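/- Consider a discounted Markov decision process with measurable state space $\mathcal S$, finite action set $\mathcal A$, transition kernel $\mathsf P(\cdot|s,a)$, reward $0\le r(s,a,s')\le r_{\max}$ and discount factor $\gamma\in(0,1)$. Let $\pi_b$ be a behavior policy, and let $\mu$ be the invariant probability measure of the state-action chain $(S_t,A_t)$ generated by $\pi_b$ and $\mathsf P$. Let $\phi:\mathcal S\times\mathcal A\to\mathbb R^N$ be measurable features, $Q_\theta(s,a)=\phi_{s,a}^\top\theta$, and let $\{\pi_\theta\}_{\theta\in\mathbb R^N}$ be stationary policies. Let $$J(\theta)=\|\mathbf\Pi\mathbf T^{\pi_\theta}Q_\theta-Q_\theta\|_\mu^2,\qquad \|Q\|_\mu^2=\int Q^2\,d\mu,\qquad \mathbf T^{\pi}Q(s,a)=\mathbb E[r(s,a,S')+\gamma Q(S',A')],$$ with $S'\sim\mathsf P(\cdot|s,a)$, $A'\sim\pi(\cdot|S')$, and $\mathbf\Pi$ the $\|\cdot\|_\mu$-projection onto $\{Q_w:w\in\mathbb R^N\}$. Put $\bar V_{s'}(\theta)=\sum_{a'}\pi_\theta(a'|s')\theta^\top\phi_{s',a'}$ and $\delta_{s,a,s'}(\theta)=r(s,a,s')+\gamma\bar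 V_{s'}(\theta)-\theta^\top\phi_{s,a}$. Along a single trajectory $(S_t,A_t)_{t\ge0}$ generated by $\pi_b$ and $\mathsf P$, Greedy-GQ computes, from initial values $\theta_0,\omega_0$ and with $\phi_t=\phi_{S_t,A_t}$, $\delta_{t+1}=\delta_{S_t,A_t,S_{t+1}}$, $$\theta_{t+1}=\theta_t+\alpha_t\bigl(\delta_{t+1}(\theta_t)\phi_t-\gamma(\omega_t^\top\phi_t)\nabla\bar V_{S_{t+1}}(\theta_t)\bigr),\qquad \omega_{t+1}=\omega_t+\beta_t\bigl(\delta_{t+1}(\theta_t)-\phi_t^\top\omega_t\bigr)\phi_t .$$ Assume: (i) $C=\mathbb E_\mu[\phi\phi^\top]$ is non-singular; (ii) $\|\phi_{s,a}\|_2\le1$ for all $(s,a)$; (iii) for some $m>0$, $\rho\in(0,1)$, the total-variation distance between the law of $S_t$ given $S_0=s$ and the state marginal of $\mu$ is at most $m\rho^t$ for all $s$ and all $t>0$; (iv) for all $(s,a)$ the map $\theta\mapsto\pi_\theta(a|s)$ is differentiable with gradient bounded by $k_1$ and $k_2$-Lipschitz; (v) the iterates are bounded: $\|\theta_t\|\le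 R$ and $\|\omega_t\|\le R$ almost surely for $t\le T$, with a constant $R$ not depending on $T$. Take the constant stepsizes $\alpha_t=T^{-a}$, $\beta_t=T^{-b}$ with $a=\tfrac23$, $b=\tfrac13$. Fix $k_0\in\{0,1\}$, and let $M$ be independent of the trajectory, with values in $\{k_0,\dots,T\}$ and $\mathbb P(M=k)=\alpha_k/\sum_{t=k_0}^T\alpha_t$. Then $J$ is differentiable and $$\mathbb E\bigl[\|\nabla J(\theta_M)\|^2\bigr]=\mathcal O\!\left(\frac{\log T}{T^{1/3}}\right),$$ that is, there is a constant $K$, independent of $T$, with $\mathbb E[\|\nabla J(\theta_M)\|^2]\le K\log T/T^{1/3}$ for all $T\ge2$. Moreover this choice is the best one for the bound $B_{a,b}(T)=\frac1{T^{1-a}}+\frac{\log T}{T^{\min\{b,a-b\}}}$ over $\frac12<a\le1$, $0<b\le a$: one has $B_{2/3,1/3}(T)=\Theta(\log T/T^{1/3})$, and $B_{2/3,1/3}=o(B_{a,b})$ as $T\to\infty$ for every other admissible $(a,b)$. -/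

import Mathlib

open MeasureTheory ProbabilityTheory Filter Asymptotics

noncomputable section

/-- A discounted Markov decision process with state space `S` and action set `A`:
transition kernel, bounded reward `r(s, a, s')` and discount factor `γ ∈ (0, 1)`. -/
structure MDP (S A : Type*) [MeasurableSpace S] [MeasurableSpace A] where
  P : Kernel (S × A) S
  markov : IsMarkovKernel P
  r : S → A → S → ℝ
  measurable_r : Measurable fun x : S × A × S => r x.1 x.2.1 x.2.2
  rmax : ℝ
  r_nonneg : ∀ s a s', 0 ≤ r s a s'
  r_le : ∀ s a s', r s a s' ≤ rmax
  γ : ℝ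
  γ_pos : 0 < γ
  γ_lt_one : γ < 1

attribute [instance] MDP.markov

namespace MDP

variable {S A : Type*} [MeasurableSpace S] [MeasurableSpace A]

/-- The state chain `S_t` under the policy `πb`: from `s`, draw `a ∼ πb(·|s)`, then
`s' ∼ P(·|s,a)`. -/
def stateKernel (m : MDP S A) (πb : Kernel S A) : Kernel S S :=
  m.P ∘ₖ (Kernel.id ×ₖ πb)

/-- The state-action chain `(S_t, A_t)` under the policy `πb`: from `(s, a)`, draw
`s' ∼ P(·|s,a)`, then `a' ∼ πb(·|s')`. -/
def pairKernel (m : MDP S A) (πb : Kernel S A) : Kernel (S × A) (S × A) :=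
  (Kernel.id ×ₖ πb) ∘ₖ m.P

/-- Total-variation distance of two probability measures. -/
def tvDist (ν₁ ν₂ : Measure S) : ℝ :=
  ⨆ U : {U : Set S // MeasurableSet U}, |ν₁.real U.1 - ν₂.real U.1|

/-- Geometric uniform ergodicity of the state chain under `πb`: the law of `S_t` started from
any `s` is within `c ρ ^ t` of `ν`. -/
def GeomErgodic (m : MDP S A) (πb : Kernel S A) (ν : Measure S) (c ρ : ℝ) : Prop :=
  ∀ s : S, ∀ t : ℕ, 0 < t → tvDist ((m.stateKernel πb ^ t) s) ν ≤ c * ρ ^ t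

/-- `(S_t, A_t)` is a single sample trajectory of the MDP generated by the behavior policy `πb`:
given the past and `S_t`, the action `A_t` has law `πb(·|S_t)`; given the past, `S_t` and `A_t`,
the state `S_{t+1}` has law `P(·|S_t, A_t)`. The law of `S_0` is arbitrary. -/
structure IsTrajectory (m : MDP S A) (πb : Kernel S A) {Ω : Type*} [MeasurableSpace Ω]
    (Pr : Measure Ω) (st : ℕ → Ω → S) (ac : ℕ → Ω → A) : Prop where
  measurable_state : ∀ t, Measurable (st t)
  measurable_action : ∀ t, Measurable (ac t)
  action_law : ∀ t, HasCondDistrib (ac t)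
    (fun ω => ((fun i : Fin t => (st i ω, ac i ω)), st t ω))
    (Kernel.prodMkLeft (Fin t → S × A) πb) Pr
  state_law : ∀ t, HasCondDistrib (st (t + 1))
    (fun ω => ((fun i : Fin t => (st i ω, ac i ω)), (st t ω, ac t ω)))
    (Kernel.prodMkLeft (Fin t → S × A) m.P) Pr

/-- The Bellman operator of a policy `π`:
`(T^π Q)(s,a) = E[r(s,a,S') + γ Q(S',A')]` with `S' ∼ P(·|s,a)` and `A' ∼ π(·|S')`. -/
def bellman [Fintype A] (m : MDP S A) (π : Kernel S A) (Q : S × A → ℝ) (x : S × A) : ℝ :=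
  ∫ s', (m.r x.1 x.2 s' + m.γ * ∑ a', (π s').real {a'} * Q (s', a')) ∂(m.P x)

end MDP

section LinearApproximation

variable {S A : Type*} [MeasurableSpace S] [MeasurableSpace A] {N : ℕ}

/-- The linear action-value function `Q_θ(s,a) = φ_{s,a}ᵀ θ`. -/
def linQ (φ : S × A → EuclideanSpace ℝ (Fin N)) (θ : EuclideanSpace ℝ (Fin N))
    (x : S × A) : ℝ :=
  inner ℝ (φ x) θ

/-- The matrix `C = E_μ[φ φᵀ]`. -/
def featureMatrix (φ : S × A → EuclideanSpace ℝ (Fin N)) (μ : Measure (S × A)) :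
    Matrix (Fin N) (Fin N) ℝ :=
  Matrix.of fun i j => ∫ x, φ x i * φ x j ∂μ

/-- A coefficient vector of the `L²(μ)`-projection of `f` onto the linear function class
`{Q_w}`, that is, a minimizer of `w ↦ ‖Q_w - f‖²_μ`. -/
def projCoef (φ : S × A → EuclideanSpace ℝ (Fin N)) (μ : Measure (S × A)) (f : S × A → ℝ) :
    EuclideanSpace ℝ (Fin N) :=
  Classical.epsilon fun w => ∀ v, ∫ x, (linQ φ w x - f x) ^ 2 ∂μ ≤ ∫ x, (linQ φ v x - f x) ^ 2 ∂μ

/-- The mean squared projected Bellman error `J(θ) = ‖Π T^{π_θ} Q_θ - Q_θ‖²_μ`. -/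
def MSPBE [Fintype A] (m : MDP S A) (φ : S × A → EuclideanSpace ℝ (Fin N))
    (π : EuclideanSpace ℝ (Fin N) → Kernel S A) (μ : Measure (S × A))
    (θ : EuclideanSpace ℝ (Fin N)) : ℝ :=
  ∫ x, (linQ φ (projCoef φ μ (m.bellman (π θ) (linQ φ θ))) x - linQ φ θ x) ^ 2 ∂μ

/-- `V̄_{s'}(θ) = ∑_{a'} π_θ(a'|s') θᵀ φ_{s',a'}`. -/
def Vbar [Fintype A] (φ : S × A → EuclideanSpace ℝ (Fin N))
    (π : EuclideanSpace ℝ (Fin N) → Kernel S A) (s' : S) (θ : EuclideanSpace ℝ (Fin N)) : ℝ :=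
  ∑ a', (π θ s').real {a'} * linQ φ θ (s', a')

/-- The temporal difference `δ_{s,a,s'}(θ) = r(s,a,s') + γ V̄_{s'}(θ) - θᵀ φ_{s,a}`. -/
def tdError [Fintype A] (m : MDP S A) (φ : S × A → EuclideanSpace ℝ (Fin N))
    (π : EuclideanSpace ℝ (Fin N) → Kernel S A) (θ : EuclideanSpace ℝ (Fin N))
    (s : S) (a : A) (s' : S) : ℝ :=
  m.r s a s' + m.γ * Vbar φ π s' θ - linQ φ θ (s, a)

/-- The iterates `(θ_t, ω_t)` of Greedy-GQ with stepsizes `α`, `β`, initial values `θ₀`, `ω₀`,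
along the sample path `(s_t, a_t)`. -/
def greedyGQ [Fintype A] (m : MDP S A) (φ : S × A → EuclideanSpace ℝ (Fin N))
    (π : EuclideanSpace ℝ (Fin N) → Kernel S A) (α β : ℕ → ℝ)
    (θ₀ ω₀ : EuclideanSpace ℝ (Fin N)) (s : ℕ → S) (a : ℕ → A) :
    ℕ → EuclideanSpace ℝ (Fin N) × EuclideanSpace ℝ (Fin N)
  | 0 => (θ₀, ω₀)
  | t + 1 =>
    let θ := (greedyGQ m φ π α β θ₀ ω₀ s a t).1
    let ω := (greedyGQ m φ π α β θ₀ ω₀ s a t).2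
    let φt := φ (s t, a t)
    let δ := tdError m φ π θ (s t) (a t) (s (t + 1))
    let φhat := gradient (Vbar φ π (s (t + 1))) θ
    (θ + α t • (δ • φt - (m.γ * inner ℝ ω φt) • φhat),
      ω + β t • ((δ - inner ℝ φt ω) • φt))

/-- Smoothness of the policy class: `θ ↦ π_θ(a|s)` is differentiable, its gradient is bounded by
`k₁` and is `k₂`-Lipschitz, for every `(s, a)`. -/
structure SmoothPolicy (π : EuclideanSpace ℝ (Fin N) → Kernel S A) (k₁ k₂ : ℝ) : Prop where
  differentiable : ∀ s a, Differentiable ℝ fun θ => (π θ s).real {a}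
  gradient_le : ∀ s a θ, ‖gradient (fun θ => (π θ s).real {a}) θ‖ ≤ k₁
  gradient_lipschitz : ∀ s a θ₁ θ₂,
    ‖gradient (fun θ => (π θ s).real {a}) θ₁ - gradient (fun θ => (π θ s).real {a}) θ₂‖
      ≤ k₂ * ‖θ₁ - θ₂‖

end LinearApproximation

/-- `M` takes values in `{k₀, …, T}` with `Pr(M = k) = α_k / ∑_{t=k₀}^T α_t`. -/
structure IsStepSizeWeighted {Ω : Type*} [MeasurableSpace Ω] (Pr : Measure Ω) (M : Ω → ℕ)
    (α : ℕ → ℝ) (k₀ T : ℕ) : Prop where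
  measurable : Measurable M
  prob_eq : ∀ k ∈ Finset.Icc k₀ T, Pr.real {ω | M ω = k} = α k / ∑ t ∈ Finset.Icc k₀ T, α t

/-- The bound `1 / T^(1-a) + log T / T^(min {b, a-b})` for the stepsizes `α_t = 1 / T^a`,
`β_t = 1 / T^b`. -/
def rateBound (a b : ℝ) (T : ℕ) : ℝ :=
  1 / (T : ℝ) ^ (1 - a) + Real.log T / (T : ℝ) ^ min b (a - b)

end

/-! Write b(θ) = E_μ[δ(θ) φ] and ω*(θ) = C⁻¹ b(θ). The normal equations give Π T Q_θ = Q_{θ +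
ω*(θ)}, so J(θ) = ‖Q_{ω*(θ)}‖²_μ = ⟨b, C⁻¹ b⟩ (`projCoef_eq`, `MSPBE_eq`). On balls, b and ω* are
Lipschitz and δ has a second-order Taylor bound uniform in the transition, hence so does J, with the
explicit gradient `gradMSPBE` (`exists_MSPBE_taylor`).

Greedy-GQ is then a two-time-scale scheme. The stationary mean of the ω-increment is -C (ω - ω*(θ)),
and C is coercive, so ω tracks ω*(θ). The stationary mean of the θ-increment is -½ ∇J(θ) plus an
error linear in y = ω - ω*(θ). This gives two coupled drift inequalities, one for J
(`exists_MSPBE_step_le`) and one for ‖y‖² (`exists_trackErr_step_le`). Each carries a centred noise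
term, which is not a martingale difference because the samples come from one Markov trajectory.

The noise is controlled by a Poisson equation (`abs_sum_integral_le_of_geomErgodic`): geometric
ergodicity turns a centred function of the current state into a telescoping difference, a correction
of the size of the movement of the iterates, and a negligible tail. With steps of size at most η the
T expectations therefore sum to O(1 + Tη), without the logarithm that a mixing-time argument would
cost.

With p = T^{1/3} the stepsizes are p⁻² and p⁻¹ over p³ steps. Summing the drifts first bounds ∑
E‖y‖² and then ∑ E‖∇J‖² by O(p²) (`sum_le_of_drift`). The output index is independent of the path
and essentially uniform, so its expected squared gradient is O(p²/p³) = O(T^{-1/3}); the factor log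
T is only needed to match the claimed form. Optimality of the exponents is elementary: both terms of
the bound have polynomial order T^{-1/3} only at (2/3, 1/3), and elsewhere one of them dominates. -/

noncomputable section

set_option linter.unusedSectionVars false

/-! ### Markov noise along a geometrically ergodic chain. -/

section MarkovNoise

theorem integrable_of_measurable_of_abs_le {Ω : Type*} [MeasurableSpace Ω] {Pr : Measure Ω}
    [IsFiniteMeasure Pr] {f : Ω → ℝ} (hf : Measurable f) {B : ℝ} (hB : ∀ ω, |f ω| ≤ B) :
    Integrable f Pr :=
  Integrable.of_bound hf.aestronglyMeasurable B (ae_of_all _ hB)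

theorem abs_integral_le_of_abs_le {Ω : Type*} [MeasurableSpace Ω] {Pr : Measure Ω}
    [IsProbabilityMeasure Pr] {f : Ω → ℝ} {B : ℝ} (hB : ∀ᵐ ω ∂Pr, |f ω| ≤ B) :
    |∫ ω, f ω ∂Pr| ≤ B := by
  simpa using norm_integral_le_of_norm_le_const (μ := Pr) (f := f) (C := B) hB

variable {S : Type*} [MeasurableSpace S]

theorem abs_real_sub_le_tvDist (ν₁ ν₂ : Measure S) [IsProbabilityMeasure ν₁]
    [IsProbabilityMeasure ν₂] {U : Set S} (hU : MeasurableSet U) :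
    |ν₁.real U - ν₂.real U| ≤ MDP.tvDist ν₁ ν₂ := by
  refine le_ciSup (f := fun U : {U : Set S // MeasurableSet U} => |ν₁.real U.1 - ν₂.real U.1|)
    ⟨1, ?_⟩ ⟨U, hU⟩
  rintro _ ⟨V, rfl⟩
  have h1 : ν₁.real V.1 ≤ 1 := measureReal_le_one
  have h2 : ν₂.real V.1 ≤ 1 := measureReal_le_one
  have h3 : 0 ≤ ν₁.real V.1 := measureReal_nonneg
  have h4 : 0 ≤ ν₂.real V.1 := measureReal_nonneg
  exact abs_le.2 ⟨by linarith, by linarith⟩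

/-- A function bounded by `B` integrates over two probability measures to values that differ by
at most `2 B` times their total-variation distance. -/
theorem abs_integral_sub_le_tvDist (ν₁ ν₂ : Measure S) [IsProbabilityMeasure ν₁]
    [IsProbabilityMeasure ν₂] {f : S → ℝ} (hf : Measurable f) {B : ℝ} (hB : ∀ s, |f s| ≤ B) :
    |∫ s, f s ∂ν₁ - ∫ s, f s ∂ν₂| ≤ 2 * B * MDP.tvDist ν₁ ν₂ := by
  have hS : Nonempty S := nonempty_of_isProbabilityMeasure ν₁
  have hB0 : 0 ≤ B := (abs_nonneg _).trans (hB hS.some)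
  have hfi : ∀ (ν : Measure S) [IsProbabilityMeasure ν], Integrable f ν := fun ν _ =>
    integrable_of_measurable_of_abs_le hf hB
  -- Layer-cake formula for f + B, which takes values in [0, 2B]. It reduces the claim to superlevel
  -- sets, and the length of the interval gives the factor 2B.
  have layer : ∀ (ν : Measure S) [IsProbabilityMeasure ν],
      ∫ s, f s ∂ν + B = ∫ t in Set.Ioc 0 (2 * B), ν.real {s | t ≤ f s + B} := by
    intro ν _
    rw [← ((hfi ν).add (integrable_const B)).integral_eq_integral_Ioc_meas_le
      (f := fun s => f s + B) (ae_of_all _ fun s => ?_) (ae_of_all _ fun s => ?_),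
      integral_add (hfi ν) (integrable_const B)]
    · simp
    · have := (abs_le.1 (hB s)).1
      simp only [Pi.zero_apply]; linarith
    · have := (abs_le.1 (hB s)).2
      show f s + B ≤ 2 * B
      linarith
  have hint : ∀ (ν : Measure S) [IsProbabilityMeasure ν],
      IntegrableOn (fun t => ν.real {s | t ≤ f s + B}) (Set.Ioc 0 (2 * B)) := by
    intro ν _
    refine Integrable.of_bound (C := 1) (Measurable.aestronglyMeasurable ?_)
      (ae_of_all _ fun t => ?_)
    · refine Measurable.ennreal_toReal (Antitone.measurable fun a b hab => ?_)
      exact measure_mono fun s (hs : b ≤ _) => hab.trans hs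
    · rw [Real.norm_eq_abs, abs_of_nonneg measureReal_nonneg]
      exact measureReal_le_one
  have key : ∫ s, f s ∂ν₁ - ∫ s, f s ∂ν₂ = ∫ t in Set.Ioc 0 (2 * B),
      (ν₁.real {s | t ≤ f s + B} - ν₂.real {s | t ≤ f s + B}) := by
    rw [integral_sub (hint ν₁) (hint ν₂), ← layer, ← layer]; ring
  rw [key]
  have := norm_setIntegral_le_of_norm_le_const (μ := volume) (s := Set.Ioc 0 (2 * B))
    (f := fun t => ν₁.real {s | t ≤ f s + B} - ν₂.real {s | t ≤ f s + B})
    (C := MDP.tvDist ν₁ ν₂) measure_Ioc_lt_top (fun t _ => abs_real_sub_le_tvDist ν₁ ν₂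
      (measurableSet_le measurable_const (hf.add_const B)))
  rw [Real.norm_eq_abs] at this
  refine this.trans_eq ?_
  rw [Real.volume_real_Ioc_of_le (by linarith)]; ring

theorem isMarkovKernel_pow (K : Kernel S S) [IsMarkovKernel K] (n : ℕ) :
    IsMarkovKernel (K ^ n) := by
  induction n with
  | zero => rw [pow_zero]; exact inferInstanceAs (IsMarkovKernel Kernel.id)
  | succ n ih =>
    rw [pow_succ]
    exact inferInstanceAs (IsMarkovKernel ((K ^ n) ∘ₖ K))

theorem measurable_integral_kernel_param {Z Y : Type*} [MeasurableSpace Z] [MeasurableSpace Y]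
    (κ : Kernel S Y) [IsSFiniteKernel κ] {g : Z × Y → ℝ} (hg : Measurable g) :
    Measurable fun p : Z × S => ∫ y, g (p.1, y) ∂(κ p.2) := by
  have := StronglyMeasurable.integral_kernel_prod_right (κ := Kernel.prodMkLeft Z κ)
    (f := fun (p : Z × S) y => g (p.1, y)) (Measurable.stronglyMeasurable (by
      simp only [Function.uncurry_def]; fun_prop))
  simpa using this.measurable

theorem integral_pow_succ (K : Kernel S S) [IsMarkovKernel K] (n : ℕ) (s : S) {f : S → ℝ}
    (hf : Measurable f) {B : ℝ} (hB : ∀ s, |f s| ≤ B) :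
    ∫ s', f s' ∂((K ^ (n + 1)) s) = ∫ s₁, ∫ s', f s' ∂((K ^ n) s₁) ∂(K s) := by
  have := isMarkovKernel_pow K n
  have h : K ^ (n + 1) = (K ^ n) ∘ₖ K := pow_succ K n
  rw [h]
  exact Kernel.integral_comp (integrable_of_measurable_of_abs_le hf hB)

/-- Along a geometrically ergodic chain `s`, the expectations of a bounded function `g (z_t, s_t)`
that is stationary-centred and Lipschitz in the slowly moving parameter `z_t` sum to at most a
constant plus a multiple of the total parameter movement. -/
theorem abs_sum_integral_le_of_geomErgodic {Z Ω : Type*} [NormedAddCommGroup Z] [MeasurableSpace Z]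
    [MeasurableSpace Ω] (K : Kernel S S) [IsMarkovKernel K] (ν : Measure S)
    [IsProbabilityMeasure ν] {c ρ : ℝ} (hc : 0 ≤ c) (hρ : 0 ≤ ρ) (hρ' : ρ < 1)
    (hK : ∀ s, ∀ t : ℕ, 0 < t → MDP.tvDist ((K ^ t) s) ν ≤ c * ρ ^ t)
    {D : Set Z} {g : Z × S → ℝ} (hg : Measurable g) {B : ℝ} (hB0 : 0 ≤ B)
    (hB : ∀ p, |g p| ≤ B)
    (hL : ∀ z ∈ D, ∀ z' ∈ D, ∀ s, |g (z, s) - g (z', s)| ≤ B * ‖z - z'‖)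
    (h0 : ∀ z ∈ D, ∫ s, g (z, s) ∂ν = 0)
    (Pr : Measure Ω) [IsProbabilityMeasure Pr] {z : ℕ → Ω → Z} {s : ℕ → Ω → S}
    (hz : ∀ t, Measurable (z t)) (hs : ∀ t, Measurable (s t))
    (hstep : ∀ t, ∀ f : Z × S → ℝ, Measurable f → ∀ C : ℝ, (∀ p, |f p| ≤ C) →
      ∫ ω, f (z t ω, s (t + 1) ω) ∂Pr = ∫ ω, ∫ s', f (z t ω, s') ∂(K (s t ω)) ∂Pr)
    (T : ℕ) {η : ℝ} (hη : 0 ≤ η) (hD : ∀ᵐ ω ∂Pr, ∀ t ≤ T, z t ω ∈ D)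
    (hmove : ∀ t < T, ∀ᵐ ω ∂Pr, ‖z (t + 1) ω - z t ω‖ ≤ η) :
    |∑ t ∈ Finset.range T, ∫ ω, g (z t ω, s t ω) ∂Pr|
      ≤ 2 * (1 + 2 * c / (1 - ρ)) * B * (1 + T * η) := by
  -- Bounds the sum over k of the decay of a centred function bounded by 1: the term k = 0, about
  -- which ergodicity says nothing, contributes 1, and the rest is a geometric series.
  set Γ : ℝ := 1 + 2 * c / (1 - ρ) with hΓ
  have hρ1 : 0 < 1 - ρ := by linarith
  have hΓ0 : 0 ≤ Γ := by positivity
  let P : ℕ → Z × S → ℝ := fun k p => ∫ s', g (p.1, s') ∂((K ^ k) p.2)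
  have hmk : ∀ k, IsMarkovKernel (K ^ k) := isMarkovKernel_pow K
  have hPm : ∀ k, Measurable (P k) := fun k => measurable_integral_kernel_param (K ^ k) hg
  have hgs : ∀ z, Measurable fun s => g (z, s) := fun z => hg.comp measurable_prodMk_left
  have hPB : ∀ k p, |P k p| ≤ B := fun k p =>
    abs_integral_le_of_abs_le (ae_of_all _ fun s' => hB (p.1, s'))
  -- geometric decay of centred functions
  have decay : ∀ f : S → ℝ, Measurable f → ∀ C : ℝ, 0 ≤ C → (∀ s, |f s| ≤ C) →
      ∫ s, f s ∂ν = 0 → ∀ k, 0 < k → ∀ s₀, |∫ s', f s' ∂((K ^ k) s₀)| ≤ 2 * C * (c * ρ ^ k) := by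
    intro f hf C hC0 hC hf0 k hk s₀
    have := abs_integral_sub_le_tvDist ((K ^ k) s₀) ν hf hC
    rw [hf0, sub_zero] at this
    exact this.trans (mul_le_mul_of_nonneg_left (hK s₀ k hk) (by positivity))
  have geom : ∀ n, ∑ k ∈ Finset.range n, ρ ^ k ≤ 1 / (1 - ρ) := by
    intro n
    have := geom_sum_Ico_le_of_lt_one (m := 0) (n := n) hρ hρ'
    simpa using this
  have sumdecay : ∀ f : S → ℝ, Measurable f → ∀ C : ℝ, 0 ≤ C → (∀ s, |f s| ≤ C) →
      ∫ s, f s ∂ν = 0 → ∀ n s₀, |∑ k ∈ Finset.range n, ∫ s', f s' ∂((K ^ k) s₀)| ≤ Γ * C := by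
    intro f hf C hC0 hC hf0 n s₀
    have hterm : ∀ k, |∫ s', f s' ∂((K ^ k) s₀)| ≤ (if k = 0 then C else 0) + 2 * C * c * ρ ^ k := by
      intro k
      rcases Nat.eq_zero_or_pos k with rfl | hk
      · have := abs_integral_le_of_abs_le (Pr := (K ^ 0) s₀) (f := f) (ae_of_all _ hC)
        have h2 : 0 ≤ 2 * C * c * ρ ^ 0 := by positivity
        simp only [if_true]; linarith
      · rw [if_neg hk.ne']
        have := decay f hf C hC0 hC hf0 k hk s₀
        linarith
    calc |∑ k ∈ Finset.range n, ∫ s', f s' ∂((K ^ k) s₀)|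
        ≤ ∑ k ∈ Finset.range n, |∫ s', f s' ∂((K ^ k) s₀)| := Finset.abs_sum_le_sum_abs _ _
      _ ≤ ∑ k ∈ Finset.range n, ((if k = 0 then C else 0) + 2 * C * c * ρ ^ k) :=
          Finset.sum_le_sum fun k _ => hterm k
      _ = (∑ k ∈ Finset.range n, if k = 0 then C else 0)
            + 2 * C * c * ∑ k ∈ Finset.range n, ρ ^ k := by
          rw [Finset.sum_add_distrib, Finset.mul_sum]
      _ ≤ C + 2 * C * c * (1 / (1 - ρ)) := by
          gcongr
          · rw [Finset.sum_ite_eq']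
            split_ifs <;> simp [hC0]
          · exact geom n
      _ = Γ * C := by rw [hΓ]; ring
  -- truncated solution of the Poisson equation
  have key : ∀ n, 0 < n → |∑ t ∈ Finset.range T, ∫ ω, g (z t ω, s t ω) ∂Pr|
      ≤ 2 * Γ * B + T * (Γ * (B * η)) + T * (2 * B * (c * ρ ^ n)) := by
    intro n hn
    let u : Z × S → ℝ := fun p => ∑ k ∈ Finset.range n, P k p
    have hum : Measurable u := Finset.measurable_sum _ fun k _ => hPm k
    -- This bound grows with n but holds everywhere, also where g is not centred. It serves only
    -- integrability and the one-step Markov identity; the quantitative bound on `D` is the uniform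
    -- one below.
    have huB' : ∀ p, |u p| ≤ n * B := by
      intro p
      refine (Finset.abs_sum_le_sum_abs _ _).trans ?_
      refine (Finset.sum_le_sum fun k _ => hPB k p).trans ?_
      simp
    have huB : ∀ z ∈ D, ∀ s, |u (z, s)| ≤ Γ * B := fun z hz s =>
      sumdecay _ (hgs z) B hB0 (fun s => hB _) (h0 z hz) n s
    have hgi : ∀ z (κ : Measure S) [IsProbabilityMeasure κ], Integrable (fun s => g (z, s)) κ :=
      fun z κ _ => integrable_of_measurable_of_abs_le (hgs z) fun s => hB _
    have huL : ∀ z ∈ D, ∀ z' ∈ D, ∀ s, |u (z, s) - u (z', s)| ≤ Γ * (B * ‖z - z'‖) := by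
      intro z hz z' hz' s
      have h1 : u (z, s) - u (z', s)
          = ∑ k ∈ Finset.range n, ∫ s', (g (z, s') - g (z', s')) ∂((K ^ k) s) := by
        simp only [u, P, ← Finset.sum_sub_distrib]
        refine Finset.sum_congr rfl fun k _ => ?_
        rw [integral_sub (hgi z _) (hgi z' _)]
      rw [h1]
      refine sumdecay _ ((hgs z).sub (hgs z')) _ (by positivity) (fun s => hL z hz z' hz' s) ?_ n s
      simp only [Pi.sub_apply]
      rw [integral_sub (hgi z _) (hgi z' _), h0 z hz, h0 z' hz', sub_zero]
    -- Since u = ∑_{k<n} Kᵏg, the difference u - Ku telescopes to g - Kⁿg.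
    have hpoisson : ∀ p : Z × S, g p = u p - ∫ s', u (p.1, s') ∂(K p.2) + P n p := by
      intro p
      have h1 : ∫ s', u (p.1, s') ∂(K p.2) = ∑ k ∈ Finset.range n, P (k + 1) p := by
        simp only [u]
        rw [integral_finsetSum]
        · refine Finset.sum_congr rfl fun k _ => ?_
          exact (integral_pow_succ K k p.2 (hgs p.1) (fun s => hB _)).symm
        · intro k _
          exact integrable_of_measurable_of_abs_le ((hPm k).comp measurable_prodMk_left)
            fun s => hPB k _
      have h2 := Finset.sum_range_succ' (fun k => P k p) n
      rw [Finset.sum_range_succ] at h2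
      have h3 : P 0 p = g p := by
        simp only [P, pow_zero]
        have : (1 : Kernel S S) = Kernel.id := rfl
        rw [this, Kernel.id_apply]
        exact integral_dirac' _ _ (hgs p.1).stronglyMeasurable
      rw [h1]; simp only [u]; linarith
    have hm1 : ∀ t, Measurable fun ω => (z t ω, s t ω) := fun t => (hz t).prodMk (hs t)
    have hm2 : ∀ t, Measurable fun ω => (z t ω, s (t + 1) ω) := fun t => (hz t).prodMk (hs _)
    have hi1 : ∀ t, Integrable (fun ω => u (z t ω, s t ω)) Pr := fun t =>
      integrable_of_measurable_of_abs_le (hum.comp (hm1 t)) fun ω => huB' _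
    have hi2 : ∀ t, Integrable (fun ω => u (z t ω, s (t + 1) ω)) Pr := fun t =>
      integrable_of_measurable_of_abs_le (hum.comp (hm2 t)) fun ω => huB' _
    have hi3 : ∀ t, Integrable (fun ω => P n (z t ω, s t ω)) Pr := fun t =>
      integrable_of_measurable_of_abs_le ((hPm n).comp (hm1 t)) fun ω => hPB n _
    have hi4 : ∀ t, Integrable (fun ω => ∫ s', u (z t ω, s') ∂(K (s t ω))) Pr := fun t =>
      integrable_of_measurable_of_abs_le (B := n * B)
        ((measurable_integral_kernel_param K hum).comp (hm1 t)) fun ω =>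
          abs_integral_le_of_abs_le (ae_of_all _ fun s' => huB' _)
    -- In expectation Ku(z_t, s_t) equals u(z_t, s_{t+1}). Replacing z_t by z_{t+1} there makes the
    -- main part telescope in t, and the replacement costs the parameter movement.
    have hterm : ∀ t, ∫ ω, g (z t ω, s t ω) ∂Pr
        = (∫ ω, u (z t ω, s t ω) ∂Pr - ∫ ω, u (z (t + 1) ω, s (t + 1) ω) ∂Pr)
          + ∫ ω, (u (z (t + 1) ω, s (t + 1) ω) - u (z t ω, s (t + 1) ω)) ∂Pr
          + ∫ ω, P n (z t ω, s t ω) ∂Pr := by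
      intro t
      rw [integral_sub (hi1 (t + 1)) (hi2 t), hstep t u hum _ huB']
      have : ∀ ω, g (z t ω, s t ω) = u (z t ω, s t ω) - ∫ s', u (z t ω, s') ∂(K (s t ω))
          + P n (z t ω, s t ω) := fun ω => hpoisson _
      simp_rw [this]
      rw [integral_add (f := fun ω => u (z t ω, s t ω) - ∫ s', u (z t ω, s') ∂(K (s t ω)))
        ((hi1 t).sub (hi4 t)) (hi3 t), integral_sub (hi1 t) (hi4 t)]
      ring
    have hb1 : ∀ t ≤ T, |∫ ω, u (z t ω, s t ω) ∂Pr| ≤ Γ * B := by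
      intro t ht
      refine abs_integral_le_of_abs_le ?_
      filter_upwards [hD] with ω hω using huB _ (hω t ht) _
    have hb2 : ∀ t < T, |∫ ω, (u (z (t + 1) ω, s (t + 1) ω) - u (z t ω, s (t + 1) ω)) ∂Pr|
        ≤ Γ * (B * η) := by
      intro t ht
      refine abs_integral_le_of_abs_le ?_
      filter_upwards [hD, hmove t ht] with ω hω hmω
      refine (huL _ (hω _ ht) _ (hω _ ht.le) _).trans ?_
      gcongr
    have hb3 : ∀ t < T, |∫ ω, P n (z t ω, s t ω) ∂Pr| ≤ 2 * B * (c * ρ ^ n) := by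
      intro t ht
      refine abs_integral_le_of_abs_le ?_
      filter_upwards [hD] with ω hω
      exact decay _ (hgs _) B hB0 (fun s => hB _) (h0 _ (hω t ht.le)) n hn _
    simp_rw [hterm]
    rw [Finset.sum_add_distrib, Finset.sum_add_distrib, Finset.sum_range_sub']
    refine (abs_add_le _ _).trans (add_le_add ((abs_add_le _ _).trans (add_le_add ?_ ?_)) ?_)
    · refine (abs_sub _ _).trans ?_
      have h1 := hb1 0 (Nat.zero_le _)
      have h2 := hb1 T le_rfl
      linarith
    · refine (Finset.abs_sum_le_sum_abs _ _).trans ?_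
      refine (Finset.sum_le_sum fun t ht => hb2 t (Finset.mem_range.1 ht)).trans ?_
      simp
    · refine (Finset.abs_sum_le_sum_abs _ _).trans ?_
      refine (Finset.sum_le_sum fun t ht => hb3 t (Finset.mem_range.1 ht)).trans ?_
      simp
  -- Only the tail depends on the truncation level, so n → ∞ removes it.
  have hlim : Tendsto (fun n : ℕ => 2 * Γ * B + T * (Γ * (B * η)) + T * (2 * B * (c * ρ ^ n)))
      atTop (nhds (2 * Γ * B + T * (Γ * (B * η)) + T * (2 * B * (c * 0)))) :=
    ((((tendsto_pow_atTop_nhds_zero_of_lt_one hρ hρ').const_mul c).const_mul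
      (2 * B)).const_mul (T : ℝ)).const_add _
  have := ge_of_tendsto hlim (eventually_atTop.2 ⟨1, fun n hn => key n hn⟩)
  refine this.trans ?_
  have : 0 ≤ T * (Γ * (B * η)) := by positivity
  nlinarith

end MarkovNoise

/-! ### Calculus of bounded Lipschitz families, and Taylor estimates. -/

section BddLip

/-- `f : Z → X → V` is bounded and Lipschitz in its first argument on `D`, uniformly in the
second. -/
def BddLipOn {Z X V : Type*} [NormedAddCommGroup Z] [NormedAddCommGroup V] (D : Set Z)
    (f : Z → X → V) : Prop :=
  ∃ B : ℝ, 0 ≤ B ∧ ∀ x, ∀ z ∈ D, ‖f z x‖ ≤ B ∧ ∀ z' ∈ D, ‖f z x - f z' x‖ ≤ B * ‖z - z'‖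

namespace BddLipOn

variable {Z X Y V W : Type*} [NormedAddCommGroup Z] [NormedAddCommGroup V] [NormedAddCommGroup W]
  {D : Set Z}

theorem of_index {h : X → V} {B : ℝ} (hB : ∀ x, ‖h x‖ ≤ B) :
    BddLipOn D fun (_ : Z) x => h x := by
  refine ⟨|B|, abs_nonneg _, fun x z _ => ⟨(hB x).trans (le_abs_self _), fun z' _ => ?_⟩⟩
  simp only [sub_self, norm_zero]; positivity

theorem of_param {p : Z → V} {r : ℝ} (hr : ∀ z ∈ D, ‖p z‖ ≤ r)
    (hp : ∀ z ∈ D, ∀ z' ∈ D, ‖p z - p z'‖ ≤ ‖z - z'‖) :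
    BddLipOn D fun z (_ : X) => p z := by
  refine ⟨max |r| 1, by positivity, fun x z hz => ⟨?_, fun z' hz' => ?_⟩⟩
  · exact (hr z hz).trans ((le_abs_self _).trans (le_max_left _ _))
  · refine (hp z hz z' hz').trans ?_
    exact le_mul_of_one_le_left (norm_nonneg _) (le_max_right _ _)

theorem add {f g : Z → X → V} (hf : BddLipOn D f) (hg : BddLipOn D g) :
    BddLipOn D fun z x => f z x + g z x := by
  obtain ⟨B, hB, hf⟩ := hf
  obtain ⟨C, hC, hg⟩ := hg
  refine ⟨B + C, by positivity, fun x z hz => ⟨?_, fun z' hz' => ?_⟩⟩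
  · exact norm_add_le_of_le (hf x z hz).1 (hg x z hz).1
  · rw [add_sub_add_comm, add_mul]
    exact norm_add_le_of_le ((hf x z hz).2 z' hz') ((hg x z hz).2 z' hz')

theorem neg {f : Z → X → V} (hf : BddLipOn D f) : BddLipOn D fun z x => -f z x := by
  obtain ⟨B, hB, hf⟩ := hf
  refine ⟨B, hB, fun x z hz => ⟨by simpa using (hf x z hz).1, fun z' hz' => ?_⟩⟩
  rw [← neg_sub', norm_neg]
  exact (hf x z hz).2 z' hz'

theorem sub {f g : Z → X → V} (hf : BddLipOn D f) (hg : BddLipOn D g) :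
    BddLipOn D fun z x => f z x - g z x := by
  simpa only [sub_eq_add_neg] using hf.add hg.neg

theorem sum {ι : Type*} (s : Finset ι) {f : ι → Z → X → V} (hf : ∀ i, BddLipOn D (f i)) :
    BddLipOn D fun z x => ∑ i ∈ s, f i z x := by
  classical
  induction s using Finset.induction_on with
  | empty => simpa using of_index (Z := Z) (D := D) (h := fun _ : X => (0 : V)) (B := 0) (by simp)
  | insert i s hi ih =>
    simp only [Finset.sum_insert hi]
    exact (hf i).add ih

/-- The product rule behind scalar multiples, products and inner products. Changing one factor at a
time costs BC each, and 2BC then serves both as bound and as Lipschitz constant. -/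
theorem bilin {U : Type*} [NormedAddCommGroup U] {b : V → W → U}
    (hb : ∀ v w, ‖b v w‖ ≤ ‖v‖ * ‖w‖) (hl : ∀ v v' w, b (v - v') w = b v w - b v' w)
    (hr : ∀ v w w', b v (w - w') = b v w - b v w')
    {f : Z → X → V} {g : Z → X → W} (hf : BddLipOn D f) (hg : BddLipOn D g) :
    BddLipOn D fun z x => b (f z x) (g z x) := by
  obtain ⟨B, hB, hf⟩ := hf
  obtain ⟨C, hC, hg⟩ := hg
  refine ⟨2 * (B * C) , by positivity, fun x z hz => ⟨?_, fun z' hz' => ?_⟩⟩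
  · refine (hb _ _).trans ?_
    have h := mul_le_mul (hf x z hz).1 (hg x z hz).1 (norm_nonneg _) hB
    have : 0 ≤ B * C := by positivity
    linarith
  · have : b (f z x) (g z x) - b (f z' x) (g z' x)
        = b (f z x - f z' x) (g z x) + b (f z' x) (g z x - g z' x) := by
      rw [hl, hr]; abel
    rw [this]
    refine (norm_add_le_of_le (hb _ _) (hb _ _)).trans ?_
    have h1 := mul_le_mul ((hf x z hz).2 z' hz') (hg x z hz).1 (norm_nonneg _)
      (by positivity)
    have h2 := mul_le_mul (hf x z' hz').1 ((hg x z hz).2 z' hz') (norm_nonneg _) hB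
    nlinarith

theorem smul [NormedSpace ℝ V] {f : Z → X → ℝ} {g : Z → X → V} (hf : BddLipOn D f)
    (hg : BddLipOn D g) : BddLipOn D fun z x => f z x • g z x :=
  bilin (b := fun (r : ℝ) (v : V) => r • v) (fun v w => (norm_smul v w).le)
    (fun v v' w => sub_smul v v' w) (fun v w w' => smul_sub v w w') hf hg

theorem mul {f g : Z → X → ℝ} (hf : BddLipOn D f) (hg : BddLipOn D g) :
    BddLipOn D fun z x => f z x * g z x :=
  hf.smul hg

theorem const_smul [NormedSpace ℝ V] (r : ℝ) {g : Z → X → V} (hg : BddLipOn D g) :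
    BddLipOn D fun z x => r • g z x :=
  (of_index (h := fun _ : X => r) (B := ‖r‖) fun _ => le_rfl).smul hg

theorem const_mul (r : ℝ) {g : Z → X → ℝ} (hg : BddLipOn D g) :
    BddLipOn D fun z x => r * g z x :=
  const_smul r hg

theorem inner [InnerProductSpace ℝ V] {f g : Z → X → V} (hf : BddLipOn D f)
    (hg : BddLipOn D g) : BddLipOn D fun z x => inner ℝ (f z x) (g z x) :=
  bilin (b := fun v w : V => Inner.inner ℝ v w) (fun v w => norm_inner_le_norm v w)
    (fun v v' w => inner_sub_left v v' w) (fun v w w' => inner_sub_right v w w') hf hg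

theorem clm [NormedSpace ℝ V] [NormedSpace ℝ W] (L : V →L[ℝ] W) {f : Z → X → V}
    (hf : BddLipOn D f) : BddLipOn D fun z x => L (f z x) := by
  obtain ⟨B, hB, hf⟩ := hf
  refine ⟨‖L‖ * B, by positivity, fun x z hz => ⟨?_, fun z' hz' => ?_⟩⟩
  · exact L.le_opNorm_of_le (hf x z hz).1
  · rw [← map_sub, mul_assoc]
    exact L.le_opNorm_of_le ((hf x z hz).2 z' hz')

theorem comp_param {Z' : Type*} [NormedAddCommGroup Z'] {D' : Set Z'} {f : Z → X → V}
    (hf : BddLipOn D f) {p : Z' → Z} (hp : ∀ z ∈ D', p z ∈ D)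
    (hp' : ∀ z ∈ D', ∀ z' ∈ D', ‖p z - p z'‖ ≤ ‖z - z'‖) :
    BddLipOn D' fun z x => f (p z) x := by
  obtain ⟨B, hB, hf⟩ := hf
  refine ⟨B, hB, fun x z hz => ⟨(hf x _ (hp z hz)).1, fun z' hz' => ?_⟩⟩
  refine ((hf x _ (hp z hz)).2 _ (hp z' hz')).trans ?_
  gcongr
  exact hp' z hz z' hz'

theorem comp_index {f : Z → X → V} (hf : BddLipOn D f) (q : Y → X) :
    BddLipOn D fun z y => f z (q y) := by
  obtain ⟨B, hB, hf⟩ := hf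
  exact ⟨B, hB, fun y z hz => hf (q y) z hz⟩

theorem integral [NormedSpace ℝ V] [MeasurableSpace X] (κ : Measure X) [IsProbabilityMeasure κ]
    {f : Z → X → V} (hf : BddLipOn D f) (hm : ∀ z, AEStronglyMeasurable (f z) κ) :
    BddLipOn D fun z (_ : Y) => ∫ x, f z x ∂κ := by
  obtain ⟨B, hB, hf⟩ := hf
  refine ⟨B, hB, fun y z hz => ⟨?_, fun z' hz' => ?_⟩⟩
  · simpa using norm_integral_le_of_norm_le_const (μ := κ) (ae_of_all _ fun x => (hf x z hz).1)
  · have hi : ∀ z ∈ D, Integrable (f z) κ := fun z hz =>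
      Integrable.of_bound (hm z) B (ae_of_all _ fun x => (hf x z hz).1)
    rw [← integral_sub (hi z hz) (hi z' hz')]
    simpa using norm_integral_le_of_norm_le_const (μ := κ)
      (ae_of_all _ fun x => (hf x z hz).2 z' hz')

end BddLipOn

/-- First-order Taylor estimate for a function with Lipschitz derivative on a convex set. -/
theorem norm_taylor_one_le {E V : Type*} [NormedAddCommGroup E] [NormedSpace ℝ E]
    [NormedAddCommGroup V] [NormedSpace ℝ V] {D : Set E} (hD : Convex ℝ D) {f : E → V}
    {f' : E → E →L[ℝ] V} (hf : ∀ x ∈ D, HasFDerivAt f (f' x) x) {L : ℝ} (hL0 : 0 ≤ L)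
    (hL : ∀ x ∈ D, ∀ y ∈ D, ‖f' x - f' y‖ ≤ L * ‖x - y‖) {x y : E} (hx : x ∈ D) (hy : y ∈ D) :
    ‖f y - f x - f' x (y - x)‖ ≤ L * ‖y - x‖ ^ 2 := by
  have hseg : segment ℝ x y ⊆ D := hD.segment_subset hx hy
  have := (convex_segment x y).norm_image_sub_le_of_norm_hasFDerivWithin_le' (f := f) (f' := f')
    (φ := f' x) (C := L * ‖y - x‖) (x := x) (y := y)
    (fun z hz => (hf z (hseg hz)).hasFDerivWithinAt) (fun z hz => ?_)
    (left_mem_segment ℝ x y) (right_mem_segment ℝ x y)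
  · exact this.trans_eq (by ring)
  · refine (hL z (hseg hz) x hx).trans ?_
    gcongr
    obtain ⟨a, b, ha, hb, hab, rfl⟩ := hz
    have : a • x + b • y - x = b • (y - x) := by
      obtain rfl : a = 1 - b := by linarith
      module
    rw [this, norm_smul, Real.norm_of_nonneg hb]
    exact mul_le_of_le_one_left (norm_nonneg _) (by linarith)

/-- A second-order remainder bound near a point gives differentiability there. -/
theorem hasFDerivAt_of_norm_sub_le_sq {E V : Type*} [NormedAddCommGroup E] [NormedSpace ℝ E]
    [NormedAddCommGroup V] [NormedSpace ℝ V] {f : E → V} {f' : E →L[ℝ] V} {x : E} {L : ℝ}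
    {D : Set E} (hD : D ∈ nhds x) (h : ∀ y ∈ D, ‖f y - f x - f' (y - x)‖ ≤ L * ‖y - x‖ ^ 2) :
    HasFDerivAt f f' x := by
  rw [hasFDerivAt_iff_isLittleO]
  have h1 : (fun y => f y - f x - f' (y - x)) =O[nhds x] fun y => ‖y - x‖ ^ 2 := by
    refine IsBigO.of_bound L ?_
    filter_upwards [hD] with y hy
    simpa using h y hy
  refine h1.trans_isLittleO ?_
  have h2 : Tendsto (fun y => y - x) (nhds x) (nhds 0) := by
    simpa using (continuous_id.sub continuous_const).tendsto (x := x) (f := fun y : E => y - x)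
  have := (isLittleO_norm_pow_id (E' := E) one_lt_two).comp_tendsto h2
  exact this

end BddLip

/-! ### Regularity and measurability of the Greedy-GQ increments. -/

section GreedyGQ

variable {S A : Type*} [MeasurableSpace S] [MeasurableSpace A] [Fintype A]
  [MeasurableSingletonClass A] {N : ℕ}

section Policy

variable {π : EuclideanSpace ℝ (Fin N) → Kernel S A} {k₁ k₂ : ℝ}

theorem bddLipOn_policy (hπ : ∀ θ, IsMarkovKernel (π θ)) (hsmooth : SmoothPolicy π k₁ k₂)
    (D : Set (EuclideanSpace ℝ (Fin N))) (a : A) :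
    BddLipOn D fun θ s => (π θ s).real {a} := by
  -- A probability is at most 1, and k₁ is a Lipschitz constant by the mean value inequality.
  refine ⟨max 1 k₁, by positivity, fun s θ _ => ⟨?_, fun θ' _ => ?_⟩⟩
  · rw [Real.norm_of_nonneg measureReal_nonneg]
    exact measureReal_le_one.trans (le_max_left _ _)
  · refine convex_univ.norm_image_sub_le_of_norm_fderiv_le (𝕜 := ℝ)
      (f := fun θ => (π θ s).real {a}) (fun x _ => hsmooth.differentiable s a x)
      (fun x _ => ?_) (Set.mem_univ _) (Set.mem_univ _)
    have := hsmooth.gradient_le s a x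
    rw [gradient, LinearIsometryEquiv.norm_map] at this
    exact this.trans (le_max_right _ _)

theorem bddLipOn_gradient_policy (hsmooth : SmoothPolicy π k₁ k₂)
    (D : Set (EuclideanSpace ℝ (Fin N))) (a : A) :
    BddLipOn D fun θ s => gradient (fun θ => (π θ s).real {a}) θ := by
  refine ⟨max |k₁| |k₂|, by positivity, fun s θ _ => ⟨?_, fun θ' _ => ?_⟩⟩
  · exact (hsmooth.gradient_le s a θ).trans ((le_abs_self _).trans (le_max_left _ _))
  · refine (hsmooth.gradient_lipschitz s a θ θ').trans ?_
    gcongr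
    exact (le_abs_self _).trans (le_max_right _ _)

/-- No joint measurability in (θ, s) is assumed: it follows from the Carathéodory criterion,
continuity in θ plus measurability in s. -/
theorem measurable_policy (hsmooth : SmoothPolicy π k₁ k₂) (a : A) :
    Measurable fun p : EuclideanSpace ℝ (Fin N) × S => (π p.1 p.2).real {a} :=
  measurable_uncurry_of_continuous_of_measurable
    (u := fun θ s => (π θ s).real {a}) (fun s => (hsmooth.differentiable s a).continuous)
    fun _ => (Kernel.measurable_coe _ (measurableSet_singleton a)).ennreal_toReal

theorem measurable_gradient_policy (hsmooth : SmoothPolicy π k₁ k₂) (a : A) :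
    Measurable fun p : EuclideanSpace ℝ (Fin N) × S =>
      gradient (fun θ => (π θ p.2).real {a}) p.1 := by
  refine measurable_uncurry_of_continuous_of_measurable
    (u := fun θ s => gradient (fun θ => (π θ s).real {a}) θ) (fun s => ?_) fun θ => ?_
  · refine (LipschitzWith.of_dist_le_mul (K := Real.toNNReal k₂) fun θ θ' => ?_).continuous
    rw [dist_eq_norm, dist_eq_norm]
    refine (hsmooth.gradient_lipschitz s a θ θ').trans ?_
    gcongr
    exact Real.le_coe_toNNReal k₂
  · let e := EuclideanSpace.basisFun (Fin N) ℝ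
    have hcoord : ∀ i, Measurable fun s =>
        inner ℝ (e i) (gradient (fun θ => (π θ s).real {a}) θ) := by
      intro i
      -- For fixed θ each coordinate of the gradient is the pointwise limit of difference quotients
      -- with increment 1/n, and these are measurable in s.
      refine measurable_of_tendsto_metrizable (f := fun (n : ℕ) s =>
        (n : ℝ) • ((π (θ + (n : ℝ)⁻¹ • e i) s).real {a} - (π θ s).real {a})) (fun n => ?_) ?_
      · have h := fun θ => (Kernel.measurable_coe (π θ) (measurableSet_singleton a)).ennreal_toReal
        exact ((h _).sub (h _)).const_mul (n : ℝ)
      · rw [tendsto_pi_nhds]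
        intro s
        have := (hsmooth.differentiable s a θ).hasFDerivAt.lim (e i) (c := fun n : ℕ => (n : ℝ))
          (l := atTop) (by simpa using tendsto_natCast_atTop_atTop)
        rw [inner_gradient_right]
        simpa using this
    have : (fun s => gradient (fun θ => (π θ s).real {a}) θ)
        = fun s => ∑ i, inner ℝ (e i) (gradient (fun θ => (π θ s).real {a}) θ) • e i := by
      funext s
      exact (e.sum_repr' _).symm
    rw [this]
    exact Finset.measurable_sum _ fun i _ => (hcoord i).smul_const _

end Policy

variable (m : MDP S A) (φ : S × A → EuclideanSpace ℝ (Fin N))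
  (π : EuclideanSpace ℝ (Fin N) → Kernel S A) {k₁ k₂ : ℝ}

/-- The increment of `θ` in a Greedy-GQ step, up to the stepsize. -/
def thetaDir (z : EuclideanSpace ℝ (Fin N) × EuclideanSpace ℝ (Fin N)) (x : (S × A) × S) :
    EuclideanSpace ℝ (Fin N) :=
  tdError m φ π z.1 x.1.1 x.1.2 x.2 • φ x.1
    - (m.γ * inner ℝ z.2 (φ x.1)) • gradient (Vbar φ π x.2) z.1

/-- The increment of `ω` in a Greedy-GQ step, up to the stepsize. -/
def omegaDir (z : EuclideanSpace ℝ (Fin N) × EuclideanSpace ℝ (Fin N)) (x : (S × A) × S) :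
    EuclideanSpace ℝ (Fin N) :=
  (tdError m φ π z.1 x.1.1 x.1.2 x.2 - inner ℝ (φ x.1) z.2) • φ x.1

variable {m φ π}

theorem hasGradientAt_Vbar (hsmooth : SmoothPolicy π k₁ k₂) (s' : S)
    (θ : EuclideanSpace ℝ (Fin N)) :
    HasGradientAt (Vbar φ π s') (∑ a', ((π θ s').real {a'} • φ (s', a')
      + linQ φ θ (s', a') • gradient (fun θ => (π θ s').real {a'}) θ)) θ := by
  rw [hasGradientAt_iff_hasFDerivAt]
  have h : ∀ a', HasFDerivAt (fun θ => (π θ s').real {a'} * linQ φ θ (s', a'))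
      (InnerProductSpace.toDual ℝ _ ((π θ s').real {a'} • φ (s', a')
      + linQ φ θ (s', a') • gradient (fun θ => (π θ s').real {a'}) θ)) θ := by
    intro a'
    have h1 := (hsmooth.differentiable s' a' θ).hasGradientAt.hasFDerivAt
    have h2 : HasFDerivAt (fun θ => linQ φ θ (s', a')) (innerSL ℝ (φ (s', a'))) θ :=
      (innerSL ℝ (φ (s', a'))).hasFDerivAt
    convert! h1.mul h2 using 1
    ext v
    simp
  rw [map_sum]
  exact HasFDerivAt.fun_sum fun a' _ => h a'

theorem gradient_Vbar (hsmooth : SmoothPolicy π k₁ k₂) (s' : S)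
    (θ : EuclideanSpace ℝ (Fin N)) :
    gradient (Vbar φ π s') θ = ∑ a', ((π θ s').real {a'} • φ (s', a')
      + linQ φ θ (s', a') • gradient (fun θ => (π θ s').real {a'}) θ) :=
  (hasGradientAt_Vbar hsmooth s' θ).gradient

section Measurability

theorem measurable_linQ (hφm : Measurable φ) :
    Measurable fun p : EuclideanSpace ℝ (Fin N) × (S × A) => linQ φ p.1 p.2 := by
  unfold linQ
  exact (hφm.comp measurable_snd).inner measurable_fst

theorem measurable_Vbar (hφm : Measurable φ) (hsmooth : SmoothPolicy π k₁ k₂) :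
    Measurable fun p : EuclideanSpace ℝ (Fin N) × S => Vbar φ π p.2 p.1 := by
  unfold Vbar
  refine Finset.measurable_sum _ fun a' _ => (measurable_policy hsmooth a').mul ?_
  exact (measurable_linQ hφm).comp
    (measurable_fst.prodMk (measurable_snd.prodMk measurable_const))

theorem measurable_gradient_Vbar (hφm : Measurable φ) (hsmooth : SmoothPolicy π k₁ k₂) :
    Measurable fun p : EuclideanSpace ℝ (Fin N) × S => gradient (Vbar φ π p.2) p.1 := by
  simp_rw [gradient_Vbar hsmooth]
  refine Finset.measurable_sum _ fun a' _ => ?_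
  have h1 : Measurable fun p : EuclideanSpace ℝ (Fin N) × S => φ (p.2, a') :=
    hφm.comp (measurable_snd.prodMk measurable_const)
  have h2 : Measurable fun p : EuclideanSpace ℝ (Fin N) × S => linQ φ p.1 (p.2, a') :=
    (measurable_linQ hφm).comp (measurable_fst.prodMk (measurable_snd.prodMk measurable_const))
  exact ((measurable_policy hsmooth a').fun_smul h1).add
    (h2.fun_smul (measurable_gradient_policy hsmooth a'))

theorem measurable_tdError (hφm : Measurable φ) (hsmooth : SmoothPolicy π k₁ k₂) :
    Measurable fun p : EuclideanSpace ℝ (Fin N) × ((S × A) × S) =>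
      tdError m φ π p.1 p.2.1.1 p.2.1.2 p.2.2 := by
  unfold tdError
  refine ((m.measurable_r.comp (f := fun p : EuclideanSpace ℝ (Fin N) × ((S × A) × S) =>
    (p.2.1.1, p.2.1.2, p.2.2)) (by fun_prop)).add
    (((measurable_Vbar hφm hsmooth).comp (f := fun p : EuclideanSpace ℝ (Fin N) × ((S × A) × S) =>
      (p.1, p.2.2)) (by fun_prop)).const_mul _)).sub ?_
  exact (measurable_linQ hφm).comp (f := fun p : EuclideanSpace ℝ (Fin N) × ((S × A) × S) =>
    (p.1, (p.2.1.1, p.2.1.2))) (by fun_prop)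

theorem measurable_thetaDir (hφm : Measurable φ) (hsmooth : SmoothPolicy π k₁ k₂) :
    Measurable fun p : (EuclideanSpace ℝ (Fin N) × EuclideanSpace ℝ (Fin N)) × ((S × A) × S) =>
      thetaDir m φ π p.1 p.2 := by
  have h1 := (measurable_tdError (m := m) hφm hsmooth).comp (f := fun p :
    (EuclideanSpace ℝ (Fin N) × EuclideanSpace ℝ (Fin N)) × ((S × A) × S) => (p.1.1, p.2))
    (by fun_prop)
  have h2 := (measurable_gradient_Vbar hφm hsmooth).comp (f := fun p :
    (EuclideanSpace ℝ (Fin N) × EuclideanSpace ℝ (Fin N)) × ((S × A) × S) => (p.1.1, p.2.2))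
    (by fun_prop)
  have h3 : Measurable fun p :
    (EuclideanSpace ℝ (Fin N) × EuclideanSpace ℝ (Fin N)) × ((S × A) × S) => φ p.2.1 :=
    hφm.comp (by fun_prop)
  have h4 : Measurable fun p :
    (EuclideanSpace ℝ (Fin N) × EuclideanSpace ℝ (Fin N)) × ((S × A) × S) =>
      m.γ * inner ℝ p.1.2 (φ p.2.1) :=
    ((measurable_snd.comp measurable_fst).inner h3).const_mul _
  exact (h1.fun_smul h3).sub (h4.fun_smul h2)

theorem measurable_omegaDir (hφm : Measurable φ) (hsmooth : SmoothPolicy π k₁ k₂) :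
    Measurable fun p : (EuclideanSpace ℝ (Fin N) × EuclideanSpace ℝ (Fin N)) × ((S × A) × S) =>
      omegaDir m φ π p.1 p.2 := by
  have h1 := (measurable_tdError (m := m) hφm hsmooth).comp (f := fun p :
    (EuclideanSpace ℝ (Fin N) × EuclideanSpace ℝ (Fin N)) × ((S × A) × S) => (p.1.1, p.2))
    (by fun_prop)
  have h3 : Measurable fun p :
    (EuclideanSpace ℝ (Fin N) × EuclideanSpace ℝ (Fin N)) × ((S × A) × S) => φ p.2.1 :=
    hφm.comp (by fun_prop)
  exact (h1.sub (h3.inner (measurable_snd.comp measurable_fst))).smul h3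

end Measurability

section Regularity

variable {r : ℝ}

theorem bddLipOn_id {X : Type*} : BddLipOn (Metric.closedBall (0 : EuclideanSpace ℝ (Fin N)) r)
    fun θ (_ : X) => θ :=
  BddLipOn.of_param (fun _ hz => by simpa using hz) fun _ _ _ _ => le_rfl

theorem bddLipOn_linQ (hφ : ∀ x, ‖φ x‖ ≤ 1) :
    BddLipOn (Metric.closedBall 0 r) fun θ x => linQ φ θ x :=
  (BddLipOn.of_index hφ).inner bddLipOn_id

theorem bddLipOn_Vbar (hφ : ∀ x, ‖φ x‖ ≤ 1) (hπ : ∀ θ, IsMarkovKernel (π θ))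
    (hsmooth : SmoothPolicy π k₁ k₂) :
    BddLipOn (Metric.closedBall 0 r) fun θ s' => Vbar φ π s' θ :=
  BddLipOn.sum _ fun a' => (bddLipOn_policy hπ hsmooth _ a').mul
    ((bddLipOn_linQ hφ).comp_index fun s' => (s', a'))

theorem bddLipOn_gradient_Vbar (hφ : ∀ x, ‖φ x‖ ≤ 1) (hπ : ∀ θ, IsMarkovKernel (π θ))
    (hsmooth : SmoothPolicy π k₁ k₂) :
    BddLipOn (Metric.closedBall 0 r) fun θ s' => gradient (Vbar φ π s') θ := by
  simp_rw [gradient_Vbar hsmooth]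
  exact BddLipOn.sum _ fun a' => ((bddLipOn_policy hπ hsmooth _ a').smul
    (BddLipOn.of_index fun s' => hφ (s', a'))).add
    (((bddLipOn_linQ hφ).comp_index fun s' => (s', a')).smul
      (bddLipOn_gradient_policy hsmooth _ a'))

theorem bddLipOn_tdError (hφ : ∀ x, ‖φ x‖ ≤ 1) (hπ : ∀ θ, IsMarkovKernel (π θ))
    (hsmooth : SmoothPolicy π k₁ k₂) :
    BddLipOn (Metric.closedBall 0 r) fun θ (x : (S × A) × S) =>
      tdError m φ π θ x.1.1 x.1.2 x.2 := by
  have h1 : BddLipOn (Metric.closedBall (0 : EuclideanSpace ℝ (Fin N)) r)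
      fun _ (x : (S × A) × S) => m.r x.1.1 x.1.2 x.2 := by
    refine BddLipOn.of_index (B := m.rmax) fun x => ?_
    rw [Real.norm_of_nonneg (m.r_nonneg _ _ _)]
    exact m.r_le _ _ _
  have h2 : BddLipOn (Metric.closedBall (0 : EuclideanSpace ℝ (Fin N)) r)
      fun θ (x : (S × A) × S) => Vbar φ π x.2 θ :=
    (bddLipOn_Vbar (r := r) hφ hπ hsmooth).comp_index Prod.snd
  have h3 : BddLipOn (Metric.closedBall (0 : EuclideanSpace ℝ (Fin N)) r)
      fun θ (x : (S × A) × S) => linQ φ θ (x.1.1, x.1.2) :=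
    (bddLipOn_linQ (r := r) hφ).comp_index (Prod.fst : (S × A) × S → S × A)
  exact (h1.add (h2.const_mul m.γ)).sub h3

/-- Pairs (θ, ω) carry the sup norm, so the projections are 1-Lipschitz and map a ball of radius r
into the ball of radius r. -/
theorem BddLipOn.comp_fst {X V : Type*} [NormedAddCommGroup V]
    {f : EuclideanSpace ℝ (Fin N) → X → V} (hf : BddLipOn (Metric.closedBall 0 r) f) :
    BddLipOn (Metric.closedBall (0 : EuclideanSpace ℝ (Fin N) × EuclideanSpace ℝ (Fin N)) r)
      fun z x => f z.1 x :=
  hf.comp_param (fun z hz => by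
    rw [mem_closedBall_zero_iff] at hz ⊢
    exact (norm_fst_le z).trans hz) fun z _ z' _ => norm_fst_le (z - z')

theorem bddLipOn_snd {X : Type*} :
    BddLipOn (Metric.closedBall (0 : EuclideanSpace ℝ (Fin N) × EuclideanSpace ℝ (Fin N)) r)
      fun z (_ : X) => z.2 :=
  bddLipOn_id.comp_param (fun z hz => by
    rw [mem_closedBall_zero_iff] at hz ⊢
    exact (norm_snd_le z).trans hz) fun z _ z' _ => norm_snd_le (z - z')

theorem bddLipOn_thetaDir (hφ : ∀ x, ‖φ x‖ ≤ 1) (hπ : ∀ θ, IsMarkovKernel (π θ))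
    (hsmooth : SmoothPolicy π k₁ k₂) :
    BddLipOn (Metric.closedBall 0 r) (thetaDir m φ π) := by
  have h1 : BddLipOn (Metric.closedBall (0 : EuclideanSpace ℝ (Fin N) × EuclideanSpace ℝ (Fin N)) r)
      fun z (x : (S × A) × S) => tdError m φ π z.1 x.1.1 x.1.2 x.2 :=
    (bddLipOn_tdError hφ hπ hsmooth).comp_fst
  have h2 : BddLipOn (Metric.closedBall (0 : EuclideanSpace ℝ (Fin N) × EuclideanSpace ℝ (Fin N)) r)
      fun _ (x : (S × A) × S) => φ x.1 := BddLipOn.of_index fun x => hφ x.1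
  have h3 : BddLipOn (Metric.closedBall (0 : EuclideanSpace ℝ (Fin N) × EuclideanSpace ℝ (Fin N)) r)
      fun z (x : (S × A) × S) => gradient (Vbar φ π x.2) z.1 :=
    (bddLipOn_gradient_Vbar (r := r) hφ hπ hsmooth).comp_fst.comp_index Prod.snd
  have h4 : BddLipOn (Metric.closedBall (0 : EuclideanSpace ℝ (Fin N) × EuclideanSpace ℝ (Fin N)) r)
      fun z (x : (S × A) × S) => inner ℝ z.2 (φ x.1) := bddLipOn_snd.inner h2
  have h5 := h4.const_mul m.γ
  have h6 := (h1.smul h2).sub (h5.smul h3)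
  unfold thetaDir
  exact h6

theorem bddLipOn_omegaDir (hφ : ∀ x, ‖φ x‖ ≤ 1) (hπ : ∀ θ, IsMarkovKernel (π θ))
    (hsmooth : SmoothPolicy π k₁ k₂) :
    BddLipOn (Metric.closedBall 0 r) (omegaDir m φ π) := by
  have h1 : BddLipOn (Metric.closedBall (0 : EuclideanSpace ℝ (Fin N) × EuclideanSpace ℝ (Fin N)) r)
      fun z (x : (S × A) × S) => tdError m φ π z.1 x.1.1 x.1.2 x.2 :=
    (bddLipOn_tdError hφ hπ hsmooth).comp_fst
  have h2 : BddLipOn (Metric.closedBall (0 : EuclideanSpace ℝ (Fin N) × EuclideanSpace ℝ (Fin N)) r)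
      fun _ (x : (S × A) × S) => φ x.1 := BddLipOn.of_index fun x => hφ x.1
  exact (h1.sub (h2.inner bddLipOn_snd)).smul h2

end Regularity

end GreedyGQ

theorem BddLipOn.integrable {Z X V : Type*} [NormedAddCommGroup Z] [NormedAddCommGroup V]
    [MeasurableSpace X] {D : Set Z} {f : Z → X → V} (hf : BddLipOn D f) {κ : Measure X}
    [IsFiniteMeasure κ] {z : Z} (hz : z ∈ D) (hm : AEStronglyMeasurable (f z) κ) :
    Integrable (f z) κ := by
  obtain ⟨B, -, hf⟩ := hf
  exact Integrable.of_bound hm B (ae_of_all _ fun x => (hf x z hz).1)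

/-! ### The feature operator C and the projection onto the linear class. -/

section FeatureOperator

variable {X : Type*} [MeasurableSpace X] {N : ℕ}

/-- The operator `v ↦ E_μ[⟨φ, v⟩ φ]` with matrix `E_μ[φ φᵀ]`. -/
def featureOp {S A : Type*} [MeasurableSpace S] [MeasurableSpace A]
    (φ : S × A → EuclideanSpace ℝ (Fin N)) (μ : Measure (S × A)) :
    EuclideanSpace ℝ (Fin N) →L[ℝ] EuclideanSpace ℝ (Fin N) :=
  Matrix.toEuclideanCLM (𝕜 := ℝ) (featureMatrix φ μ)

/-- The operator of the inverse feature matrix. -/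
def featureInv {S A : Type*} [MeasurableSpace S] [MeasurableSpace A]
    (φ : S × A → EuclideanSpace ℝ (Fin N)) (μ : Measure (S × A)) :
    EuclideanSpace ℝ (Fin N) →L[ℝ] EuclideanSpace ℝ (Fin N) :=
  Matrix.toEuclideanCLM (𝕜 := ℝ) (featureMatrix φ μ)⁻¹

variable {S A : Type*} [MeasurableSpace S] [MeasurableSpace A]
  {φ : S × A → EuclideanSpace ℝ (Fin N)} {μ : Measure (S × A)} [IsProbabilityMeasure μ]

theorem featureOp_featureInv (hC : (featureMatrix φ μ).det ≠ 0)
    (v : EuclideanSpace ℝ (Fin N)) : featureOp φ μ (featureInv φ μ v) = v := by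
  have h : featureOp φ μ * featureInv φ μ = 1 := by
    rw [featureOp, featureInv, ← map_mul, Matrix.mul_nonsing_inv _ (isUnit_iff_ne_zero.2 hC),
      map_one]
  exact congrArg (fun L => L v) h

theorem featureInv_featureOp (hC : (featureMatrix φ μ).det ≠ 0)
    (v : EuclideanSpace ℝ (Fin N)) : featureInv φ μ (featureOp φ μ v) = v := by
  have h : featureInv φ μ * featureOp φ μ = 1 := by
    rw [featureOp, featureInv, ← map_mul, Matrix.nonsing_inv_mul _ (isUnit_iff_ne_zero.2 hC),
      map_one]
  exact congrArg (fun L => L v) h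

theorem integrable_smul_feature (hφm : Measurable φ) (hφ : ∀ x, ‖φ x‖ ≤ 1) {f : S × A → ℝ}
    (hf : Measurable f) {B : ℝ} (hB : ∀ x, |f x| ≤ B) : Integrable (fun x => f x • φ x) μ := by
  refine Integrable.of_bound (hf.smul hφm).aestronglyMeasurable B (ae_of_all _ fun x => ?_)
  rw [norm_smul, Real.norm_eq_abs]
  exact (mul_le_of_le_one_right (abs_nonneg _) (hφ x)).trans (hB x)

theorem abs_inner_feature_le (hφ : ∀ x, ‖φ x‖ ≤ 1) (v : EuclideanSpace ℝ (Fin N)) (x : S × A) :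
    |inner ℝ (φ x) v| ≤ ‖v‖ :=
  (abs_real_inner_le_norm _ _).trans (mul_le_of_le_one_left (norm_nonneg _) (hφ x))

theorem measurable_inner_feature (hφm : Measurable φ) (v : EuclideanSpace ℝ (Fin N)) :
    Measurable fun x => (inner ℝ (φ x) v : ℝ) :=
  hφm.inner measurable_const

theorem featureOp_apply (hφm : Measurable φ) (hφ : ∀ x, ‖φ x‖ ≤ 1)
    (v : EuclideanSpace ℝ (Fin N)) :
    featureOp φ μ v = ∫ x, (inner ℝ (φ x) v : ℝ) • φ x ∂μ := by
  ext i
  have hi : Integrable (fun x => (inner ℝ (φ x) v : ℝ) • φ x) μ :=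
    integrable_smul_feature hφm hφ (measurable_inner_feature hφm v) (abs_inner_feature_le hφ v)
  have h1 := (EuclideanSpace.proj i : EuclideanSpace ℝ (Fin N) →L[ℝ] ℝ).integral_comp_comm hi
  have h2 : (featureOp φ μ v) i = ∑ j, (∫ x, φ x i * φ x j ∂μ) * v j := rfl
  have hcoord : ∀ j, Measurable fun x => φ x j := fun j =>
    (EuclideanSpace.proj j : EuclideanSpace ℝ (Fin N) →L[ℝ] ℝ).continuous.measurable.comp hφm
  have hle : ∀ j x, |φ x j| ≤ 1 := fun j x => (PiLp.norm_apply_le (φ x) j).trans (hφ x)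
  have hij : ∀ j, Integrable (fun x => φ x i * φ x j) μ := fun j =>
    integrable_of_measurable_of_abs_le (B := 1) ((hcoord i).mul (hcoord j)) fun x => by
      rw [abs_mul]; exact mul_le_one₀ (hle i x) (abs_nonneg _) (hle j x)
  rw [h2]
  refine Eq.trans ?_ h1
  simp_rw [← integral_mul_const]
  rw [← integral_finsetSum _ fun j _ => (hij j).mul_const _]
  refine integral_congr_ae (ae_of_all _ fun x => ?_)
  simp only [EuclideanSpace.coe_proj, PiLp.smul_apply, smul_eq_mul, PiLp.inner_apply,
    RCLike.inner_apply, conj_trivial, Finset.sum_mul]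
  exact Finset.sum_congr rfl fun j _ => by ring

theorem inner_featureOp (hφm : Measurable φ) (hφ : ∀ x, ‖φ x‖ ≤ 1)
    (u v : EuclideanSpace ℝ (Fin N)) :
    inner ℝ u (featureOp φ μ v) = ∫ x, (inner ℝ (φ x) u * inner ℝ (φ x) v : ℝ) ∂μ := by
  have hi : Integrable (fun x => (inner ℝ (φ x) v : ℝ) • φ x) μ :=
    integrable_smul_feature hφm hφ (measurable_inner_feature hφm v) (abs_inner_feature_le hφ v)
  rw [featureOp_apply hφm hφ, ← integral_inner hi]
  refine integral_congr_ae (ae_of_all _ fun x => ?_)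
  simp only [inner_smul_right, real_inner_comm u (φ x)]
  ring

theorem inner_featureOp_comm (hφm : Measurable φ) (hφ : ∀ x, ‖φ x‖ ≤ 1)
    (u v : EuclideanSpace ℝ (Fin N)) :
    inner ℝ u (featureOp φ μ v) = inner ℝ (featureOp φ μ u) v := by
  rw [real_inner_comm v, inner_featureOp hφm hφ, inner_featureOp hφm hφ]
  simp_rw [mul_comm]

theorem inner_featureInv_comm (hφm : Measurable φ) (hφ : ∀ x, ‖φ x‖ ≤ 1)
    (hC : (featureMatrix φ μ).det ≠ 0) (u v : EuclideanSpace ℝ (Fin N)) :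
    inner ℝ u (featureInv φ μ v) = inner ℝ (featureInv φ μ u) v := by
  have := inner_featureOp_comm (μ := μ) hφm hφ (featureInv φ μ u) (featureInv φ μ v)
  rw [featureOp_featureInv hC, featureOp_featureInv hC] at this
  exact this.symm

theorem inner_featureOp_self_nonneg (hφm : Measurable φ) (hφ : ∀ x, ‖φ x‖ ≤ 1)
    (v : EuclideanSpace ℝ (Fin N)) : 0 ≤ inner ℝ v (featureOp φ μ v) := by
  rw [inner_featureOp hφm hφ]
  exact integral_nonneg fun x => mul_self_nonneg _

theorem inner_featureOp_self_le (hφm : Measurable φ) (hφ : ∀ x, ‖φ x‖ ≤ 1)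
    (v : EuclideanSpace ℝ (Fin N)) : inner ℝ v (featureOp φ μ v) ≤ ‖v‖ ^ 2 := by
  rw [inner_featureOp hφm hφ]
  refine (le_abs_self _).trans (abs_integral_le_of_abs_le (ae_of_all _ fun x => ?_))
  rw [abs_mul, sq]
  exact mul_le_mul (abs_inner_feature_le hφ v x) (abs_inner_feature_le hφ v x) (abs_nonneg _)
    (norm_nonneg _)

/-- C² ≤ C because 0 ≤ C ≤ 1: positivity of C tested at v - Cv, combined with symmetry and ⟨Cv,
C(Cv)⟩ ≤ ‖Cv‖². -/
theorem norm_featureOp_sq_le (hφm : Measurable φ) (hφ : ∀ x, ‖φ x‖ ≤ 1)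
    (v : EuclideanSpace ℝ (Fin N)) :
    ‖featureOp φ μ v‖ ^ 2 ≤ inner ℝ v (featureOp φ μ v) := by
  set w := featureOp φ μ v with hw
  have h1 := inner_featureOp_self_nonneg (μ := μ) hφm hφ (v - w)
  have h2 := inner_featureOp_self_le (μ := μ) hφm hφ w
  have h3 := inner_featureOp_comm (μ := μ) hφm hφ v w
  have h4 := real_inner_self_eq_norm_sq w
  rw [map_sub, inner_sub_left, inner_sub_right, inner_sub_right, h3, ← hw] at h1
  linarith

/-- The feature operator is coercive when it is non-singular. -/
theorem exists_coercive_featureOp (hφm : Measurable φ) (hφ : ∀ x, ‖φ x‖ ≤ 1)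
    (hC : (featureMatrix φ μ).det ≠ 0) :
    ∃ c : ℝ, 0 < c ∧ ∀ v, c * ‖v‖ ^ 2 ≤ inner ℝ v (featureOp φ μ v) := by
  -- From ‖v‖² ≤ ‖C⁻¹‖² ‖Cv‖² ≤ ‖C⁻¹‖² ⟨v, Cv⟩. The added 1 covers N = 0, where the inverse has norm
  -- 0.
  refine ⟨1 / (‖featureInv φ μ‖ ^ 2 + 1), by positivity, fun v => ?_⟩
  have h1 : ‖v‖ ≤ ‖featureInv φ μ‖ * ‖featureOp φ μ v‖ := by
    conv_lhs => rw [← featureInv_featureOp hC v]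
    exact ContinuousLinearMap.le_opNorm _ _
  have h2 := norm_featureOp_sq_le (μ := μ) hφm hφ v
  have h3 : ‖v‖ ^ 2 ≤ ‖featureInv φ μ‖ ^ 2 * ‖featureOp φ μ v‖ ^ 2 := by
    rw [← mul_pow]; gcongr
  rw [div_mul_eq_mul_div, one_mul, div_le_iff₀ (by positivity)]
  nlinarith [sq_nonneg ‖featureInv φ μ‖, sq_nonneg ‖featureOp φ μ v‖]

/-- The projection coefficient is the solution of the normal equations. -/
theorem projCoef_eq (hφm : Measurable φ) (hφ : ∀ x, ‖φ x‖ ≤ 1)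
    (hC : (featureMatrix φ μ).det ≠ 0) {f : S × A → ℝ} (hf : Measurable f) {B : ℝ}
    (hB : ∀ x, |f x| ≤ B) :
    projCoef φ μ f = featureInv φ μ (∫ x, f x • φ x ∂μ) := by
  set w := featureInv φ μ (∫ x, f x • φ x ∂μ) with hw
  have hfφ : Integrable (fun x => f x • φ x) μ := integrable_smul_feature hφm hφ hf hB
  have hlin : ∀ v, Measurable (linQ φ v) := fun v => measurable_inner_feature hφm v
  have hlinB : ∀ v x, |linQ φ v x| ≤ ‖v‖ := fun v x => abs_inner_feature_le hφ v x
  -- Pythagoras: the residual Q_w - f is orthogonal to every Q_u since Cw = E_μ[f φ], so the cross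
  -- term vanishes.
  have hff : ∀ v, ∫ x, (linQ φ v x - f x) ^ 2 ∂μ
      = ∫ x, (linQ φ w x - f x) ^ 2 ∂μ + inner ℝ (v - w) (featureOp φ μ (v - w)) := by
    intro v
    have hB' : ∀ u x, |linQ φ u x - f x| ≤ ‖u‖ + B := fun u x =>
      (abs_sub _ _).trans (add_le_add (hlinB u x) (hB x))
    have hm' : ∀ u, Measurable fun x => linQ φ u x - f x := fun u => (hlin u).sub hf
    have i1 : ∀ u, Integrable (fun x => (linQ φ u x - f x) ^ 2) μ := fun u =>
      integrable_of_measurable_of_abs_le (B := (‖u‖ + B) ^ 2) ((hm' u).pow_const 2) fun x => by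
        rw [abs_pow]
        exact pow_le_pow_left₀ (abs_nonneg _) (hB' u x) 2
    have i2 : Integrable (fun x => linQ φ (v - w) x * linQ φ (v - w) x) μ :=
      integrable_of_measurable_of_abs_le (B := ‖v - w‖ * ‖v - w‖) ((hlin _).mul (hlin _))
        fun x => by
          rw [abs_mul]
          exact mul_le_mul (hlinB _ x) (hlinB _ x) (abs_nonneg _) (norm_nonneg _)
    have i3 : Integrable (fun x => linQ φ (v - w) x * (linQ φ w x - f x)) μ :=
      integrable_of_measurable_of_abs_le (B := ‖v - w‖ * (‖w‖ + B)) ((hlin _).mul (hm' w))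
        fun x => by
          rw [abs_mul]
          exact mul_le_mul (hlinB _ x) (hB' w x) (abs_nonneg _) (norm_nonneg _)
    have hcross : ∫ x, linQ φ (v - w) x * (linQ φ w x - f x) ∂μ = 0 := by
      have h1 : inner ℝ (v - w) (featureOp φ μ w) = inner ℝ (v - w) (∫ x, f x • φ x ∂μ) := by
        rw [hw, featureOp_featureInv hC]
      rw [inner_featureOp hφm hφ, ← integral_inner hfφ] at h1
      have j1 : Integrable (fun x => (inner ℝ (φ x) (v - w) * inner ℝ (φ x) w : ℝ)) μ :=
        integrable_of_measurable_of_abs_le (B := ‖v - w‖ * ‖w‖) ((hlin _).mul (hlin _))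
          fun x => by
            rw [abs_mul]
            exact mul_le_mul (hlinB _ x) (hlinB _ x) (abs_nonneg _) (norm_nonneg _)
      have j2 : Integrable (fun x => (inner ℝ (v - w) (f x • φ x) : ℝ)) μ :=
        hfφ.const_inner (v - w)
      rw [← sub_eq_zero, ← integral_sub j1 j2] at h1
      rw [← h1]
      refine integral_congr_ae (ae_of_all _ fun x => ?_)
      simp only [linQ, inner_smul_right, real_inner_comm (v - w) (φ x)]
      ring
    have : ∀ x, (linQ φ v x - f x) ^ 2 = (linQ φ w x - f x) ^ 2
        + (linQ φ (v - w) x * linQ φ (v - w) x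
          + 2 * (linQ φ (v - w) x * (linQ φ w x - f x))) := by
      intro x
      simp only [linQ, inner_sub_right]; ring
    have i4 : Integrable (fun x => linQ φ (v - w) x * linQ φ (v - w) x
        + 2 * (linQ φ (v - w) x * (linQ φ w x - f x))) μ := i2.add (i3.const_mul 2)
    simp_rw [this]
    rw [integral_add (i1 w) i4, integral_add i2 (i3.const_mul 2),
      integral_const_mul, hcross, inner_featureOp hφm hφ]
    simp [linQ]
  have hwmin : ∀ v, ∫ x, (linQ φ w x - f x) ^ 2 ∂μ ≤ ∫ x, (linQ φ v x - f x) ^ 2 ∂μ := by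
    intro v
    rw [hff v]
    linarith [inner_featureOp_self_nonneg (μ := μ) hφm hφ (v - w)]
  -- A minimizer exists, namely w, so the choice operator returns a genuine minimizer; coercivity
  -- then forces it to equal w.
  have hspec : ∀ v, ∫ x, (linQ φ (projCoef φ μ f) x - f x) ^ 2 ∂μ
      ≤ ∫ x, (linQ φ v x - f x) ^ 2 ∂μ :=
    Classical.epsilon_spec (p := fun w => ∀ v, ∫ x, (linQ φ w x - f x) ^ 2 ∂μ
      ≤ ∫ x, (linQ φ v x - f x) ^ 2 ∂μ) ⟨w, hwmin⟩
  obtain ⟨c, hc, hcoer⟩ := exists_coercive_featureOp hφm hφ hC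
  have h1 := hspec w
  rw [hff (projCoef φ μ f)] at h1
  have h2 := hcoer (projCoef φ μ f - w)
  have h3 : ‖projCoef φ μ f - w‖ ^ 2 ≤ 0 := by
    by_contra! h
    have := mul_pos hc h
    linarith
  have h4 : ‖projCoef φ μ f - w‖ = 0 := by
    have := sq_nonneg ‖projCoef φ μ f - w‖
    exact pow_eq_zero_iff two_ne_zero |>.1 (le_antisymm h3 this)
  exact sub_eq_zero.1 (norm_eq_zero.1 h4)

end FeatureOperator

/-! ### Stationary mean increments, and the gradient of the objective. -/

section MeanField

variable {S A : Type*} [MeasurableSpace S] [MeasurableSpace A] [Fintype A]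
  [MeasurableSingletonClass A] {N : ℕ}

/-- `E_μ[δ(θ) φ]` for a stationary transition. -/
def meanTD (m : MDP S A) (φ : S × A → EuclideanSpace ℝ (Fin N))
    (π : EuclideanSpace ℝ (Fin N) → Kernel S A) (μ : Measure (S × A))
    (θ : EuclideanSpace ℝ (Fin N)) : EuclideanSpace ℝ (Fin N) :=
  ∫ x, tdError m φ π θ x.1.1 x.1.2 x.2 • φ x.1 ∂(μ ⊗ₘ m.P)

/-- The equilibrium `ω*(θ) = C⁻¹ E_μ[δ(θ) φ]` of the fast iterate. -/
def omegaStar (m : MDP S A) (φ : S × A → EuclideanSpace ℝ (Fin N))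
    (π : EuclideanSpace ℝ (Fin N) → Kernel S A) (μ : Measure (S × A))
    (θ : EuclideanSpace ℝ (Fin N)) : EuclideanSpace ℝ (Fin N) :=
  featureInv φ μ (meanTD m φ π μ θ)

/-- The gradient of the mean squared projected Bellman error, in closed form. -/
def gradMSPBE (m : MDP S A) (φ : S × A → EuclideanSpace ℝ (Fin N))
    (π : EuclideanSpace ℝ (Fin N) → Kernel S A) (μ : Measure (S × A))
    (θ : EuclideanSpace ℝ (Fin N)) : EuclideanSpace ℝ (Fin N) :=
  ∫ x, (2 * inner ℝ (φ x.1) (omegaStar m φ π μ θ) : ℝ) •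
    (m.γ • gradient (Vbar φ π x.2) θ - φ x.1) ∂(μ ⊗ₘ m.P)

variable {m : MDP S A} {φ : S × A → EuclideanSpace ℝ (Fin N)}
  {π : EuclideanSpace ℝ (Fin N) → Kernel S A} {μ : Measure (S × A)} [IsProbabilityMeasure μ]
  {k₁ k₂ r : ℝ}

theorem measurable_tdError_right (hφm : Measurable φ) (hsmooth : SmoothPolicy π k₁ k₂)
    (θ : EuclideanSpace ℝ (Fin N)) :
    Measurable fun x : (S × A) × S => tdError m φ π θ x.1.1 x.1.2 x.2 :=
  (measurable_tdError hφm hsmooth).comp measurable_prodMk_left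

theorem measurable_gradient_Vbar_right (hφm : Measurable φ) (hsmooth : SmoothPolicy π k₁ k₂)
    (θ : EuclideanSpace ℝ (Fin N)) :
    Measurable fun x : (S × A) × S => gradient (Vbar φ π x.2) θ :=
  (measurable_gradient_Vbar hφm hsmooth).comp
    (f := fun x : (S × A) × S => (θ, x.2)) (by fun_prop)

theorem bddLipOn_feature {Z : Type*} [NormedAddCommGroup Z] {D : Set Z}
    (hφ : ∀ x, ‖φ x‖ ≤ 1) : BddLipOn D fun (_ : Z) (x : (S × A) × S) => φ x.1 :=
  BddLipOn.of_index fun x => hφ x.1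

theorem bddLipOn_td_smul (hφ : ∀ x, ‖φ x‖ ≤ 1) (hπ : ∀ θ, IsMarkovKernel (π θ))
    (hsmooth : SmoothPolicy π k₁ k₂) :
    BddLipOn (Metric.closedBall 0 r) fun θ (x : (S × A) × S) =>
      tdError m φ π θ x.1.1 x.1.2 x.2 • φ x.1 :=
  (bddLipOn_tdError hφ hπ hsmooth).smul (bddLipOn_feature hφ)

theorem bddLipOn_gradient_td (hφ : ∀ x, ‖φ x‖ ≤ 1) (hπ : ∀ θ, IsMarkovKernel (π θ))
    (hsmooth : SmoothPolicy π k₁ k₂) :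
    BddLipOn (Metric.closedBall 0 r) fun θ (x : (S × A) × S) =>
      m.γ • gradient (Vbar φ π x.2) θ - φ x.1 := by
  have h1 : BddLipOn (Metric.closedBall (0 : EuclideanSpace ℝ (Fin N)) r)
      fun θ (x : (S × A) × S) => gradient (Vbar φ π x.2) θ :=
    (bddLipOn_gradient_Vbar (r := r) hφ hπ hsmooth).comp_index Prod.snd
  exact (h1.const_smul m.γ).sub (bddLipOn_feature hφ)

theorem bddLipOn_meanTD {Y : Type*} (hφm : Measurable φ) (hφ : ∀ x, ‖φ x‖ ≤ 1)
    (hπ : ∀ θ, IsMarkovKernel (π θ)) (hsmooth : SmoothPolicy π k₁ k₂) :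
    BddLipOn (Metric.closedBall 0 r) fun θ (_ : Y) => meanTD m φ π μ θ :=
  (bddLipOn_td_smul hφ hπ hsmooth).integral (μ ⊗ₘ m.P) fun θ =>
    ((measurable_tdError_right hφm hsmooth θ).smul
      (hφm.comp measurable_fst)).aestronglyMeasurable

theorem bddLipOn_omegaStar {Y : Type*} (hφm : Measurable φ) (hφ : ∀ x, ‖φ x‖ ≤ 1)
    (hπ : ∀ θ, IsMarkovKernel (π θ)) (hsmooth : SmoothPolicy π k₁ k₂) :
    BddLipOn (Metric.closedBall 0 r) fun θ (_ : Y) => omegaStar m φ π μ θ :=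
  (bddLipOn_meanTD hφm hφ hπ hsmooth).clm (featureInv φ μ)

theorem bddLipOn_gradMSPBE_integrand (hφm : Measurable φ) (hφ : ∀ x, ‖φ x‖ ≤ 1)
    (hπ : ∀ θ, IsMarkovKernel (π θ)) (hsmooth : SmoothPolicy π k₁ k₂) :
    BddLipOn (Metric.closedBall 0 r) fun θ (x : (S × A) × S) =>
      (2 * inner ℝ (φ x.1) (omegaStar m φ π μ θ) : ℝ) •
        (m.γ • gradient (Vbar φ π x.2) θ - φ x.1) := by
  have h1 : BddLipOn (Metric.closedBall (0 : EuclideanSpace ℝ (Fin N)) r)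
      fun θ (x : (S × A) × S) => (inner ℝ (φ x.1) (omegaStar m φ π μ θ) : ℝ) :=
    (bddLipOn_feature hφ).inner (bddLipOn_omegaStar hφm hφ hπ hsmooth)
  exact (h1.const_mul 2).smul (bddLipOn_gradient_td hφ hπ hsmooth)

theorem measurable_gradient_td (hφm : Measurable φ) (hsmooth : SmoothPolicy π k₁ k₂)
    (θ : EuclideanSpace ℝ (Fin N)) :
    Measurable fun x : (S × A) × S => m.γ • gradient (Vbar φ π x.2) θ - φ x.1 :=
  ((measurable_gradient_Vbar_right hφm hsmooth θ).const_smul m.γ).sub (hφm.comp measurable_fst)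

theorem measurable_gradMSPBE_integrand (hφm : Measurable φ) (hsmooth : SmoothPolicy π k₁ k₂)
    (θ : EuclideanSpace ℝ (Fin N)) :
    Measurable fun x : (S × A) × S => (2 * inner ℝ (φ x.1) (omegaStar m φ π μ θ) : ℝ) •
        (m.γ • gradient (Vbar φ π x.2) θ - φ x.1) :=
  (((hφm.comp measurable_fst).inner measurable_const).const_mul 2).fun_smul
    (measurable_gradient_td hφm hsmooth θ)

theorem bddLipOn_gradMSPBE {Y : Type*} (hφm : Measurable φ) (hφ : ∀ x, ‖φ x‖ ≤ 1)
    (hπ : ∀ θ, IsMarkovKernel (π θ)) (hsmooth : SmoothPolicy π k₁ k₂) :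
    BddLipOn (Metric.closedBall 0 r) fun θ (_ : Y) => gradMSPBE m φ π μ θ :=
  (bddLipOn_gradMSPBE_integrand hφm hφ hπ hsmooth).integral (μ ⊗ₘ m.P) fun θ =>
    (measurable_gradMSPBE_integrand hφm hsmooth θ).aestronglyMeasurable

/-- Provides Borel measurability of ω*, ∇J and J in θ through continuity, from the Lipschitz bounds
on all balls. -/
theorem BddLipOn.continuous_of_forall {E V : Type*} [NormedAddCommGroup E] [NormedAddCommGroup V]
    {f : E → V} (hf : ∀ r, BddLipOn (Metric.closedBall 0 r) fun z (_ : Unit) => f z) :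
    Continuous f := by
  rw [continuous_iff_continuousAt]
  intro z
  obtain ⟨B, hB, h⟩ := hf (‖z‖ + 1)
  have hnhds : Metric.closedBall (0 : E) (‖z‖ + 1) ∈ nhds z := by
    refine Filter.mem_of_superset (Metric.ball_mem_nhds z one_pos) fun y hy => ?_
    rw [mem_closedBall_zero_iff]
    rw [mem_ball_iff_norm] at hy
    have := norm_le_norm_add_norm_sub' y z
    linarith
  have hlip : LipschitzOnWith (Real.toNNReal B) f (Metric.closedBall (0 : E) (‖z‖ + 1)) := by
    refine LipschitzOnWith.of_dist_le_mul fun x hx y hy => ?_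
    rw [dist_eq_norm, dist_eq_norm, Real.coe_toNNReal B hB]
    exact (h () x hx).2 y hy
  exact hlip.continuousOn.continuousAt hnhds

theorem measurable_gradMSPBE (hφm : Measurable φ) (hφ : ∀ x, ‖φ x‖ ≤ 1)
    (hπ : ∀ θ, IsMarkovKernel (π θ)) (hsmooth : SmoothPolicy π k₁ k₂) :
    Measurable (gradMSPBE m φ π μ) :=
  (BddLipOn.continuous_of_forall fun _ => bddLipOn_gradMSPBE hφm hφ hπ hsmooth).measurable

theorem measurable_omegaStar (hφm : Measurable φ) (hφ : ∀ x, ‖φ x‖ ≤ 1)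
    (hπ : ∀ θ, IsMarkovKernel (π θ)) (hsmooth : SmoothPolicy π k₁ k₂) :
    Measurable (omegaStar m φ π μ) :=
  (BddLipOn.continuous_of_forall fun _ => bddLipOn_omegaStar hφm hφ hπ hsmooth).measurable

theorem mem_closedBall_norm {E : Type*} [NormedAddCommGroup E] (z : E) :
    z ∈ Metric.closedBall (0 : E) ‖z‖ := by simp

theorem integral_feature_fst [IsMarkovKernel m.P] (hφm : Measurable φ) (hφ : ∀ x, ‖φ x‖ ≤ 1)
    (v : EuclideanSpace ℝ (Fin N)) :
    ∫ x, (inner ℝ (φ x.1) v : ℝ) • φ x.1 ∂(μ ⊗ₘ m.P) = featureOp φ μ v := by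
  have hi : Integrable (fun x : (S × A) × S => (inner ℝ (φ x.1) v : ℝ) • φ x.1) (μ ⊗ₘ m.P) := by
    refine Integrable.of_bound (((measurable_inner_feature hφm v).smul hφm).comp
      measurable_fst).aestronglyMeasurable ‖v‖ (ae_of_all _ fun x => ?_)
    rw [norm_smul, Real.norm_eq_abs]
    exact (mul_le_of_le_one_right (abs_nonneg _) (hφ _)).trans (abs_inner_feature_le hφ v _)
  rw [Measure.integral_compProd hi, featureOp_apply hφm hφ]
  simp

theorem bellman_linQ (θ : EuclideanSpace ℝ (Fin N)) (x : S × A) :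
    m.bellman (π θ) (linQ φ θ) x = ∫ s', (m.r x.1 x.2 s' + m.γ * Vbar φ π s' θ) ∂(m.P x) :=
  rfl

/-- The term Cθ restores the -θᵀφ contained in δ. Applying C⁻¹ gives ω* + θ as the coefficient of Π
T Q_θ. -/
theorem integral_bellman_smul (hφm : Measurable φ) (hφ : ∀ x, ‖φ x‖ ≤ 1)
    (hπ : ∀ θ, IsMarkovKernel (π θ)) (hsmooth : SmoothPolicy π k₁ k₂)
    (θ : EuclideanSpace ℝ (Fin N)) :
    ∫ x, m.bellman (π θ) (linQ φ θ) x • φ x ∂μ = meanTD m φ π μ θ + featureOp φ μ θ := by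
  have i1 : Integrable (fun x : (S × A) × S => tdError m φ π θ x.1.1 x.1.2 x.2 • φ x.1)
      (μ ⊗ₘ m.P) :=
    (bddLipOn_td_smul hφ hπ hsmooth).integrable (mem_closedBall_norm θ)
      ((measurable_tdError_right hφm hsmooth θ).smul
        (hφm.comp measurable_fst)).aestronglyMeasurable
  have i2 : Integrable (fun x : (S × A) × S => (inner ℝ (φ x.1) θ : ℝ) • φ x.1) (μ ⊗ₘ m.P) := by
    refine Integrable.of_bound (((measurable_inner_feature hφm θ).smul hφm).comp
      measurable_fst).aestronglyMeasurable ‖θ‖ (ae_of_all _ fun x => ?_)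
    rw [norm_smul, Real.norm_eq_abs]
    exact (mul_le_of_le_one_right (abs_nonneg _) (hφ _)).trans (abs_inner_feature_le hφ θ _)
  have i3 := i1.add i2
  rw [meanTD, ← integral_feature_fst (m := m) hφm hφ, ← integral_add i1 i2]
  have h : ∀ x : (S × A) × S, tdError m φ π θ x.1.1 x.1.2 x.2 • φ x.1
      + (inner ℝ (φ x.1) θ : ℝ) • φ x.1
      = (m.r x.1.1 x.1.2 x.2 + m.γ * Vbar φ π x.2 θ) • φ x.1 := by
    intro x
    rw [← add_smul]
    simp [tdError, linQ]
  have i4 : Integrable (fun x : (S × A) × S =>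
      (m.r x.1.1 x.1.2 x.2 + m.γ * Vbar φ π x.2 θ) • φ x.1) (μ ⊗ₘ m.P) :=
    i3.congr (ae_of_all _ h)
  simp_rw [h]
  rw [Measure.integral_compProd i4]
  simp_rw [integral_smul_const]
  rfl

theorem measurable_bellman_linQ (hφm : Measurable φ) (hsmooth : SmoothPolicy π k₁ k₂)
    (θ : EuclideanSpace ℝ (Fin N)) : Measurable (m.bellman (π θ) (linQ φ θ)) := by
  have h : Measurable fun x : (S × A) × S => m.r x.1.1 x.1.2 x.2 + m.γ * Vbar φ π x.2 θ :=
    (m.measurable_r.comp (f := fun x : (S × A) × S => (x.1.1, x.1.2, x.2)) (by fun_prop)).add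
      (((measurable_Vbar hφm hsmooth).comp (f := fun x : (S × A) × S => (θ, x.2))
        (by fun_prop)).const_mul _)
  exact (StronglyMeasurable.integral_kernel_prod_right' (κ := m.P)
    h.stronglyMeasurable).measurable

theorem exists_abs_bellman_linQ_le (hφ : ∀ x, ‖φ x‖ ≤ 1) (hπ : ∀ θ, IsMarkovKernel (π θ))
    (hsmooth : SmoothPolicy π k₁ k₂) (θ : EuclideanSpace ℝ (Fin N)) :
    ∃ B, ∀ x, |m.bellman (π θ) (linQ φ θ) x| ≤ B := by
  obtain ⟨B, hB, h⟩ := bddLipOn_Vbar (r := ‖θ‖) hφ hπ hsmooth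
  refine ⟨m.rmax + |m.γ| * B, fun x => ?_⟩
  rw [bellman_linQ]
  refine abs_integral_le_of_abs_le (ae_of_all _ fun s' => ?_)
  refine (abs_add_le _ _).trans (add_le_add ?_ ?_)
  · rw [abs_of_nonneg (m.r_nonneg _ _ _)]
    exact m.r_le _ _ _
  · rw [abs_mul]
    exact mul_le_mul_of_nonneg_left (h s' θ (mem_closedBall_norm θ)).1 (abs_nonneg _)

/-- The mean squared projected Bellman error as a quadratic form in `E_μ[δ(θ) φ]`. -/
theorem MSPBE_eq (hφm : Measurable φ) (hφ : ∀ x, ‖φ x‖ ≤ 1) (hC : (featureMatrix φ μ).det ≠ 0)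
    (hπ : ∀ θ, IsMarkovKernel (π θ)) (hsmooth : SmoothPolicy π k₁ k₂)
    (θ : EuclideanSpace ℝ (Fin N)) :
    MSPBE m φ π μ θ = inner ℝ (meanTD m φ π μ θ) (omegaStar m φ π μ θ) := by
  obtain ⟨B, hB⟩ := exists_abs_bellman_linQ_le (m := m) hφ hπ hsmooth θ
  have h1 : projCoef φ μ (m.bellman (π θ) (linQ φ θ)) = omegaStar m φ π μ θ + θ := by
    rw [projCoef_eq hφm hφ hC (measurable_bellman_linQ hφm hsmooth θ) hB,
      integral_bellman_smul hφm hφ hπ hsmooth, map_add, featureInv_featureOp hC, omegaStar]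
  have h2 : meanTD m φ π μ θ = featureOp φ μ (omegaStar m φ π μ θ) := by
    rw [omegaStar, featureOp_featureInv hC]
  rw [real_inner_comm, h2, inner_featureOp hφm hφ, MSPBE, h1]
  refine integral_congr_ae (ae_of_all _ fun x => ?_)
  simp only [linQ, inner_add_right]; ring

/-- Only V̄ is nonlinear in θ, so the remainder of δ is γ times that of V̄. The constant does not
depend on the transition, so the estimate can be integrated. -/
theorem exists_tdError_taylor (hφ : ∀ x, ‖φ x‖ ≤ 1) (hπ : ∀ θ, IsMarkovKernel (π θ))
    (hsmooth : SmoothPolicy π k₁ k₂) (r : ℝ) :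
    ∃ L : ℝ, 0 ≤ L ∧ ∀ θ ∈ Metric.closedBall (0 : EuclideanSpace ℝ (Fin N)) r,
      ∀ θ' ∈ Metric.closedBall (0 : EuclideanSpace ℝ (Fin N)) r, ∀ x : (S × A) × S,
      |tdError m φ π θ' x.1.1 x.1.2 x.2 - tdError m φ π θ x.1.1 x.1.2 x.2
        - inner ℝ (m.γ • gradient (Vbar φ π x.2) θ - φ x.1) (θ' - θ)| ≤ L * ‖θ' - θ‖ ^ 2 := by
  obtain ⟨L, hL, h⟩ := bddLipOn_gradient_Vbar (r := r) hφ hπ hsmooth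
  refine ⟨|m.γ| * L, by positivity, fun θ hθ θ' hθ' x => ?_⟩
  have hdiff : ∀ θ, HasGradientAt (Vbar φ π x.2) (gradient (Vbar φ π x.2) θ) θ := fun θ =>
    (hasGradientAt_Vbar hsmooth x.2 θ).differentiableAt.hasGradientAt
  have := norm_taylor_one_le (convex_closedBall (0 : EuclideanSpace ℝ (Fin N)) r)
    (f := Vbar φ π x.2) (f' := fun θ => InnerProductSpace.toDual ℝ _ (gradient (Vbar φ π x.2) θ))
    (fun θ _ => (hdiff θ).hasFDerivAt) hL (fun y hy z hz => by
      rw [← map_sub, LinearIsometryEquiv.norm_map]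
      exact (h x.2 y hy).2 z hz) hθ hθ'
  rw [InnerProductSpace.toDual_apply_apply, Real.norm_eq_abs] at this
  have heq : tdError m φ π θ' x.1.1 x.1.2 x.2 - tdError m φ π θ x.1.1 x.1.2 x.2
        - inner ℝ (m.γ • gradient (Vbar φ π x.2) θ - φ x.1) (θ' - θ)
      = m.γ * (Vbar φ π x.2 θ' - Vbar φ π x.2 θ
        - inner ℝ (gradient (Vbar φ π x.2) θ) (θ' - θ)) := by
    simp only [tdError, linQ, inner_sub_left, inner_sub_right, real_inner_smul_left]
    ring
  rw [heq, abs_mul, mul_assoc]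
  exact mul_le_mul_of_nonneg_left this (abs_nonneg _)

/-- Second-order Taylor estimate of the objective on balls. -/
theorem exists_MSPBE_taylor (hφm : Measurable φ) (hφ : ∀ x, ‖φ x‖ ≤ 1)
    (hC : (featureMatrix φ μ).det ≠ 0)
    (hπ : ∀ θ, IsMarkovKernel (π θ)) (hsmooth : SmoothPolicy π k₁ k₂) (r : ℝ) :
    ∃ L : ℝ, 0 ≤ L ∧ ∀ θ ∈ Metric.closedBall (0 : EuclideanSpace ℝ (Fin N)) r,
      ∀ θ' ∈ Metric.closedBall (0 : EuclideanSpace ℝ (Fin N)) r,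
      |MSPBE m φ π μ θ' - MSPBE m φ π μ θ - inner ℝ (gradMSPBE m φ π μ θ) (θ' - θ)|
        ≤ L * ‖θ' - θ‖ ^ 2 := by
  obtain ⟨L, hL, hTaylor⟩ := exists_tdError_taylor (m := m) hφ hπ hsmooth r
  obtain ⟨B, hB, hb⟩ := bddLipOn_meanTD (Y := Unit) (m := m) (μ := μ) (r := r) hφm hφ hπ hsmooth
  obtain ⟨W, hW, hw⟩ := bddLipOn_omegaStar (Y := Unit) (m := m) (μ := μ) (r := r) hφm hφ hπ hsmooth
  refine ⟨2 * W * L + B * W, by positivity, fun θ hθ θ' hθ' => ?_⟩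
  set b := meanTD m φ π μ θ with hbdef
  set b' := meanTD m φ π μ θ' with hbdef'
  set w := omegaStar m φ π μ θ with hwdef
  set w' := omegaStar m φ π μ θ' with hwdef'
  have hmφ : Measurable fun x : (S × A) × S => φ x.1 := hφm.comp measurable_fst
  have i1 : ∀ θ, Integrable (fun x : (S × A) × S => tdError m φ π θ x.1.1 x.1.2 x.2 • φ x.1)
      (μ ⊗ₘ m.P) := fun θ =>
    (bddLipOn_td_smul hφ hπ hsmooth).integrable (mem_closedBall_norm θ)
      ((measurable_tdError_right hφm hsmooth θ).smul hmφ).aestronglyMeasurable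
  have i2 := (bddLipOn_gradMSPBE_integrand (m := m) (μ := μ) hφm hφ hπ hsmooth).integrable
    (κ := μ ⊗ₘ m.P) (mem_closedBall_norm θ)
    (measurable_gradMSPBE_integrand hφm hsmooth θ).aestronglyMeasurable
  -- Symmetry of C⁻¹ splits the increment of ⟨b, C⁻¹b⟩ into 2⟨w, b' - b⟩ and a product of two
  -- increments, the latter quadratic by Lipschitz continuity.
  have hsplit : inner ℝ b' w' - inner ℝ b w - inner ℝ (gradMSPBE m φ π μ θ) (θ' - θ)
      = (2 * inner ℝ w (b' - b) - inner ℝ (θ' - θ) (gradMSPBE m φ π μ θ))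
        + inner ℝ (b' - b) (w' - w) := by
    have h1 : inner ℝ b w' = inner ℝ w b' := by
      rw [hwdef', omegaStar, inner_featureInv_comm hφm hφ hC]; rfl
    simp only [inner_sub_left, inner_sub_right, h1, real_inner_comm w,
      real_inner_comm (gradMSPBE m φ π μ θ)]
    ring
  -- What remains of the linear part is the mean of the Taylor remainders of δ, weighted by 2⟨φ, w⟩.
  have hint : 2 * inner ℝ w (b' - b) - inner ℝ (θ' - θ) (gradMSPBE m φ π μ θ)
      = ∫ x, 2 * inner ℝ (φ x.1) w * (tdError m φ π θ' x.1.1 x.1.2 x.2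
        - tdError m φ π θ x.1.1 x.1.2 x.2
        - inner ℝ (m.γ • gradient (Vbar φ π x.2) θ - φ x.1) (θ' - θ)) ∂(μ ⊗ₘ m.P) := by
    have i3 : Integrable (fun x : (S × A) × S => tdError m φ π θ' x.1.1 x.1.2 x.2 • φ x.1
        - tdError m φ π θ x.1.1 x.1.2 x.2 • φ x.1) (μ ⊗ₘ m.P) := (i1 θ').sub (i1 θ)
    rw [hbdef, hbdef', meanTD, meanTD, ← integral_sub (i1 θ') (i1 θ), gradMSPBE,
      ← integral_inner i3, ← integral_inner i2, ← integral_const_mul,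
      ← integral_sub]
    · refine integral_congr_ae (ae_of_all _ fun x => ?_)
      simp only [← sub_smul, inner_smul_right, real_inner_comm w (φ x.1), ← hwdef,
        real_inner_comm (θ' - θ) (m.γ • gradient (Vbar φ π x.2) θ - φ x.1)]
      ring
    · exact (i3.const_inner w).const_mul 2
    · exact i2.const_inner (θ' - θ)
  rw [MSPBE_eq hφm hφ hC hπ hsmooth, MSPBE_eq hφm hφ hC hπ hsmooth, hsplit, hint]
  refine (abs_add_le _ _).trans ?_
  rw [add_mul]
  refine add_le_add (abs_integral_le_of_abs_le (ae_of_all _ fun x => ?_)) ?_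
  · rw [abs_mul, mul_assoc]
    have h1 : |2 * inner ℝ (φ x.1) w| ≤ 2 * W := by
      rw [abs_mul, abs_two]
      gcongr
      exact (abs_inner_feature_le hφ w x.1).trans (hw () θ hθ).1
    rw [mul_assoc] at *
    calc _ ≤ (2 * W) * (L * ‖θ' - θ‖ ^ 2) :=
          mul_le_mul h1 (hTaylor θ hθ θ' hθ' x) (abs_nonneg _) (by positivity)
      _ = _ := by ring
  · refine (abs_real_inner_le_norm _ _).trans ?_
    have h1 := (hb () θ' hθ').2 θ hθ
    have h2 := (hw () θ' hθ').2 θ hθ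
    calc ‖b' - b‖ * ‖w' - w‖ ≤ (B * ‖θ' - θ‖) * (W * ‖θ' - θ‖) :=
          mul_le_mul h1 h2 (norm_nonneg _) (by positivity)
      _ = _ := by ring

theorem hasGradientAt_MSPBE (hφm : Measurable φ) (hφ : ∀ x, ‖φ x‖ ≤ 1)
    (hC : (featureMatrix φ μ).det ≠ 0)
    (hπ : ∀ θ, IsMarkovKernel (π θ)) (hsmooth : SmoothPolicy π k₁ k₂)
    (θ : EuclideanSpace ℝ (Fin N)) :
    HasGradientAt (MSPBE m φ π μ) (gradMSPBE m φ π μ θ) θ := by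
  -- The extra 1 makes the ball a neighbourhood of θ.
  obtain ⟨L, -, h⟩ := exists_MSPBE_taylor (m := m) hφm hφ hC hπ hsmooth (‖θ‖ + 1)
  rw [hasGradientAt_iff_hasFDerivAt]
  refine hasFDerivAt_of_norm_sub_le_sq (D := Metric.closedBall 0 (‖θ‖ + 1)) (L := L) ?_
    fun y hy => ?_
  · refine Filter.mem_of_superset (Metric.ball_mem_nhds θ one_pos) fun y hy => ?_
    rw [mem_closedBall_zero_iff]
    rw [mem_ball_iff_norm] at hy
    have := norm_le_norm_add_norm_sub' y θ
    linarith
  · rw [InnerProductSpace.toDual_apply_apply, Real.norm_eq_abs]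
    exact h θ (by simp) y hy

theorem gradient_MSPBE (hφm : Measurable φ) (hφ : ∀ x, ‖φ x‖ ≤ 1)
    (hC : (featureMatrix φ μ).det ≠ 0)
    (hπ : ∀ θ, IsMarkovKernel (π θ)) (hsmooth : SmoothPolicy π k₁ k₂)
    (θ : EuclideanSpace ℝ (Fin N)) :
    gradient (MSPBE m φ π μ) θ = gradMSPBE m φ π μ θ :=
  (hasGradientAt_MSPBE hφm hφ hC hπ hsmooth θ).gradient

/-- The mean increment of the fast iterate. -/
theorem integral_omegaDir (hφm : Measurable φ) (hφ : ∀ x, ‖φ x‖ ≤ 1)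
    (hC : (featureMatrix φ μ).det ≠ 0)
    (hπ : ∀ θ, IsMarkovKernel (π θ)) (hsmooth : SmoothPolicy π k₁ k₂)
    (z : EuclideanSpace ℝ (Fin N) × EuclideanSpace ℝ (Fin N)) :
    ∫ x, omegaDir m φ π z x ∂(μ ⊗ₘ m.P) = -featureOp φ μ (z.2 - omegaStar m φ π μ z.1) := by
  have i1 : Integrable (fun x : (S × A) × S => tdError m φ π z.1 x.1.1 x.1.2 x.2 • φ x.1)
      (μ ⊗ₘ m.P) :=
    (bddLipOn_td_smul hφ hπ hsmooth).integrable (mem_closedBall_norm z.1)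
      ((measurable_tdError_right hφm hsmooth z.1).smul
        (hφm.comp measurable_fst)).aestronglyMeasurable
  have i2 : Integrable (fun x : (S × A) × S => (inner ℝ (φ x.1) z.2 : ℝ) • φ x.1)
      (μ ⊗ₘ m.P) := by
    refine Integrable.of_bound (((measurable_inner_feature hφm z.2).smul hφm).comp
      measurable_fst).aestronglyMeasurable ‖z.2‖ (ae_of_all _ fun x => ?_)
    rw [norm_smul, Real.norm_eq_abs]
    exact (mul_le_of_le_one_right (abs_nonneg _) (hφ _)).trans (abs_inner_feature_le hφ z.2 _)
  simp only [omegaDir, sub_smul]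
  rw [integral_sub i1 i2, integral_feature_fst hφm hφ, map_sub, omegaStar,
    featureOp_featureInv hC, meanTD]
  abel

/-- Up to the tracking error, the mean increment of `θ` is a descent direction. -/
theorem exists_inner_gradMSPBE_thetaDir_le (hφm : Measurable φ) (hφ : ∀ x, ‖φ x‖ ≤ 1)
    (hC : (featureMatrix φ μ).det ≠ 0)
    (hπ : ∀ θ, IsMarkovKernel (π θ)) (hsmooth : SmoothPolicy π k₁ k₂) (r : ℝ) :
    ∃ c : ℝ, 0 ≤ c ∧ ∀ z : EuclideanSpace ℝ (Fin N) × EuclideanSpace ℝ (Fin N), ‖z.1‖ ≤ r →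
      inner ℝ (gradMSPBE m φ π μ z.1) (∫ x, thetaDir m φ π z x ∂(μ ⊗ₘ m.P))
        ≤ -(1 / 4) * ‖gradMSPBE m φ π μ z.1‖ ^ 2
          + c * ‖z.2 - omegaStar m φ π μ z.1‖ ^ 2 := by
  obtain ⟨B, hB, hψ⟩ := bddLipOn_gradient_Vbar (r := r) hφ hπ hsmooth
  refine ⟨(|m.γ| * B) ^ 2, by positivity, fun z hz => ?_⟩
  set g := gradMSPBE m φ π μ z.1 with hg
  set w := omegaStar m φ π μ z.1 with hw
  have hmφ : Measurable fun x : (S × A) × S => φ x.1 := hφm.comp measurable_fst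
  have hψz : ∀ s', ‖gradient (Vbar φ π s') z.1‖ ≤ B := fun s' =>
    (hψ s' z.1 (by simpa using hz)).1
  have i1 : Integrable (fun x : (S × A) × S => tdError m φ π z.1 x.1.1 x.1.2 x.2 • φ x.1)
      (μ ⊗ₘ m.P) :=
    (bddLipOn_td_smul hφ hπ hsmooth).integrable (mem_closedBall_norm z.1)
      ((measurable_tdError_right hφm hsmooth z.1).smul hmφ).aestronglyMeasurable
  have hcorrB : ∀ (v : EuclideanSpace ℝ (Fin N)) (x : (S × A) × S),
      ‖(m.γ * inner ℝ v (φ x.1)) • gradient (Vbar φ π x.2) z.1‖ ≤ (|m.γ| * B) * ‖v‖ := by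
    intro v x
    rw [norm_smul, Real.norm_eq_abs, abs_mul, real_inner_comm]
    calc _ ≤ |m.γ| * ‖v‖ * B := by
          gcongr
          · exact abs_inner_feature_le hφ v x.1
          · exact hψz x.2
      _ = _ := by ring
  have i2 : ∀ v, Integrable (fun x : (S × A) × S =>
      (m.γ * inner ℝ v (φ x.1)) • gradient (Vbar φ π x.2) z.1) (μ ⊗ₘ m.P) := fun v =>
    Integrable.of_bound (((measurable_const.inner hmφ).const_mul _).fun_smul
      (measurable_gradient_Vbar_right hφm hsmooth z.1)).aestronglyMeasurable _
      (ae_of_all _ (hcorrB v))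
  have i3 : Integrable (fun x : (S × A) × S => (inner ℝ (φ x.1) w : ℝ) • φ x.1)
      (μ ⊗ₘ m.P) := by
    refine Integrable.of_bound (((measurable_inner_feature hφm w).smul hφm).comp
      measurable_fst).aestronglyMeasurable ‖w‖ (ae_of_all _ fun x => ?_)
    rw [norm_smul, Real.norm_eq_abs]
    exact (mul_le_of_le_one_right (abs_nonneg _) (hφ _)).trans (abs_inner_feature_le hφ w _)
  -- Since b = Cω* = E[⟨φ, ω*⟩ φ], the mean TD term appears inside ∇J; at ω = ω* the mean increment
  -- of θ is exactly -½ ∇J.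
  have hgrad : g = (2 : ℝ) • ∫ x, (m.γ * inner ℝ w (φ x.1)) • gradient (Vbar φ π x.2) z.1
      ∂(μ ⊗ₘ m.P) - (2 : ℝ) • meanTD m φ π μ z.1 := by
    have h1 : meanTD m φ π μ z.1 = featureOp φ μ w := by
      rw [hw, omegaStar, featureOp_featureInv hC]
    rw [h1, ← integral_feature_fst (m := m) hφm hφ, ← smul_sub, ← integral_sub (i2 w) i3,
      ← integral_smul, hg, gradMSPBE]
    refine integral_congr_ae (ae_of_all _ fun x => ?_)
    simp only [real_inner_comm (φ x.1) w, ← hw]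
    module
  have herr : ∫ x, thetaDir m φ π z x ∂(μ ⊗ₘ m.P) = (-(1 / 2) : ℝ) • g
      - ∫ x, (m.γ * inner ℝ (z.2 - w) (φ x.1)) • gradient (Vbar φ π x.2) z.1 ∂(μ ⊗ₘ m.P) := by
    have h1 : ∀ x : (S × A) × S,
        (m.γ * inner ℝ (z.2 - w) (φ x.1)) • gradient (Vbar φ π x.2) z.1
        = (m.γ * inner ℝ z.2 (φ x.1)) • gradient (Vbar φ π x.2) z.1
          - (m.γ * inner ℝ w (φ x.1)) • gradient (Vbar φ π x.2) z.1 := by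
      intro x
      rw [inner_sub_left, mul_sub, sub_smul]
    simp_rw [h1]
    rw [integral_sub (i2 z.2) (i2 w), hgrad]
    unfold thetaDir
    rw [integral_sub i1 (i2 z.2), ← meanTD]
    module
  have hbound : ‖∫ x, (m.γ * inner ℝ (z.2 - w) (φ x.1)) • gradient (Vbar φ π x.2) z.1
      ∂(μ ⊗ₘ m.P)‖ ≤ (|m.γ| * B) * ‖z.2 - w‖ := by
    simpa using norm_integral_le_of_norm_le_const (μ := μ ⊗ₘ m.P)
      (ae_of_all _ (hcorrB (z.2 - w)))
  rw [herr, inner_sub_right, inner_smul_right, real_inner_self_eq_norm_sq]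
  set e := ∫ x, (m.γ * inner ℝ (z.2 - w) (φ x.1)) • gradient (Vbar φ π x.2) z.1 ∂(μ ⊗ₘ m.P)
  have h1 : -(inner ℝ g e : ℝ) ≤ ‖g‖ * ‖e‖ := (neg_le_abs _).trans (abs_real_inner_le_norm _ _)
  have h2 : ‖e‖ ^ 2 ≤ (|m.γ| * B) ^ 2 * ‖z.2 - w‖ ^ 2 := by
    rw [← mul_pow]; gcongr
  -- Young: ‖g‖‖e‖ ≤ ‖g‖²/4 + ‖e‖² leaves -¼ out of -½.
  nlinarith [sq_nonneg (‖g‖ / 2 - ‖e‖)]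

end MeanField

/-! ### Conditional laws along the trajectory, and the noise of the iterates. -/

section Trajectory

theorem measurable_integral_kernel_prodMkLeft {Z X Y : Type*} [MeasurableSpace Z]
    [MeasurableSpace X] [MeasurableSpace Y] (κ : Kernel X Y) [IsSFiniteKernel κ]
    {f : (Z × X) × Y → ℝ} (hf : Measurable f) :
    Measurable fun p : Z × X => ∫ y, f (p, y) ∂(κ p.2) :=
  (StronglyMeasurable.integral_kernel_prod_right' (κ := Kernel.prodMkLeft Z κ)
    hf.stronglyMeasurable).measurable

theorem HasCondDistrib.integral_eq {Ω X Y : Type*} [MeasurableSpace Ω] [MeasurableSpace X]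
    [MeasurableSpace Y] {Pr : Measure Ω} [IsProbabilityMeasure Pr] {κ : Kernel X Y}
    [IsMarkovKernel κ] {U : Ω → X} {V : Ω → Y} (h : HasCondDistrib V U κ Pr)
    {f : X × Y → ℝ} (hf : Measurable f) {C : ℝ} (hC : ∀ p, |f p| ≤ C) :
    ∫ ω, f (U ω, V ω) ∂Pr = ∫ ω, ∫ y, f (U ω, y) ∂(κ (U ω)) ∂Pr := by
  have hprob : IsProbabilityMeasure (Pr.map U) :=
    Measure.isProbabilityMeasure_map h.aemeasurable_fst
  have h1 : ∫ ω, f (U ω, V ω) ∂Pr = ∫ p, f p ∂(Pr.map fun ω => (U ω, V ω)) :=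
    (integral_map h.aemeasurable hf.aestronglyMeasurable).symm
  have hm : Measurable fun x => ∫ y, f (x, y) ∂(κ x) :=
    (StronglyMeasurable.integral_kernel_prod_right' (κ := κ) hf.stronglyMeasurable).measurable
  rw [h1, h.map_eq, Measure.integral_compProd (integrable_of_measurable_of_abs_le hf hC),
    integral_map h.aemeasurable_fst hm.aestronglyMeasurable]

variable {S A : Type*} [MeasurableSpace S] [MeasurableSpace A]

/-- One-step disintegration along a trajectory: a bounded function of a quantity determined by
the past up to `S_t` and of the next transition is averaged over `πb` and `P`. -/
theorem MDP.IsTrajectory.integral_eq {m : MDP S A} {πb : Kernel S A} [IsMarkovKernel πb]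
    {Ω Z : Type*} [MeasurableSpace Ω] [MeasurableSpace Z] {Pr : Measure Ω} [IsProbabilityMeasure Pr]
    {st : ℕ → Ω → S} {ac : ℕ → Ω → A} (h : m.IsTrajectory πb Pr st ac) (t : ℕ)
    {Ψ : (Fin t → S × A) × S → Z} (hΨ : Measurable Ψ) {f : Z × ((S × A) × S) → ℝ}
    (hf : Measurable f) {C : ℝ} (hC : ∀ p, |f p| ≤ C) :
    ∫ ω, f (Ψ (fun i => (st i ω, ac i ω), st t ω), ((st t ω, ac t ω), st (t + 1) ω)) ∂Pr
      = ∫ ω, ∫ a, ∫ s', f (Ψ (fun i => (st i ω, ac i ω), st t ω), ((st t ω, a), s'))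
          ∂(m.P (st t ω, a)) ∂(πb (st t ω)) ∂Pr := by
  let G : Z × (S × A) → ℝ := fun p => ∫ s', f (p.1, (p.2, s')) ∂(m.P p.2)
  have hG : Measurable G := measurable_integral_kernel_prodMkLeft m.P
    (f := fun q : (Z × (S × A)) × S => f (q.1.1, (q.1.2, q.2))) (hf.comp (by fun_prop))
  have hGC : ∀ p, |G p| ≤ C := fun p => abs_integral_le_of_abs_le (ae_of_all _ fun _ => hC _)
  have h1 := HasCondDistrib.integral_eq (h.state_law t)
    (f := fun q : ((Fin t → S × A) × (S × A)) × S =>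
      f (Ψ (q.1.1, q.1.2.1), (q.1.2, q.2))) (hf.comp (by fun_prop)) (fun q => hC _)
  have h2 := HasCondDistrib.integral_eq (h.action_law t)
    (f := fun q : ((Fin t → S × A) × S) × A => G (Ψ q.1, (q.1.2, q.2)))
    (hG.comp (by fun_prop)) (fun q => hGC _)
  exact h1.trans h2

/-- The pair chain draws its action last, so invariance exhibits μ as (P ∘ μ) ⊗ πb, whose first
marginal is P ∘ μ. This links averages under μ to the state marginal, for which mixing is assumed.
-/
theorem MDP.measure_eq_compProd {m : MDP S A} {πb : Kernel S A} [IsMarkovKernel πb]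
    {μ : Measure (S × A)} [IsProbabilityMeasure μ] (hμ : (m.pairKernel πb).Invariant μ) :
    μ.fst ⊗ₘ πb = μ := by
  have h1 : (m.P ∘ₘ μ) ⊗ₘ πb = μ := by
    rw [Measure.compProd_eq_comp_prod, Measure.comp_assoc]
    exact hμ
  have h2 : μ.fst = m.P ∘ₘ μ := by
    conv_lhs => rw [← h1]
    exact Measure.fst_compProd _ _
  rw [h2, h1]

theorem MDP.integral_stateKernel {m : MDP S A} {πb : Kernel S A} [IsMarkovKernel πb]
    {f : S → ℝ} (hf : Measurable f) {C : ℝ} (hC : ∀ s, |f s| ≤ C) (s : S) :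
    ∫ s', f s' ∂(m.stateKernel πb s) = ∫ a, ∫ s', f s' ∂(m.P (s, a)) ∂(πb s) := by
  have hm : Measurable fun x => ∫ s', f s' ∂(m.P x) :=
    (StronglyMeasurable.integral_kernel_prod_right' (κ := m.P)
      (f := fun p : (S × A) × S => f p.2)
      (hf.comp measurable_snd).stronglyMeasurable).measurable
  rw [MDP.stateKernel, Kernel.integral_comp (integrable_of_measurable_of_abs_le hf hC),
    Kernel.prod_apply, Kernel.id_apply, Measure.dirac_prod,
    integral_map measurable_prodMk_left.aemeasurable hm.aestronglyMeasurable]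

instance (m : MDP S A) (πb : Kernel S A) [IsMarkovKernel πb] :
    IsMarkovKernel (m.stateKernel πb) := by
  unfold MDP.stateKernel; infer_instance

section Iterates

variable [Fintype A] [MeasurableSingletonClass A] {N : ℕ} {m : MDP S A}
  {φ : S × A → EuclideanSpace ℝ (Fin N)} {π : EuclideanSpace ℝ (Fin N) → Kernel S A} {k₁ k₂ : ℝ}

theorem greedyGQ_succ (α β : ℕ → ℝ) (θ₀ ω₀ : EuclideanSpace ℝ (Fin N)) (s : ℕ → S) (a : ℕ → A)
    (t : ℕ) :
    greedyGQ m φ π α β θ₀ ω₀ s a (t + 1) =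
      ((greedyGQ m φ π α β θ₀ ω₀ s a t).1 + α t •
          thetaDir m φ π (greedyGQ m φ π α β θ₀ ω₀ s a t) ((s t, a t), s (t + 1)),
        (greedyGQ m φ π α β θ₀ ω₀ s a t).2 + β t •
          omegaDir m φ π (greedyGQ m φ π α β θ₀ ω₀ s a t) ((s t, a t), s (t + 1))) :=
  rfl

/-- The iterate at time t reads S_t but not A_t, so conditioning on what determines it leaves A_t
distributed as πb(·|S_t). -/
theorem greedyGQ_congr (α β : ℕ → ℝ) (θ₀ ω₀ : EuclideanSpace ℝ (Fin N)) {s s' : ℕ → S}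
    {a a' : ℕ → A} (t : ℕ) (hs : ∀ i ≤ t, s i = s' i) (ha : ∀ i < t, a i = a' i) :
    greedyGQ m φ π α β θ₀ ω₀ s a t = greedyGQ m φ π α β θ₀ ω₀ s' a' t := by
  induction t with
  | zero => rfl
  | succ t ih =>
    have ih := ih (fun i hi => hs i (hi.trans t.le_succ)) fun i hi => ha i (hi.trans t.lt_succ_self)
    rw [greedyGQ_succ, greedyGQ_succ, ih, hs t t.le_succ, ha t t.lt_succ_self, hs (t + 1) le_rfl]

theorem measurable_greedyGQ (hφm : Measurable φ) (hsmooth : SmoothPolicy π k₁ k₂) (α β : ℕ → ℝ)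
    (θ₀ ω₀ : EuclideanSpace ℝ (Fin N)) {Y : Type*} [MeasurableSpace Y] {s : Y → ℕ → S}
    {a : Y → ℕ → A} (hs : ∀ t, Measurable fun y => s y t) (ha : ∀ t, Measurable fun y => a y t)
    (t : ℕ) : Measurable fun y => greedyGQ m φ π α β θ₀ ω₀ (s y) (a y) t := by
  induction t with
  | zero => exact measurable_const
  | succ t ih =>
    simp_rw [greedyGQ_succ]
    have hx : Measurable fun y => (greedyGQ m φ π α β θ₀ ω₀ (s y) (a y) t,
        ((s y t, a y t), s y (t + 1))) :=
      ih.prodMk (((hs t).prodMk (ha t)).prodMk (hs (t + 1)))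
    have h1 := (measurable_thetaDir (m := m) hφm hsmooth).comp hx
    have h2 := (measurable_omegaDir (m := m) hφm hsmooth).comp hx
    exact (ih.fst.add (h1.const_smul (α t))).prodMk (ih.snd.add (h2.const_smul (β t)))

/-- The iterate at time `t` is a measurable function of the history before `t` and `S_t`. -/
theorem exists_measurable_greedyGQ_eq [Nonempty A] (hφm : Measurable φ)
    (hsmooth : SmoothPolicy π k₁ k₂)
    (α β : ℕ → ℝ) (θ₀ ω₀ : EuclideanSpace ℝ (Fin N)) (t : ℕ) :
    ∃ Ψ : (Fin t → S × A) × S → EuclideanSpace ℝ (Fin N) × EuclideanSpace ℝ (Fin N),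
      Measurable Ψ ∧ ∀ (s : ℕ → S) (a : ℕ → A),
        Ψ (fun i => (s i, a i), s t) = greedyGQ m φ π α β θ₀ ω₀ s a t := by
  -- The finite history is padded to infinite sequences: by S_t for states and by an arbitrary
  -- action. Apart from S_t itself the padding is never read.
  let s' : (Fin t → S × A) × S → ℕ → S := fun p i => if h : i < t then (p.1 ⟨i, h⟩).1 else p.2
  let a' : (Fin t → S × A) × S → ℕ → A := fun p i =>
    if h : i < t then (p.1 ⟨i, h⟩).2 else Classical.arbitrary A
  refine ⟨fun p => greedyGQ m φ π α β θ₀ ω₀ (s' p) (a' p) t, ?_, fun s a => ?_⟩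
  · refine measurable_greedyGQ hφm hsmooth α β θ₀ ω₀ (fun i => ?_) (fun i => ?_) t
    · by_cases h : i < t
      · simp only [s', h, dite_true]; fun_prop
      · simp only [s', h, dite_false]; fun_prop
    · by_cases h : i < t
      · simp only [a', h, dite_true]; fun_prop
      · simp only [a', h, dite_false]; fun_prop
  · refine greedyGQ_congr α β θ₀ ω₀ t (fun i hi => ?_) fun i hi => ?_
    · rcases hi.lt_or_eq with h | rfl
      · simp [s', h]
      · simp [s']
    · simp [a', hi]

/-- The expectations of a stationary-centred, bounded and Lipschitz function of the iterates and
the current transition sum to at most a constant plus a multiple of the total movement. -/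
theorem exists_abs_sum_noise_le {πb : Kernel S A} [IsMarkovKernel πb]
    {μ : Measure (S × A)} [IsProbabilityMeasure μ] (hμ : (m.pairKernel πb).Invariant μ)
    {c ρ : ℝ} (hc : 0 ≤ c) (hρ : 0 ≤ ρ) (hρ' : ρ < 1) (hmix : m.GeomErgodic πb μ.fst c ρ)
    (hφm : Measurable φ) (hsmooth : SmoothPolicy π k₁ k₂) {r : ℝ}
    {n : EuclideanSpace ℝ (Fin N) × EuclideanSpace ℝ (Fin N) → (S × A) × S → ℝ}
    (hn : Measurable fun p : (EuclideanSpace ℝ (Fin N) × EuclideanSpace ℝ (Fin N)) ×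
      ((S × A) × S) => n p.1 p.2)
    (hbl : BddLipOn (Metric.closedBall 0 r) n)
    (h0 : ∀ z ∈ Metric.closedBall 0 r, ∫ x, n z x ∂(μ ⊗ₘ m.P) = 0) :
    ∃ C : ℝ, 0 ≤ C ∧ ∀ (Ω : Type*) [MeasurableSpace Ω] (Pr : Measure Ω) [IsProbabilityMeasure Pr]
      (st : ℕ → Ω → S) (ac : ℕ → Ω → A) (θ₀ ω₀ : EuclideanSpace ℝ (Fin N)) (α β : ℕ → ℝ)
      (T : ℕ) (η : ℝ), 0 ≤ η → m.IsTrajectory πb Pr st ac →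
      (∀ᵐ ω ∂Pr, ∀ t ≤ T, greedyGQ m φ π α β θ₀ ω₀ (fun i => st i ω) (fun i => ac i ω) t
        ∈ Metric.closedBall 0 r) →
      (∀ t < T, ∀ᵐ ω ∂Pr,
        ‖greedyGQ m φ π α β θ₀ ω₀ (fun i => st i ω) (fun i => ac i ω) (t + 1)
          - greedyGQ m φ π α β θ₀ ω₀ (fun i => st i ω) (fun i => ac i ω) t‖ ≤ η) →
      |∑ t ∈ Finset.range T, ∫ ω,
        n (greedyGQ m φ π α β θ₀ ω₀ (fun i => st i ω) (fun i => ac i ω) t)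
          ((st t ω, ac t ω), st (t + 1) ω) ∂Pr| ≤ C * (1 + T * η) := by
  classical
  obtain ⟨B, hB, hnB⟩ := hbl
  set D : Set (EuclideanSpace ℝ (Fin N) × EuclideanSpace ℝ (Fin N)) := Metric.closedBall 0 r
    with hD
  have hDm : MeasurableSet D := measurableSet_closedBall
  -- Cut off outside the ball, because the noise lemma needs a global bound; almost surely the
  -- iterates do not see the cut-off. Averaging over s' and then over a leaves a function of (z, s)
  -- only, to which mixing of the state chain applies.
  let f : (EuclideanSpace ℝ (Fin N) × EuclideanSpace ℝ (Fin N)) × ((S × A) × S) → ℝ :=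
    fun p => if p.1 ∈ D then n p.1 p.2 else 0
  have hf : Measurable f := Measurable.ite (measurable_fst hDm) hn measurable_const
  have hfB : ∀ p, |f p| ≤ B := by
    intro p
    by_cases hp : p.1 ∈ D
    · simp only [f, hp, if_true]
      exact (hnB p.2 p.1 hp).1
    · simp [f, hp, hB]
  have hfD : ∀ z ∈ D, ∀ x, f (z, x) = n z x := fun z hz x => by simp [f, hz]
  let G : (EuclideanSpace ℝ (Fin N) × EuclideanSpace ℝ (Fin N)) × (S × A) → ℝ :=
    fun p => ∫ s', f (p.1, (p.2, s')) ∂(m.P p.2)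
  have hG : Measurable G := measurable_integral_kernel_prodMkLeft m.P
    (f := fun q : ((EuclideanSpace ℝ (Fin N) × EuclideanSpace ℝ (Fin N)) × (S × A)) × S =>
      f (q.1.1, (q.1.2, q.2))) (hf.comp (by fun_prop))
  have hGB : ∀ p, |G p| ≤ B := fun p => abs_integral_le_of_abs_le (ae_of_all _ fun _ => hfB _)
  let g : (EuclideanSpace ℝ (Fin N) × EuclideanSpace ℝ (Fin N)) × S → ℝ :=
    fun p => ∫ a, G (p.1, (p.2, a)) ∂(πb p.2)
  have hg : Measurable g := measurable_integral_kernel_prodMkLeft πb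
    (f := fun q : ((EuclideanSpace ℝ (Fin N) × EuclideanSpace ℝ (Fin N)) × S) × A =>
      G (q.1.1, (q.1.2, q.2))) (hG.comp (by fun_prop))
  have hgB : ∀ p, |g p| ≤ B := fun p => abs_integral_le_of_abs_le (ae_of_all _ fun _ => hGB _)
  have hfi : ∀ z (ν : Measure S) [IsProbabilityMeasure ν] x,
      Integrable (fun s' => f (z, (x, s'))) ν := fun z ν _ x =>
    integrable_of_measurable_of_abs_le (hf.comp (by fun_prop)) fun _ => hfB _
  have hGi : ∀ z (ν : Measure A) [IsProbabilityMeasure ν] s,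
      Integrable (fun a => G (z, (s, a))) ν := fun z ν _ s =>
    integrable_of_measurable_of_abs_le (hG.comp (by fun_prop)) fun _ => hGB _
  have hGL : ∀ z ∈ D, ∀ z' ∈ D, ∀ x, |G (z, x) - G (z', x)| ≤ B * ‖z - z'‖ := by
    intro z hz z' hz' x
    simp only [G]
    rw [← integral_sub (hfi z _ x) (hfi z' _ x)]
    refine abs_integral_le_of_abs_le (ae_of_all _ fun s' => ?_)
    rw [hfD z hz, hfD z' hz']
    exact (hnB _ z hz).2 z' hz'
  have hgL : ∀ z ∈ D, ∀ z' ∈ D, ∀ s, |g (z, s) - g (z', s)| ≤ B * ‖z - z'‖ := by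
    intro z hz z' hz' s
    simp only [g]
    rw [← integral_sub (hGi z _ s) (hGi z' _ s)]
    exact abs_integral_le_of_abs_le (ae_of_all _ fun a => hGL z hz z' hz' _)
  have hg0 : ∀ z ∈ D, ∫ s, g (z, s) ∂μ.fst = 0 := by
    intro z hz
    have i1 : Integrable (fun x => G (z, x)) (μ.fst ⊗ₘ πb) :=
      integrable_of_measurable_of_abs_le (hG.comp (by fun_prop)) fun _ => hGB _
    have i2 : Integrable (fun x => f (z, x)) (μ ⊗ₘ m.P) :=
      integrable_of_measurable_of_abs_le (hf.comp (by fun_prop)) fun _ => hfB _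
    have e1 := Measure.integral_compProd i1
    have e2 := Measure.integral_compProd i2
    rw [MDP.measure_eq_compProd hμ] at e1
    simp only [g]
    rw [← e1]
    simp only [G]
    rw [← e2]
    simp_rw [hfD z hz]
    exact h0 z hz
  refine ⟨2 * (1 + 2 * c / (1 - ρ)) * B, ?_, ?_⟩
  · have : 0 < 1 - ρ := by linarith
    positivity
  intro Ω _ Pr _ st ac θ₀ ω₀ α β T η hη htraj hbdd hmove
  have hΩ : Nonempty Ω := nonempty_of_isProbabilityMeasure Pr
  have hA : Nonempty A := ⟨ac 0 hΩ.some⟩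
  set z : ℕ → Ω → EuclideanSpace ℝ (Fin N) × EuclideanSpace ℝ (Fin N) := fun t ω =>
    greedyGQ m φ π α β θ₀ ω₀ (fun i => st i ω) (fun i => ac i ω) t with hzdef
  have hzm : ∀ t, Measurable (z t) := fun t =>
    measurable_greedyGQ hφm hsmooth α β θ₀ ω₀ htraj.measurable_state htraj.measurable_action t
  have disint : ∀ t, ∀ F : (EuclideanSpace ℝ (Fin N) × EuclideanSpace ℝ (Fin N)) ×
      ((S × A) × S) → ℝ, Measurable F → ∀ C : ℝ, (∀ p, |F p| ≤ C) →
      ∫ ω, F (z t ω, ((st t ω, ac t ω), st (t + 1) ω)) ∂Pr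
        = ∫ ω, ∫ a, ∫ s', F (z t ω, ((st t ω, a), s')) ∂(m.P (st t ω, a)) ∂(πb (st t ω)) ∂Pr := by
    intro t F hF C hC
    obtain ⟨Ψ, hΨ, hΨz⟩ := exists_measurable_greedyGQ_eq (m := m) hφm hsmooth α β θ₀ ω₀ t
    have := htraj.integral_eq t hΨ hF hC
    have e : ∀ ω, Ψ (fun i => (st i ω, ac i ω), st t ω) = z t ω := fun ω =>
      hΨz (fun i => st i ω) fun i => ac i ω
    simp_rw [e] at this
    exact this
  have hsum := abs_sum_integral_le_of_geomErgodic (m.stateKernel πb) μ.fst hc hρ hρ' hmix hg hB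
    hgB hgL hg0 Pr hzm htraj.measurable_state (fun t F hF C hC => by
      rw [disint t (fun p => F (p.1, p.2.2)) (hF.comp (by fun_prop)) C fun p => hC _]
      refine integral_congr_ae (ae_of_all _ fun ω => ?_)
      exact (MDP.integral_stateKernel (hF.comp measurable_prodMk_left) (fun s => hC _) _).symm)
    T hη hbdd hmove
  refine le_trans (le_of_eq ?_) hsum
  congr 1
  refine Finset.sum_congr rfl fun t ht => ?_
  have ht := Finset.mem_range.1 ht
  rw [← disint t f hf B hfB]
  refine integral_congr_ae ?_
  filter_upwards [hbdd] with ω hω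
  exact (hfD _ (hω t ht.le) _).symm

end Iterates

end Trajectory

/-! ### Drift inequalities for the objective and the tracking error. -/

section Drift

/-- Summation of the coupled drift inequalities of the objective `j` and the squared tracking
error `y` for the stepsizes `p⁻²` and `p⁻¹` over `p³` steps. -/
theorem sum_le_of_drift {T : ℕ} {p : ℝ} (hp : 1 ≤ p) (hT : (T : ℝ) = p ^ 3) {c l : ℝ}
    (hc : 0 ≤ c) (hl : 0 < l) {j y g n₁ n₂ : ℕ → ℝ}
    (hj : ∀ t < T, j (t + 1) ≤ j t + 1 / p ^ 2 * (-(1 / 4) * g t + c * y t) + 1 / p ^ 2 * n₁ t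
      + c * (1 / p ^ 2) ^ 2)
    (hy : ∀ t < T, y (t + 1) ≤ y t - 1 / p * l * y t + 2 * (1 / p) * n₂ t
      + c * ((1 / p) ^ 2 + (1 / p ^ 2) ^ 2 / (1 / p)))
    (hj0 : |j 0| ≤ c) (hjT : |j T| ≤ c) (hy0 : y 0 ≤ c) (hyT : 0 ≤ y T)
    (hn₁ : |∑ t ∈ Finset.range T, n₁ t| ≤ c * (1 + T * (1 / p)))
    (hn₂ : |∑ t ∈ Finset.range T, n₂ t| ≤ c * (1 + T * (1 / p))) :
    ∑ t ∈ Finset.range T, g t ≤ 4 * (5 * c + 7 * c ^ 2 / l) * p ^ 2 := by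
  have hp0 : 0 < p := by linarith
  set Y := ∑ t ∈ Finset.range T, y t with hY
  set G := ∑ t ∈ Finset.range T, g t with hG
  set N₁ := ∑ t ∈ Finset.range T, n₁ t
  set N₂ := ∑ t ∈ Finset.range T, n₂ t
  have hTp : (T : ℝ) * (1 / p) = p ^ 2 := by rw [hT]; field_simp
  rw [hTp] at hn₁ hn₂
  have hn₁ := (abs_le.1 hn₁).2
  have hn₂ := (abs_le.1 hn₂).2
  -- After multiplication by p the sum is at most 2c + 2cp + 3cp², hence 7cp² as p ≥ 1.
  have hYle : l * Y ≤ 7 * c * p ^ 2 := by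
    have h1 : ∑ t ∈ Finset.range T, (y (t + 1) - y t) ≤ ∑ t ∈ Finset.range T,
        (-(1 / p * l) * y t + 2 * (1 / p) * n₂ t
          + c * ((1 / p) ^ 2 + (1 / p ^ 2) ^ 2 / (1 / p))) :=
      Finset.sum_le_sum fun t ht => by linarith [hy t (Finset.mem_range.1 ht)]
    rw [Finset.sum_range_sub, Finset.sum_add_distrib, Finset.sum_add_distrib, ← Finset.mul_sum,
      ← Finset.mul_sum, Finset.sum_const, Finset.card_range, nsmul_eq_mul, hT] at h1
    have h2 : p ^ 3 * (c * ((1 / p) ^ 2 + (1 / p ^ 2) ^ 2 / (1 / p))) = c * (p + 1) := by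
      field_simp
    rw [h2] at h1
    have h3 : 1 / p * l * Y ≤ c + 2 * (1 / p) * N₂ + c * (p + 1) := by linarith
    have h4 : l * Y ≤ c * p + 2 * N₂ + c * (p + 1) * p := by
      have := mul_le_mul_of_nonneg_right h3 hp0.le
      have e1 : 1 / p * l * Y * p = l * Y := by field_simp
      have e2 : (c + 2 * (1 / p) * N₂ + c * (p + 1)) * p = c * p + 2 * N₂ + c * (p + 1) * p := by
        field_simp
      linarith
    nlinarith [mul_nonneg hc (sub_nonneg.2 hp), mul_nonneg (mul_nonneg hc hp0.le)
      (sub_nonneg.2 hp)]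
  have h1 : ∑ t ∈ Finset.range T, (j (t + 1) - j t) ≤ ∑ t ∈ Finset.range T,
      (1 / p ^ 2 * (-(1 / 4)) * g t + 1 / p ^ 2 * c * y t + 1 / p ^ 2 * n₁ t
        + c * (1 / p ^ 2) ^ 2) :=
    Finset.sum_le_sum fun t ht => by linarith [hj t (Finset.mem_range.1 ht)]
  rw [Finset.sum_range_sub, Finset.sum_add_distrib, Finset.sum_add_distrib,
    Finset.sum_add_distrib, ← Finset.mul_sum, ← Finset.mul_sum, ← Finset.mul_sum,
    Finset.sum_const, Finset.card_range, nsmul_eq_mul, hT] at h1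
  have hj0 := (abs_le.1 hj0).2
  have hjT := (abs_le.1 hjT).1
  have h2 : p ^ 3 * (c * (1 / p ^ 2) ^ 2) = c * (1 / p) := by field_simp
  rw [h2] at h1
  have h3 : 1 / p ^ 2 * (1 / 4) * G
      ≤ 2 * c + 1 / p ^ 2 * c * Y + 1 / p ^ 2 * N₁ + c * (1 / p) := by linarith
  have h4 : 1 / 4 * G ≤ 2 * c * p ^ 2 + c * Y + N₁ + c * p := by
    have := mul_le_mul_of_nonneg_right h3 (sq_nonneg p)
    have e1 : 1 / p ^ 2 * (1 / 4) * G * p ^ 2 = 1 / 4 * G := by field_simp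
    have e2 : (2 * c + 1 / p ^ 2 * c * Y + 1 / p ^ 2 * N₁ + c * (1 / p)) * p ^ 2
        = 2 * c * p ^ 2 + c * Y + N₁ + c * p := by field_simp
    linarith
  -- The tracking bound enters the objective here; the other terms of `h4` add up to at most 5cp².
  have h5 : Y ≤ 7 * c * p ^ 2 / l := by rw [le_div_iff₀ hl]; linarith
  have h6 : c * Y ≤ 7 * c ^ 2 / l * p ^ 2 := by
    refine (mul_le_mul_of_nonneg_left h5 hc).trans_eq (by ring)
  nlinarith [mul_nonneg hc (sub_nonneg.2 hp), mul_nonneg (mul_nonneg hc hp0.le)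
    (sub_nonneg.2 hp)]

variable {S A : Type*} [MeasurableSpace S] [MeasurableSpace A] [Fintype A]
  [MeasurableSingletonClass A] {N : ℕ} {m : MDP S A} {φ : S × A → EuclideanSpace ℝ (Fin N)}
  {π : EuclideanSpace ℝ (Fin N) → Kernel S A} {μ : Measure (S × A)} [IsProbabilityMeasure μ]
  {k₁ k₂ r : ℝ}

/-- The deviation of a random direction from its stationary mean, tested against `v`. -/
def centredInner (m : MDP S A) (μ : Measure (S × A))
    (v : EuclideanSpace ℝ (Fin N) × EuclideanSpace ℝ (Fin N) → EuclideanSpace ℝ (Fin N))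
    (d : EuclideanSpace ℝ (Fin N) × EuclideanSpace ℝ (Fin N) → (S × A) × S →
      EuclideanSpace ℝ (Fin N))
    (z : EuclideanSpace ℝ (Fin N) × EuclideanSpace ℝ (Fin N)) (x : (S × A) × S) : ℝ :=
  inner ℝ (v z) (d z x - ∫ x', d z x' ∂(μ ⊗ₘ m.P))

section CentredInner

variable {v : EuclideanSpace ℝ (Fin N) × EuclideanSpace ℝ (Fin N) → EuclideanSpace ℝ (Fin N)}
  {d : EuclideanSpace ℝ (Fin N) × EuclideanSpace ℝ (Fin N) → (S × A) × S →
      EuclideanSpace ℝ (Fin N)}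

theorem measurable_centredInner (hv : Measurable v)
    (hd : Measurable fun p : (EuclideanSpace ℝ (Fin N) × EuclideanSpace ℝ (Fin N)) ×
      ((S × A) × S) => d p.1 p.2) :
    Measurable fun p : (EuclideanSpace ℝ (Fin N) × EuclideanSpace ℝ (Fin N)) × ((S × A) × S) =>
      centredInner m μ v d p.1 p.2 := by
  have h : Measurable fun z => ∫ x', d z x' ∂(μ ⊗ₘ m.P) :=
    (hd.stronglyMeasurable.integral_prod_right' (ν := μ ⊗ₘ m.P)).measurable
  exact (hv.comp measurable_fst).inner (hd.sub (h.comp measurable_fst))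

theorem bddLipOn_centredInner {D : Set (EuclideanSpace ℝ (Fin N) × EuclideanSpace ℝ (Fin N))}
    (hv : BddLipOn D fun z (_ : (S × A) × S) => v z)
    (hdm : Measurable fun p : (EuclideanSpace ℝ (Fin N) × EuclideanSpace ℝ (Fin N)) ×
      ((S × A) × S) => d p.1 p.2) (hd : BddLipOn D d) :
    BddLipOn D (centredInner m μ v d) :=
  hv.inner (hd.sub (hd.integral (μ ⊗ₘ m.P) fun _ =>
    (hdm.comp measurable_prodMk_left).aestronglyMeasurable))

theorem integral_centredInner {D : Set (EuclideanSpace ℝ (Fin N) × EuclideanSpace ℝ (Fin N))}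
    (hdm : Measurable fun p : (EuclideanSpace ℝ (Fin N) × EuclideanSpace ℝ (Fin N)) ×
      ((S × A) × S) => d p.1 p.2) (hd : BddLipOn D d)
    {z : EuclideanSpace ℝ (Fin N) × EuclideanSpace ℝ (Fin N)} (hz : z ∈ D) :
    ∫ x, centredInner m μ v d z x ∂(μ ⊗ₘ m.P) = 0 := by
  have hi : Integrable (d z) (μ ⊗ₘ m.P) :=
    hd.integrable hz (hdm.comp measurable_prodMk_left).aestronglyMeasurable
  have hi' : Integrable (fun x => d z x - ∫ x', d z x' ∂(μ ⊗ₘ m.P)) (μ ⊗ₘ m.P) :=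
    hi.sub (integrable_const _)
  unfold centredInner
  rw [integral_inner hi', integral_sub hi (integrable_const _)]
  simp

end CentredInner

/-- The tracking error `ω - ω*(θ)`. -/
def trackErr (m : MDP S A) (φ : S × A → EuclideanSpace ℝ (Fin N))
    (π : EuclideanSpace ℝ (Fin N) → Kernel S A) (μ : Measure (S × A))
    (z : EuclideanSpace ℝ (Fin N) × EuclideanSpace ℝ (Fin N)) : EuclideanSpace ℝ (Fin N) :=
  z.2 - omegaStar m φ π μ z.1

theorem bddLipOn_trackErr {Y : Type*} (hφm : Measurable φ) (hφ : ∀ x, ‖φ x‖ ≤ 1)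
    (hπ : ∀ θ, IsMarkovKernel (π θ)) (hsmooth : SmoothPolicy π k₁ k₂) :
    BddLipOn (Metric.closedBall 0 r) fun z (_ : Y) => trackErr m φ π μ z :=
  bddLipOn_snd.sub (bddLipOn_omegaStar hφm hφ hπ hsmooth).comp_fst

theorem measurable_trackErr (hφm : Measurable φ) (hφ : ∀ x, ‖φ x‖ ≤ 1)
    (hπ : ∀ θ, IsMarkovKernel (π θ)) (hsmooth : SmoothPolicy π k₁ k₂) :
    Measurable (trackErr m φ π μ) :=
  measurable_snd.sub ((measurable_omegaStar hφm hφ hπ hsmooth).comp measurable_fst)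

theorem bddLipOn_MSPBE {Y : Type*} (hφm : Measurable φ) (hφ : ∀ x, ‖φ x‖ ≤ 1)
    (hC : (featureMatrix φ μ).det ≠ 0)
    (hπ : ∀ θ, IsMarkovKernel (π θ)) (hsmooth : SmoothPolicy π k₁ k₂) :
    BddLipOn (Metric.closedBall 0 r) fun θ (_ : Y) => MSPBE m φ π μ θ := by
  simp_rw [MSPBE_eq hφm hφ hC hπ hsmooth]
  exact (bddLipOn_meanTD hφm hφ hπ hsmooth).inner (bddLipOn_omegaStar hφm hφ hπ hsmooth)

/-- One-step drift of the objective along the slow iterate. -/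
theorem exists_MSPBE_step_le (hφm : Measurable φ) (hφ : ∀ x, ‖φ x‖ ≤ 1)
    (hC : (featureMatrix φ μ).det ≠ 0)
    (hπ : ∀ θ, IsMarkovKernel (π θ)) (hsmooth : SmoothPolicy π k₁ k₂) (r : ℝ) :
    ∃ c : ℝ, 0 ≤ c ∧ ∀ z ∈ Metric.closedBall
      (0 : EuclideanSpace ℝ (Fin N) × EuclideanSpace ℝ (Fin N)) r, ∀ x, ∀ a : ℝ, 0 ≤ a →
      z.1 + a • thetaDir m φ π z x ∈ Metric.closedBall 0 r →
      MSPBE m φ π μ (z.1 + a • thetaDir m φ π z x) ≤ MSPBE m φ π μ z.1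
        + a * (-(1 / 4) * ‖gradMSPBE m φ π μ z.1‖ ^ 2 + c * ‖trackErr m φ π μ z‖ ^ 2)
        + a * centredInner m μ (fun z => gradMSPBE m φ π μ z.1) (thetaDir m φ π) z x
        + c * a ^ 2 := by
  obtain ⟨L, hL, hTaylor⟩ := exists_MSPBE_taylor (m := m) hφm hφ hC hπ hsmooth r
  obtain ⟨B, hB, hdir⟩ := bddLipOn_thetaDir (m := m) (r := r) hφ hπ hsmooth
  obtain ⟨c, hc, hdesc⟩ := exists_inner_gradMSPBE_thetaDir_le (m := m) hφm hφ hC hπ hsmooth r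
  refine ⟨max c (L * B ^ 2), le_max_of_le_left hc, fun z hz x a ha hz' => ?_⟩
  have hz1 : ‖z.1‖ ≤ r := (norm_fst_le z).trans (by simpa using hz)
  have h1 := (abs_le.1 (hTaylor z.1 (by simpa using hz1) _ hz')).2
  rw [add_sub_cancel_left, inner_smul_right, norm_smul, mul_pow, Real.norm_eq_abs, sq_abs] at h1
  have h2 := hdesc z hz1
  have h3 : centredInner m μ (fun z => gradMSPBE m φ π μ z.1) (thetaDir m φ π) z x
      = inner ℝ (gradMSPBE m φ π μ z.1) (thetaDir m φ π z x)
        - inner ℝ (gradMSPBE m φ π μ z.1) (∫ x, thetaDir m φ π z x ∂(μ ⊗ₘ m.P)) := by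
    rw [centredInner, inner_sub_right]
  have h4 : L * (a ^ 2 * ‖thetaDir m φ π z x‖ ^ 2) ≤ max c (L * B ^ 2) * a ^ 2 := by
    have : ‖thetaDir m φ π z x‖ ^ 2 ≤ B ^ 2 := by
      gcongr
      exact (hdir x z hz).1
    calc L * (a ^ 2 * ‖thetaDir m φ π z x‖ ^ 2) ≤ L * (a ^ 2 * B ^ 2) := by gcongr
      _ = L * B ^ 2 * a ^ 2 := by ring
      _ ≤ _ := by
        gcongr
        exact le_max_right _ _
  have h5 : c * ‖trackErr m φ π μ z‖ ^ 2 ≤ max c (L * B ^ 2) * ‖trackErr m φ π μ z‖ ^ 2 := by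
    gcongr
    exact le_max_left _ _
  rw [h3]
  have h6 := mul_le_mul_of_nonneg_left (h2.trans (add_le_add_right h5 _)) ha
  simp only [trackErr] at h6 ⊢
  linarith

/-- One-step drift of the squared tracking error. -/
theorem exists_trackErr_step_le (hφm : Measurable φ) (hφ : ∀ x, ‖φ x‖ ≤ 1)
    (hC : (featureMatrix φ μ).det ≠ 0)
    (hπ : ∀ θ, IsMarkovKernel (π θ)) (hsmooth : SmoothPolicy π k₁ k₂) (r : ℝ) :
    ∃ l c : ℝ, 0 < l ∧ 0 ≤ c ∧ ∀ z ∈ Metric.closedBall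
      (0 : EuclideanSpace ℝ (Fin N) × EuclideanSpace ℝ (Fin N)) r, ∀ x, ∀ a b : ℝ, 0 ≤ a → 0 < b →
      a ≤ b → z.1 + a • thetaDir m φ π z x ∈ Metric.closedBall 0 r →
      ‖trackErr m φ π μ (z.1 + a • thetaDir m φ π z x, z.2 + b • omegaDir m φ π z x)‖ ^ 2
        ≤ ‖trackErr m φ π μ z‖ ^ 2 - b * l * ‖trackErr m φ π μ z‖ ^ 2
          + 2 * b * centredInner m μ (trackErr m φ π μ) (omegaDir m φ π) z x
          + c * (b ^ 2 + a ^ 2 / b) := by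
  obtain ⟨l, hl, hcoer⟩ := exists_coercive_featureOp hφm hφ hC
  obtain ⟨B, hB, hdir⟩ := bddLipOn_thetaDir (m := m) (r := r) hφ hπ hsmooth
  obtain ⟨B', hB', hdir'⟩ := bddLipOn_omegaDir (m := m) (r := r) hφ hπ hsmooth
  obtain ⟨W, hW, hw⟩ := bddLipOn_omegaStar (Y := Unit) (m := m) (μ := μ) (r := r) hφm hφ hπ hsmooth
  refine ⟨l, 2 * B' ^ 2 + 2 * (W * B) ^ 2 + (W * B) ^ 2 / l, hl, by positivity,
    fun z hz x a b ha hb hab hz' => ?_⟩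
  have hz1 : z.1 ∈ Metric.closedBall (0 : EuclideanSpace ℝ (Fin N)) r := by
    rw [mem_closedBall_zero_iff]
    exact (norm_fst_le z).trans (by simpa using hz)
  set y := trackErr m φ π μ z with hy
  set h := omegaDir m φ π z x with hh
  set e := omegaStar m φ π μ (z.1 + a • thetaDir m φ π z x) - omegaStar m φ π μ z.1 with he
  have hnew : trackErr m φ π μ (z.1 + a • thetaDir m φ π z x, z.2 + b • h)
      = y + (b • h - e) := by
    simp only [hy, he, trackErr]; abel
  have hhB : ‖h‖ ≤ B' := (hdir' x z hz).1
  have heB : ‖e‖ ≤ W * B * a := by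
    refine ((hw () _ hz').2 _ hz1).trans ?_
    rw [add_sub_cancel_left, norm_smul, Real.norm_of_nonneg ha]
    have := (hdir x z hz).1
    calc W * (a * ‖thetaDir m φ π z x‖) ≤ W * (a * B) := by gcongr
      _ = _ := by ring
  -- The stationary mean of the increment is -Cy; centring thus isolates ⟨y, Cy⟩, which is the
  -- source of contraction.
  have hcent : centredInner m μ (trackErr m φ π μ) (omegaDir m φ π) z x
      = inner ℝ y h + inner ℝ y (featureOp φ μ y) := by
    rw [centredInner, integral_omegaDir hφm hφ hC hπ hsmooth, ← hy, sub_neg_eq_add,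
      inner_add_right]
    rfl
  have hco := hcoer y
  have hsq : ‖b • h - e‖ ^ 2 ≤ 2 * (b ^ 2 * B' ^ 2) + 2 * ((W * B) ^ 2 * a ^ 2) := by
    have h1 : ‖b • h - e‖ ≤ b * B' + W * B * a := by
      refine (norm_sub_le _ _).trans (add_le_add ?_ heB)
      rw [norm_smul, Real.norm_of_nonneg hb.le]
      gcongr
    have h2 : ‖b • h - e‖ ^ 2 ≤ (b * B' + W * B * a) ^ 2 := by gcongr
    nlinarith [sq_nonneg (b * B' - W * B * a)]
  -- Coercivity yields a contraction of 2bl‖y‖². Weighted Young spends half of it on the drift e of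
  -- ω*(θ), whence the remainder a²/b.
  have hye : -(2 * inner ℝ y e : ℝ) ≤ b * l * ‖y‖ ^ 2 + (W * B) ^ 2 / l * (a ^ 2 / b) := by
    have h1 : -(inner ℝ y e : ℝ) ≤ ‖y‖ * ‖e‖ :=
      (neg_le_abs _).trans (abs_real_inner_le_norm _ _)
    have h2 : ‖y‖ * ‖e‖ ≤ ‖y‖ * (W * B * a) := by gcongr
    have h3 : b * l * ‖y‖ ^ 2 + (W * B) ^ 2 / l * (a ^ 2 / b) - 2 * (‖y‖ * (W * B * a))
        = (b * l * ‖y‖ - W * B * a) ^ 2 / (b * l) := by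
      field_simp; ring
    have h4 : 0 ≤ (b * l * ‖y‖ - W * B * a) ^ 2 / (b * l) := by positivity
    linarith
  have haa : (W * B) ^ 2 * a ^ 2 ≤ (W * B) ^ 2 * b ^ 2 := by gcongr
  have hrest : 0 ≤ (2 * B' ^ 2 + 2 * (W * B) ^ 2) * (a ^ 2 / b) := by positivity
  have hrest' : 0 ≤ (W * B) ^ 2 / l * b ^ 2 := by positivity
  rw [hnew, norm_add_sq_real, hcent, inner_sub_right, inner_smul_right]
  have hco' := mul_le_mul_of_nonneg_left hco hb.le
  nlinarith

end Drift

/-! ### Averaging over the random output index. -/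

section RandomOutput

/-- The prescribed probabilities on the interval already sum to 1, so other values have probability
0. -/
theorem IsStepSizeWeighted.ae_mem_Icc {Ω : Type*} [MeasurableSpace Ω] {Pr : Measure Ω}
    [IsProbabilityMeasure Pr] {M : Ω → ℕ} {α : ℕ → ℝ} {k₀ T : ℕ}
    (hM : IsStepSizeWeighted Pr M α k₀ T) (hα : ∑ t ∈ Finset.Icc k₀ T, α t ≠ 0) :
    ∀ᵐ ω ∂Pr, M ω ∈ Finset.Icc k₀ T := by
  have hms : ∀ k, MeasurableSet {ω | M ω = k} := fun k =>
    hM.measurable (measurableSet_singleton k)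
  have h1 : {ω | M ω ∈ Finset.Icc k₀ T} = ⋃ k ∈ Finset.Icc k₀ T, {ω | M ω = k} := by
    ext ω; simp
  have hm : MeasurableSet {ω | M ω ∈ Finset.Icc k₀ T} := by
    rw [h1]; exact Finset.measurableSet_biUnion _ fun k _ => hms k
  have h2 : Pr.real {ω | M ω ∈ Finset.Icc k₀ T} = 1 := by
    rw [h1, measureReal_biUnion_finset (fun i _ j _ hij => ?_) fun k _ => hms k,
      Finset.sum_congr rfl hM.prob_eq, ← Finset.sum_div, div_self hα]
    exact Set.disjoint_left.2 fun ω (hi : M ω = i) (hj : M ω = j) => hij (hi.symm.trans hj)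
  have h3 : Pr {ω | M ω ∈ Finset.Icc k₀ T} = 1 := by
    rw [measureReal_def] at h2
    exact (ENNReal.toReal_eq_one_iff _).1 h2
  exact (prob_compl_eq_zero_iff hm).2 h3

/-- Averaging over an independent output index with constant stepsizes costs at most the
time average. -/
theorem IsStepSizeWeighted.integral_le {Ω X : Type*} [MeasurableSpace Ω] [MeasurableSpace X]
    {Pr : Measure Ω} [IsProbabilityMeasure Pr] {M : Ω → ℕ} {α : ℕ → ℝ} {a : ℝ} (ha : 0 < a)
    (hα : ∀ t, α t = a) {k₀ T : ℕ} (hk₀ : k₀ ≤ 1) (hT : 1 ≤ T)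
    (hM : IsStepSizeWeighted Pr M α k₀ T) {Y : Ω → X} (hY : Measurable Y)
    (hind : IndepFun M Y Pr) {H : ℕ → X → ℝ} (hH : ∀ k, Measurable (H k)) (hH0 : ∀ k x, 0 ≤ H k x)
    {c : ℝ} (hc : ∀ᵐ ω ∂Pr, ∀ t ≤ T, H t (Y ω) ≤ c) :
    Integrable (fun ω => H (M ω) (Y ω)) Pr ∧
      ∫ ω, H (M ω) (Y ω) ∂Pr ≤ 1 / T * ∑ t ∈ Finset.range (T + 1), ∫ ω, H t (Y ω) ∂Pr := by
  have hsum : ∑ t ∈ Finset.Icc k₀ T, α t = ((T + 1 - k₀ : ℕ) : ℝ) * a := by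
    simp [hα]
  -- Constant stepsizes make M uniform on T + 1 - k₀ indices; k₀ ≤ 1 gives at least T of them, so
  -- each has probability at most 1/T.
  have hcard : (T : ℝ) ≤ ((T + 1 - k₀ : ℕ) : ℝ) := by exact_mod_cast (by omega)
  have hT0 : (0 : ℝ) < T := by exact_mod_cast hT
  have hcard0 : (0 : ℝ) < ((T + 1 - k₀ : ℕ) : ℝ) := hT0.trans_le hcard
  have hmem := hM.ae_mem_Icc (by rw [hsum]; positivity)
  have hprob : ∀ k ∈ Finset.Icc k₀ T, Pr.real {ω | M ω = k} ≤ 1 / T := by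
    intro k hk
    rw [hM.prob_eq k hk, hsum, hα, div_le_div_iff₀ (by positivity) hT0]
    nlinarith
  have hmeas : Measurable fun ω => H (M ω) (Y ω) := by
    have : Measurable fun p : ℕ × X => H p.1 p.2 := measurable_from_prod_countable_right hH
    exact this.comp (hM.measurable.prodMk hY)
  have hint : Integrable (fun ω => H (M ω) (Y ω)) Pr := by
    refine Integrable.of_bound hmeas.aestronglyMeasurable c ?_
    filter_upwards [hc, hmem] with ω hω hMω
    rw [Real.norm_of_nonneg (hH0 _ _)]
    exact hω _ (Finset.mem_Icc.1 hMω).2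
  refine ⟨hint, ?_⟩
  have hti : ∀ t ≤ T, Integrable (fun ω => H t (Y ω)) Pr := by
    intro t ht
    refine Integrable.of_bound ((hH t).comp hY).aestronglyMeasurable c ?_
    filter_upwards [hc] with ω hω
    rw [Real.norm_of_nonneg (hH0 _ _)]
    exact hω t ht
  let χ : ℕ → ℕ → ℝ := fun k i => if i = k then 1 else 0
  have hχi : ∀ k, Integrable (fun ω => χ k (M ω)) Pr := fun k =>
    integrable_of_measurable_of_abs_le (B := 1) ((measurable_of_countable (χ k)).comp hM.measurable)
      fun ω => by simp only [χ]; split_ifs <;> simp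
  have hχint : ∀ k, ∫ ω, χ k (M ω) ∂Pr = Pr.real {ω | M ω = k} := by
    intro k
    have : (fun ω => χ k (M ω)) = Set.indicator {ω | M ω = k} fun _ => (1 : ℝ) := by
      funext ω; simp [χ, Set.indicator_apply]
    have hms : MeasurableSet {ω | M ω = k} := hM.measurable (measurableSet_singleton k)
    rw [this, integral_indicator hms]
    simp
  have hindk : ∀ k, IndepFun (fun ω => χ k (M ω)) (fun ω => H k (Y ω)) Pr := fun k =>
    hind.comp (measurable_of_countable (χ k)) (hH k)
  have hprodint : ∀ k ∈ Finset.Icc k₀ T, Integrable (fun ω => χ k (M ω) * H k (Y ω)) Pr :=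
    fun k hk => (hindk k).integrable_mul (hχi k) (hti k (Finset.mem_Icc.1 hk).2)
  -- Splitting by the value of M, independence factors each term into a probability times an
  -- expectation at a fixed time.
  have hdecomp : ∫ ω, H (M ω) (Y ω) ∂Pr
      = ∑ k ∈ Finset.Icc k₀ T, Pr.real {ω | M ω = k} * ∫ ω, H k (Y ω) ∂Pr := by
    have h1 : ∫ ω, H (M ω) (Y ω) ∂Pr
        = ∫ ω, ∑ k ∈ Finset.Icc k₀ T, χ k (M ω) * H k (Y ω) ∂Pr := by
      refine integral_congr_ae ?_
      filter_upwards [hmem] with ω hω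
      rw [Finset.sum_eq_single (M ω)]
      · simp [χ]
      · intro k _ hk
        simp [χ, Ne.symm hk]
      · exact fun h => absurd hω h
    rw [h1, integral_finsetSum _ hprodint]
    refine Finset.sum_congr rfl fun k hk => ?_
    rw [← hχint k]
    exact (hindk k).integral_fun_mul_eq_mul_integral (hχi k).aestronglyMeasurable
      (hti k (Finset.mem_Icc.1 hk).2).aestronglyMeasurable
  rw [hdecomp, Finset.mul_sum]
  refine (Finset.sum_le_sum fun k hk => mul_le_mul_of_nonneg_right (hprob k hk)
    (integral_nonneg fun ω => hH0 k _)).trans ?_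
  refine Finset.sum_le_sum_of_subset_of_nonneg (fun k hk => ?_) fun k _ _ =>
    mul_nonneg (by positivity) (integral_nonneg fun ω => hH0 k _)
  exact Finset.mem_range.2 (Nat.lt_succ_of_le (Finset.mem_Icc.1 hk).2)

end RandomOutput

/-! ### The summed squared gradients. -/

section Rate

variable {S A : Type*} [MeasurableSpace S] [MeasurableSpace A] [Fintype A]
  [MeasurableSingletonClass A] {N : ℕ} {m : MDP S A} {φ : S × A → EuclideanSpace ℝ (Fin N)}
  {π : EuclideanSpace ℝ (Fin N) → Kernel S A} {μ : Measure (S × A)} [IsProbabilityMeasure μ]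
  {k₁ k₂ : ℝ}

/-- With stepsizes `p⁻²` and `p⁻¹` over `p³` steps, the squared gradient norms at the iterates sum
to `O(p²)`. -/
theorem exists_sum_gradMSPBE_le {πb : Kernel S A} [IsMarkovKernel πb]
    (hμ : (m.pairKernel πb).Invariant μ)
    {c ρ : ℝ} (hc : 0 ≤ c) (hρ : 0 ≤ ρ) (hρ' : ρ < 1) (hmix : m.GeomErgodic πb μ.fst c ρ)
    (hφm : Measurable φ) (hφ : ∀ x, ‖φ x‖ ≤ 1) (hC : (featureMatrix φ μ).det ≠ 0)
    (hπ : ∀ θ, IsMarkovKernel (π θ)) (hsmooth : SmoothPolicy π k₁ k₂) (R : ℝ) :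
    ∃ K : ℝ, 0 ≤ K ∧ ∀ (Ω : Type*) [MeasurableSpace Ω] (Pr : Measure Ω) [IsProbabilityMeasure Pr]
      (st : ℕ → Ω → S) (ac : ℕ → Ω → A) (θ₀ ω₀ : EuclideanSpace ℝ (Fin N)) (α β : ℕ → ℝ)
      (T : ℕ) (p : ℝ), 1 ≤ p → (T : ℝ) = p ^ 3 → (∀ t, α t = 1 / p ^ 2) → (∀ t, β t = 1 / p) →
      m.IsTrajectory πb Pr st ac →
      (∀ᵐ ω ∂Pr, ∀ t ≤ T, greedyGQ m φ π α β θ₀ ω₀ (fun i => st i ω) (fun i => ac i ω) t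
        ∈ Metric.closedBall 0 R) →
      ∑ t ∈ Finset.range T, ∫ ω, ‖gradMSPBE m φ π μ
        (greedyGQ m φ π α β θ₀ ω₀ (fun i => st i ω) (fun i => ac i ω) t).1‖ ^ 2 ∂Pr
        ≤ K * p ^ 2 := by
  set D : Set (EuclideanSpace ℝ (Fin N) × EuclideanSpace ℝ (Fin N)) := Metric.closedBall 0 R
    with hDdef
  -- the functions that enter the drift inequalities
  let X := (S × A) × S
  let fJ : EuclideanSpace ℝ (Fin N) × EuclideanSpace ℝ (Fin N) → X → ℝ := fun z _ =>
    MSPBE m φ π μ z.1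
  let fG : EuclideanSpace ℝ (Fin N) × EuclideanSpace ℝ (Fin N) → X → ℝ := fun z _ =>
    ‖gradMSPBE m φ π μ z.1‖ ^ 2
  let fY : EuclideanSpace ℝ (Fin N) × EuclideanSpace ℝ (Fin N) → X → ℝ := fun z _ =>
    ‖trackErr m φ π μ z‖ ^ 2
  let f₁ : EuclideanSpace ℝ (Fin N) × EuclideanSpace ℝ (Fin N) → X → ℝ :=
    centredInner m μ (fun z => gradMSPBE m φ π μ z.1) (thetaDir m φ π)
  let f₂ : EuclideanSpace ℝ (Fin N) × EuclideanSpace ℝ (Fin N) → X → ℝ :=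
    centredInner m μ (trackErr m φ π μ) (omegaDir m φ π)
  have bg : BddLipOn D fun z (_ : X) => gradMSPBE m φ π μ z.1 :=
    (bddLipOn_gradMSPBE hφm hφ hπ hsmooth).comp_fst
  have bY : BddLipOn D fun z (_ : X) => trackErr m φ π μ z := bddLipOn_trackErr hφm hφ hπ hsmooth
  have bθ : BddLipOn D (thetaDir m φ π) := bddLipOn_thetaDir hφ hπ hsmooth
  have bω : BddLipOn D (omegaDir m φ π) := bddLipOn_omegaDir hφ hπ hsmooth
  have bfJ : BddLipOn D fJ := (bddLipOn_MSPBE hφm hφ hC hπ hsmooth).comp_fst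
  have bfG : BddLipOn D fG := by
    have := bg.inner bg
    simp only [real_inner_self_eq_norm_sq] at this
    exact this
  have bfY : BddLipOn D fY := by
    have := bY.inner bY
    simp only [real_inner_self_eq_norm_sq] at this
    exact this
  have mg : Measurable (gradMSPBE m φ π μ) := measurable_gradMSPBE hφm hφ hπ hsmooth
  have mY : Measurable (trackErr m φ π μ) := measurable_trackErr hφm hφ hπ hsmooth
  have mJ : Measurable (MSPBE m φ π μ) :=
    (BddLipOn.continuous_of_forall fun _ => bddLipOn_MSPBE hφm hφ hC hπ hsmooth).measurable
  have mθ := measurable_thetaDir (m := m) hφm hsmooth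
  have mω := measurable_omegaDir (m := m) hφm hsmooth
  have bf₁ : BddLipOn D f₁ := bddLipOn_centredInner bg mθ bθ
  have bf₂ : BddLipOn D f₂ := bddLipOn_centredInner bY mω bω
  have mf₁ : Measurable fun q : (EuclideanSpace ℝ (Fin N) × EuclideanSpace ℝ (Fin N)) × X =>
    f₁ q.1 q.2 := measurable_centredInner (mg.comp measurable_fst) mθ
  have mf₂ : Measurable fun q : (EuclideanSpace ℝ (Fin N) × EuclideanSpace ℝ (Fin N)) × X =>
    f₂ q.1 q.2 := measurable_centredInner mY mω
  have mfJ : Measurable fun q : (EuclideanSpace ℝ (Fin N) × EuclideanSpace ℝ (Fin N)) × X =>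
    fJ q.1 q.2 := mJ.comp (measurable_fst.comp measurable_fst)
  have mfG : Measurable fun q : (EuclideanSpace ℝ (Fin N) × EuclideanSpace ℝ (Fin N)) × X =>
    fG q.1 q.2 := (mg.comp (measurable_fst.comp measurable_fst)).norm.pow_const 2
  have mfY : Measurable fun q : (EuclideanSpace ℝ (Fin N) × EuclideanSpace ℝ (Fin N)) × X =>
    fY q.1 q.2 := (mY.comp measurable_fst).norm.pow_const 2
  obtain ⟨C₁, hC₁, noise₁⟩ := exists_abs_sum_noise_le hμ hc hρ hρ' hmix hφm hsmooth mf₁ bf₁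
    fun z hz => integral_centredInner mθ bθ hz
  obtain ⟨C₂, hC₂, noise₂⟩ := exists_abs_sum_noise_le hμ hc hρ hρ' hmix hφm hsmooth mf₂ bf₂
    fun z hz => integral_centredInner mω bω hz
  obtain ⟨c₁, hc₁, drift₁⟩ := exists_MSPBE_step_le (m := m) hφm hφ hC hπ hsmooth R
  obtain ⟨l, c₂, hl, hc₂, drift₂⟩ := exists_trackErr_step_le (m := m) hφm hφ hC hπ hsmooth R
  obtain ⟨Bθ, hBθ, hθB⟩ := id bθ
  obtain ⟨Bω, hBω, hωB⟩ := id bω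
  obtain ⟨BJ, hBJ, hJB⟩ := id bfJ
  obtain ⟨BY, hBY, hYB⟩ := id bfY
  -- One constant dominating all those of the summation lemma. It is fixed before the probability
  -- space, T and the initial values, so the final bound is uniform in them.
  set c' := C₁ * (1 + (Bθ + Bω)) + C₂ * (1 + (Bθ + Bω)) + c₁ + c₂ + BJ + BY with hc'
  have t₁ : 0 ≤ C₁ * (1 + (Bθ + Bω)) := by positivity
  have t₂ : 0 ≤ C₂ * (1 + (Bθ + Bω)) := by positivity
  have hc'0 : 0 ≤ c' := by positivity
  refine ⟨4 * (5 * c' + 7 * c' ^ 2 / l), by positivity, ?_⟩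
  intro Ω _ Pr _ st ac θ₀ ω₀ α β T p hp hT hα hβ htraj hbdd
  have hp0 : 0 < p := by linarith
  have hab : 1 / p ^ 2 ≤ 1 / p := by
    rw [div_le_div_iff₀ (by positivity) hp0]; nlinarith
  set z : ℕ → Ω → EuclideanSpace ℝ (Fin N) × EuclideanSpace ℝ (Fin N) := fun t ω =>
    greedyGQ m φ π α β θ₀ ω₀ (fun i => st i ω) (fun i => ac i ω) t with hzdef
  let x : ℕ → Ω → X := fun t ω => ((st t ω, ac t ω), st (t + 1) ω)
  have hzm : ∀ t, Measurable (z t) := fun t =>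
    measurable_greedyGQ hφm hsmooth α β θ₀ ω₀ htraj.measurable_state htraj.measurable_action t
  have hxm : ∀ t, Measurable (x t) := fun t =>
    ((htraj.measurable_state t).prodMk (htraj.measurable_action t)).prodMk
      (htraj.measurable_state (t + 1))
  have hzs : ∀ t ω, z (t + 1) ω = ((z t ω).1 + (1 / p ^ 2) • thetaDir m φ π (z t ω) (x t ω),
      (z t ω).2 + (1 / p) • omegaDir m φ π (z t ω) (x t ω)) := by
    intro t ω
    simp only [hzdef, x, greedyGQ_succ, hα, hβ]
  have hint : ∀ q : EuclideanSpace ℝ (Fin N) × EuclideanSpace ℝ (Fin N) → X → ℝ,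
      (Measurable fun q' : (EuclideanSpace ℝ (Fin N) × EuclideanSpace ℝ (Fin N)) × X =>
        q q'.1 q'.2) → BddLipOn D q → ∀ t ≤ T, Integrable (fun ω => q (z t ω) (x t ω)) Pr := by
    intro q hq ⟨B, _, hB⟩ t ht
    refine Integrable.of_bound (hq.comp ((hzm t).prodMk (hxm t))).aestronglyMeasurable B ?_
    filter_upwards [hbdd] with ω hω using (hB _ _ (hω t ht)).1
  have hη : 0 ≤ 1 / p * (Bθ + Bω) := by positivity
  -- The fast stepsize p⁻¹ governs the movement of the pair, since p⁻² ≤ p⁻¹.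
  have hmove : ∀ t < T, ∀ᵐ ω ∂Pr, ‖z (t + 1) ω - z t ω‖ ≤ 1 / p * (Bθ + Bω) := by
    intro t ht
    filter_upwards [hbdd] with ω hω
    have hzt := hω t ht.le
    have h1 : ‖thetaDir m φ π (z t ω) (x t ω)‖ ≤ Bθ := (hθB _ _ hzt).1
    have h2 : ‖omegaDir m φ π (z t ω) (x t ω)‖ ≤ Bω := (hωB _ _ hzt).1
    rw [hzs]
    refine norm_prod_le_iff.2 ⟨?_, ?_⟩
    · simp only [Prod.fst_sub, add_sub_cancel_left]
      rw [norm_smul, Real.norm_of_nonneg (by positivity)]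
      exact mul_le_mul hab (by linarith) (norm_nonneg _) (by positivity)
    · simp only [Prod.snd_sub, add_sub_cancel_left]
      rw [norm_smul, Real.norm_of_nonneg (by positivity)]
      exact mul_le_mul le_rfl (by linarith) (norm_nonneg _) (by positivity)
  have hscale : ∀ C : ℝ, 0 ≤ C → C * (1 + (Bθ + Bω)) ≤ c' →
      C * (1 + T * (1 / p * (Bθ + Bω))) ≤ c' * (1 + T * (1 / p)) := by
    intro C hC0 hCc
    have h1 : (0 : ℝ) ≤ T * (1 / p) := by positivity
    have h2 : 0 ≤ C * (Bθ + Bω) := by positivity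
    calc C * (1 + T * (1 / p * (Bθ + Bω)))
        ≤ (C * (1 + (Bθ + Bω))) * (1 + T * (1 / p)) := by nlinarith
      _ ≤ c' * (1 + T * (1 / p)) := by gcongr
  have N₁ := (noise₁ Ω Pr st ac θ₀ ω₀ α β T _ hη htraj hbdd hmove).trans
    (hscale C₁ hC₁ (by linarith))
  have N₂ := (noise₂ Ω Pr st ac θ₀ ω₀ α β T _ hη htraj hbdd hmove).trans
    (hscale C₂ hC₂ (by linarith))
  refine sum_le_of_drift (j := fun t => ∫ ω, fJ (z t ω) (x t ω) ∂Pr)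
    (y := fun t => ∫ ω, fY (z t ω) (x t ω) ∂Pr) (g := fun t => ∫ ω, fG (z t ω) (x t ω) ∂Pr)
    (n₁ := fun t => ∫ ω, f₁ (z t ω) (x t ω) ∂Pr) (n₂ := fun t => ∫ ω, f₂ (z t ω) (x t ω) ∂Pr)
    hp hT hc'0 hl (fun t ht => ?_) (fun t ht => ?_) ?_ ?_ ?_ ?_ N₁ N₂
  · have iJ := hint fJ mfJ bfJ t ht.le
    have iG := hint fG mfG bfG t ht.le
    have iY := hint fY mfY bfY t ht.le
    have i₁ := hint f₁ mf₁ bf₁ t ht.le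
    have iJ' := hint fJ mfJ bfJ (t + 1) ht
    have j₁ : Integrable (fun ω => -(1 / 4) * fG (z t ω) (x t ω) + c' * fY (z t ω) (x t ω)) Pr :=
      (iG.const_mul _).add (iY.const_mul _)
    have j₂ : Integrable (fun ω => fJ (z t ω) (x t ω) + 1 / p ^ 2 *
        (-(1 / 4) * fG (z t ω) (x t ω) + c' * fY (z t ω) (x t ω))) Pr := iJ.add (j₁.const_mul _)
    have j₃ : Integrable (fun ω => fJ (z t ω) (x t ω) + 1 / p ^ 2 *
        (-(1 / 4) * fG (z t ω) (x t ω) + c' * fY (z t ω) (x t ω))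
          + 1 / p ^ 2 * f₁ (z t ω) (x t ω)) Pr := j₂.add (i₁.const_mul _)
    have key : ∫ ω, fJ (z (t + 1) ω) (x (t + 1) ω) ∂Pr ≤ ∫ ω, (fJ (z t ω) (x t ω) + 1 / p ^ 2 *
        (-(1 / 4) * fG (z t ω) (x t ω) + c' * fY (z t ω) (x t ω))
          + 1 / p ^ 2 * f₁ (z t ω) (x t ω) + c' * (1 / p ^ 2) ^ 2) ∂Pr := by
      refine integral_mono_ae iJ' (j₃.add (integrable_const _)) ?_
      filter_upwards [hbdd] with ω hω
      have hz' : (z t ω).1 + (1 / p ^ 2) • thetaDir m φ π (z t ω) (x t ω)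
          ∈ Metric.closedBall (0 : EuclideanSpace ℝ (Fin N)) R := by
        have h1 : ‖z (t + 1) ω‖ ≤ R := by simpa [hDdef] using hω (t + 1) ht
        rw [mem_closedBall_zero_iff]
        have h2 := (norm_fst_le (z (t + 1) ω)).trans h1
        rwa [hzs] at h2
      have h := drift₁ (z t ω) (hω t ht.le) (x t ω) (1 / p ^ 2) (by positivity) hz'
      have h3 : fJ (z (t + 1) ω) (x (t + 1) ω)
          = MSPBE m φ π μ ((z t ω).1 + (1 / p ^ 2) • thetaDir m φ π (z t ω) (x t ω)) := by
        simp only [fJ, hzs]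
      rw [h3]
      refine h.trans ?_
      have hcc : c₁ ≤ c' := by linarith
      simp only [fJ, fG, fY, f₁]
      gcongr
    refine key.trans_eq ?_
    rw [integral_add j₃ (integrable_const _), integral_add j₂ (i₁.const_mul _),
      integral_add iJ (j₁.const_mul _), integral_const_mul, integral_const_mul,
      integral_add (iG.const_mul _) (iY.const_mul _), integral_const_mul, integral_const_mul]
    simp
  · have iY := hint fY mfY bfY t ht.le
    have i₂ := hint f₂ mf₂ bf₂ t ht.le
    have iY' := hint fY mfY bfY (t + 1) ht
    have j₁ : Integrable (fun ω => fY (z t ω) (x t ω) - 1 / p * l * fY (z t ω) (x t ω)) Pr :=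
      iY.sub (iY.const_mul _)
    have j₂ : Integrable (fun ω => fY (z t ω) (x t ω) - 1 / p * l * fY (z t ω) (x t ω)
        + 2 * (1 / p) * f₂ (z t ω) (x t ω)) Pr := j₁.add (i₂.const_mul _)
    have key : ∫ ω, fY (z (t + 1) ω) (x (t + 1) ω) ∂Pr
        ≤ ∫ ω, (fY (z t ω) (x t ω) - 1 / p * l * fY (z t ω) (x t ω)
          + 2 * (1 / p) * f₂ (z t ω) (x t ω)
          + c' * ((1 / p) ^ 2 + (1 / p ^ 2) ^ 2 / (1 / p))) ∂Pr := by
      refine integral_mono_ae iY' (j₂.add (integrable_const _)) ?_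
      filter_upwards [hbdd] with ω hω
      have hz' : (z t ω).1 + (1 / p ^ 2) • thetaDir m φ π (z t ω) (x t ω)
          ∈ Metric.closedBall (0 : EuclideanSpace ℝ (Fin N)) R := by
        have h1 : ‖z (t + 1) ω‖ ≤ R := by simpa [hDdef] using hω (t + 1) ht
        rw [mem_closedBall_zero_iff]
        have h2 := (norm_fst_le (z (t + 1) ω)).trans h1
        rwa [hzs] at h2
      have h := drift₂ (z t ω) (hω t ht.le) (x t ω) (1 / p ^ 2) (1 / p) (by positivity)
        (by positivity) hab hz'
      rw [← hzs] at h
      refine h.trans ?_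
      have hcc : c₂ ≤ c' := by linarith
      simp only [fY, f₂]
      gcongr
    refine key.trans_eq ?_
    rw [integral_add j₂ (integrable_const _), integral_add j₁ (i₂.const_mul _),
      integral_sub iY (iY.const_mul _), integral_const_mul, integral_const_mul]
    simp
  · refine (abs_integral_le_of_abs_le (B := BJ) ?_).trans (by linarith)
    filter_upwards [hbdd] with ω hω using (hJB (x 0 ω) _ (hω 0 (Nat.zero_le _))).1
  · refine (abs_integral_le_of_abs_le (B := BJ) ?_).trans (by linarith)
    filter_upwards [hbdd] with ω hω using (hJB (x T ω) _ (hω T le_rfl)).1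
  · refine (le_abs_self _).trans ((abs_integral_le_of_abs_le (B := BY) ?_).trans (by linarith))
    filter_upwards [hbdd] with ω hω using (hYB (x 0 ω) _ (hω 0 (Nat.zero_le _))).1
  · exact integral_nonneg fun ω => sq_nonneg _

end Rate

/-! ### Optimality of the exponents. -/

section RateBound

theorem rateBound_isTheta :
    rateBound (2 / 3) (1 / 3) =Θ[atTop] fun T : ℕ => Real.log T / (T : ℝ) ^ (1 / 3 : ℝ) := by
  have hform : ∀ T : ℕ, rateBound (2 / 3) (1 / 3) T
      = 1 / (T : ℝ) ^ (1 / 3 : ℝ) + Real.log T / (T : ℝ) ^ (1 / 3 : ℝ) := by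
    intro T
    rw [rateBound]
    norm_num
  have hlog : ∀ᶠ T : ℕ in atTop, 1 ≤ Real.log T :=
    (Real.tendsto_log_atTop.comp tendsto_natCast_atTop_atTop).eventually_ge_atTop 1
  constructor
  · refine IsBigO.of_bound 2 ?_
    filter_upwards [hlog] with T hT
    have h1 : 0 ≤ 1 / (T : ℝ) ^ (1 / 3 : ℝ) := by positivity
    have h2 : 1 / (T : ℝ) ^ (1 / 3 : ℝ) ≤ Real.log T / (T : ℝ) ^ (1 / 3 : ℝ) := by gcongr
    rw [hform, Real.norm_of_nonneg (by linarith), Real.norm_of_nonneg (by linarith)]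
    linarith
  · refine IsBigO.of_bound 1 ?_
    filter_upwards [hlog] with T hT
    have h1 : 0 ≤ 1 / (T : ℝ) ^ (1 / 3 : ℝ) := by positivity
    have h2 : 1 / (T : ℝ) ^ (1 / 3 : ℝ) ≤ Real.log T / (T : ℝ) ^ (1 / 3 : ℝ) := by gcongr
    rw [hform, Real.norm_of_nonneg (by linarith), Real.norm_of_nonneg (by linarith)]
    linarith

/-- Both terms of the bound are eventually nonnegative, so it suffices that one dominates: T^{a-1}
in the first case, where a power beats the logarithm, and the logarithmic term in the second. -/
theorem log_div_rpow_isLittleO_rateBound {a b : ℝ} (h : 2 / 3 < a ∨ min b (a - b) < 1 / 3) :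
    (fun T : ℕ => Real.log T / (T : ℝ) ^ (1 / 3 : ℝ)) =o[atTop] rateBound a b := by
  have hcast : Tendsto (fun T : ℕ => (T : ℝ)) atTop atTop := tendsto_natCast_atTop_atTop
  have hpos : ∀ᶠ T : ℕ in atTop, (0 : ℝ) < T := hcast.eventually_gt_atTop 0
  have hlog : ∀ᶠ T : ℕ in atTop, 0 ≤ Real.log T :=
    (Real.tendsto_log_atTop.comp hcast).eventually_ge_atTop 0
  rcases h with h | h
  · have h1 : (fun T : ℕ => Real.log T) =o[atTop] fun T : ℕ => (T : ℝ) ^ (a - 2 / 3) :=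
      (isLittleO_log_rpow_atTop (sub_pos.2 h)).comp_tendsto hcast
    have h2 := h1.mul_isBigO (isBigO_refl (fun T : ℕ => ((T : ℝ) ^ (1 / 3 : ℝ))⁻¹) atTop)
    refine h2.trans_isBigO (IsBigO.of_bound 1 ?_)
    filter_upwards [hpos, hlog] with T hT hl
    have e : (T : ℝ) ^ (a - 2 / 3) * ((T : ℝ) ^ (1 / 3 : ℝ))⁻¹ = 1 / (T : ℝ) ^ (1 - a) := by
      rw [← Real.rpow_neg hT.le, ← Real.rpow_add hT, one_div ((T : ℝ) ^ (1 - a)), ← Real.rpow_neg hT.le]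
      congr 1; ring
    have h3 : 0 ≤ 1 / (T : ℝ) ^ (1 - a) := by positivity
    have h4 : 0 ≤ Real.log T / (T : ℝ) ^ min b (a - b) := by positivity
    rw [e, rateBound, Real.norm_of_nonneg h3, Real.norm_of_nonneg (by linarith)]
    linarith
  · set q := min b (a - b)
    have h1 : (fun T : ℕ => (T : ℝ) ^ (-(1 / 3 - q))) =o[atTop] fun _ : ℕ => (1 : ℝ) :=
      (isLittleO_one_iff ℝ).2 ((tendsto_rpow_neg_atTop (sub_pos.2 h)).comp hcast)
    have h2 := h1.mul_isBigO
      (isBigO_refl (fun T : ℕ => Real.log T / (T : ℝ) ^ q) atTop)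
    refine (h2.congr' ?_ EventuallyEq.rfl).trans_isBigO (IsBigO.of_bound 1 ?_)
    · filter_upwards [hpos] with T hT
      rw [neg_sub, Real.rpow_sub hT]
      have : (T : ℝ) ^ q ≠ 0 := (Real.rpow_pos_of_pos hT q).ne'
      field_simp
    · filter_upwards [hpos, hlog] with T hT hl
      have h3 : 0 ≤ 1 / (T : ℝ) ^ (1 - a) := by positivity
      have h4 : 0 ≤ Real.log T / (T : ℝ) ^ q := by positivity
      rw [one_mul, one_mul, rateBound, Real.norm_of_nonneg h4, Real.norm_of_nonneg (by linarith)]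
      linarith

end RateBound

/-! ### The main theorem. -/

theorem corollary1 {S A : Type*} [MeasurableSpace S] [MeasurableSpace A] [Fintype A]
    [MeasurableSingletonClass A] {N : ℕ}
    -- the decision process, the behavior policy, the stationary law of the state-action chain
    (m : MDP S A) (πb : Kernel S A) [IsMarkovKernel πb]
    (μ : Measure (S × A)) [IsProbabilityMeasure μ] (hμ : (m.pairKernel πb).Invariant μ)
    -- geometric uniform ergodicity
    (c ρ : ℝ) (hc : 0 < c) (hρ : 0 < ρ) (hρ' : ρ < 1) (hmix : m.GeomErgodic πb μ.fst c ρ)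
    -- bounded features and problem solvability
    (φ : S × A → EuclideanSpace ℝ (Fin N)) (hφm : Measurable φ) (hφ : ∀ x, ‖φ x‖ ≤ 1)
    (hC : (featureMatrix φ μ).det ≠ 0)
    -- smooth target policies
    (π : EuclideanSpace ℝ (Fin N) → Kernel S A) (hπ : ∀ θ, IsMarkovKernel (π θ))
    (k₁ k₂ : ℝ) (hsmooth : SmoothPolicy π k₁ k₂)
    -- the bound on the iterates
    (R : ℝ) :
    -- the objective is differentiable, and the gradient norm at the output has the claimed rate
    Differentiable ℝ (MSPBE m φ π μ) ∧
    (∃ K : ℝ, ∀ T : ℕ, 2 ≤ T → ∀ (Ω : Type*) [MeasurableSpace Ω] (Pr : Measure Ω)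
      [IsProbabilityMeasure Pr] (st : ℕ → Ω → S) (ac : ℕ → Ω → A) (M : Ω → ℕ) (k₀ : ℕ)
      (θ₀ ω₀ : EuclideanSpace ℝ (Fin N)) (α β : ℕ → ℝ),
      (∀ t, α t = 1 / (T : ℝ) ^ (2 / 3 : ℝ)) →
      (∀ t, β t = 1 / (T : ℝ) ^ (1 / 3 : ℝ)) →
      m.IsTrajectory πb Pr st ac →
      (∀ᵐ ω ∂Pr, ∀ t ≤ T,
        ‖(greedyGQ m φ π α β θ₀ ω₀ (fun i => st i ω) (fun i => ac i ω) t).1‖ ≤ R ∧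
        ‖(greedyGQ m φ π α β θ₀ ω₀ (fun i => st i ω) (fun i => ac i ω) t).2‖ ≤ R) →
      k₀ ≤ 1 →
      IsStepSizeWeighted Pr M α k₀ T →
      IndepFun M (fun ω t => (st t ω, ac t ω)) Pr →
      Integrable (fun ω => ‖gradient (MSPBE m φ π μ)
        (greedyGQ m φ π α β θ₀ ω₀ (fun i => st i ω) (fun i => ac i ω) (M ω)).1‖ ^ 2) Pr ∧
      ∫ ω, ‖gradient (MSPBE m φ π μ)
        (greedyGQ m φ π α β θ₀ ω₀ (fun i => st i ω) (fun i => ac i ω) (M ω)).1‖ ^ 2 ∂Pr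
        ≤ K * (Real.log T / (T : ℝ) ^ (1 / 3 : ℝ))) ∧
    -- `(2/3, 1/3)` gives this rate, and strictly the best one, among the admissible exponents
    (rateBound (2 / 3) (1 / 3) =Θ[atTop] fun T : ℕ => Real.log T / (T : ℝ) ^ (1 / 3 : ℝ)) ∧
    (∀ a b : ℝ, 1 / 2 < a → a ≤ 1 → 0 < b → b ≤ a → (a, b) ≠ (2 / 3, 1 / 3) →
      rateBound (2 / 3) (1 / 3) =o[atTop] rateBound a b) := by
  refine ⟨fun θ => (hasGradientAt_MSPBE hφm hφ hC hπ hsmooth θ).differentiableAt, ?_,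
    rateBound_isTheta, fun a b _ _ _ _ hab => ?_⟩
  · obtain ⟨K, hK, hsum⟩ := exists_sum_gradMSPBE_le hμ hc.le hρ.le hρ' hmix hφm hφ hC hπ hsmooth R
    obtain ⟨B, hB, hgB⟩ :=
      bddLipOn_gradMSPBE (Y := Unit) (m := m) (μ := μ) (r := R) hφm hφ hπ hsmooth
    -- The argument gives (K + B²) T^{-1/3}; for T ≥ 2 the ratio log T / log 2 is at least 1.
    refine ⟨(K + B ^ 2) / Real.log 2, ?_⟩
    intro T hT Ω _ Pr _ st ac M k₀ θ₀ ω₀ α β hα hβ htraj hbdd hk₀ hM hind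
    have hT0 : (0 : ℝ) < T := by exact_mod_cast (by omega : 0 < T)
    have hT1 : (1 : ℝ) ≤ T := by exact_mod_cast (by omega : 1 ≤ T)
    set p : ℝ := (T : ℝ) ^ (1 / 3 : ℝ) with hp
    have hp1 : 1 ≤ p := Real.one_le_rpow hT1 (by norm_num)
    have hp0 : 0 < p := by linarith
    have hp3 : (T : ℝ) = p ^ 3 := by
      rw [hp, ← Real.rpow_natCast, ← Real.rpow_mul hT0.le]; norm_num
    have hp2 : (T : ℝ) ^ (2 / 3 : ℝ) = p ^ 2 := by
      rw [hp, ← Real.rpow_natCast, ← Real.rpow_mul hT0.le]; norm_num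
    rw [hp2] at hα
    have hbdd' : ∀ᵐ ω ∂Pr, ∀ t ≤ T,
        greedyGQ m φ π α β θ₀ ω₀ (fun i => st i ω) (fun i => ac i ω) t
          ∈ Metric.closedBall 0 R := by
      filter_upwards [hbdd] with ω hω t ht
      rw [mem_closedBall_zero_iff]
      exact norm_prod_le_iff.2 (hω t ht)
    have hsumT := hsum Ω Pr st ac θ₀ ω₀ α β T p hp1 hp3 hα hβ htraj hbdd'
    simp_rw [gradient_MSPBE hφm hφ hC hπ hsmooth]
    let H : ℕ → (ℕ → S × A) → ℝ := fun k y => ‖gradMSPBE m φ π μ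
      (greedyGQ m φ π α β θ₀ ω₀ (fun i => (y i).1) (fun i => (y i).2) k).1‖ ^ 2
    have hH : ∀ k, Measurable (H k) := fun k =>
      ((measurable_gradMSPBE hφm hφ hπ hsmooth).comp (measurable_greedyGQ hφm hsmooth α β θ₀ ω₀
        (s := fun (y : ℕ → S × A) i => (y i).1) (a := fun (y : ℕ → S × A) i => (y i).2)
        (fun i => by fun_prop) (fun i => by fun_prop) k).fst).norm.pow_const 2
    have hY : Measurable fun ω t => (st t ω, ac t ω) :=
      measurable_pi_lambda _ fun t => (htraj.measurable_state t).prodMk (htraj.measurable_action t)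
    have hHB : ∀ᵐ ω ∂Pr, ∀ t ≤ T, H t (fun t => (st t ω, ac t ω)) ≤ B ^ 2 := by
      filter_upwards [hbdd] with ω hω t ht
      exact pow_le_pow_left₀ (norm_nonneg _)
        (hgB () _ (mem_closedBall_zero_iff.2 (hω t ht).1)).1 2
    obtain ⟨hint, hle⟩ := hM.integral_le (a := 1 / p ^ 2) (by positivity) hα hk₀ (by omega) hY
      hind hH (fun k x => sq_nonneg _) hHB
    refine ⟨hint, hle.trans ?_⟩
    -- M may equal T, while the summed bound covers only t < T; the last term is bounded separately.
    have hlast : ∫ ω, H T (fun t => (st t ω, ac t ω)) ∂Pr ≤ B ^ 2 := by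
      refine (le_abs_self _).trans (abs_integral_le_of_abs_le ?_)
      filter_upwards [hHB] with ω hω
      rw [abs_of_nonneg (sq_nonneg _)]
      exact hω T le_rfl
    rw [Finset.sum_range_succ]
    have htotal : ∑ t ∈ Finset.range T, ∫ ω, H t (fun t => (st t ω, ac t ω)) ∂Pr
        + ∫ ω, H T (fun t => (st t ω, ac t ω)) ∂Pr ≤ (K + B ^ 2) * p ^ 2 := by
      have h1 : B ^ 2 ≤ B ^ 2 * p ^ 2 := le_mul_of_one_le_right (sq_nonneg B) (one_le_pow₀ hp1)
      have h2 := add_le_add hsumT (hlast.trans h1)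
      rw [add_mul]
      exact h2
    have hlog2 : 0 < Real.log 2 := Real.log_pos one_lt_two
    have hlog : Real.log 2 ≤ Real.log T := Real.log_le_log two_pos (by exact_mod_cast hT)
    calc _ ≤ 1 / (T : ℝ) * ((K + B ^ 2) * p ^ 2) := mul_le_mul_of_nonneg_left htotal (by positivity)
      _ = (K + B ^ 2) / Real.log 2 * (Real.log 2 / p) := by
        rw [hp3]; field_simp
      _ ≤ (K + B ^ 2) / Real.log 2 * (Real.log T / p) := by gcongr
  · refine rateBound_isTheta.1.trans_isLittleO (log_div_rpow_isLittleO_rateBound ?_)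
    -- If both alternatives fail, then a ≤ 2/3, b ≥ 1/3 and a - b ≥ 1/3, which forces (a, b) = (2/3,
    -- 1/3).
    by_contra! h
    obtain ⟨h1, h2⟩ := h
    have h3 := h2.trans (min_le_left _ _)
    have h4 := h2.trans (min_le_right _ _)
    exact hab (Prod.ext (by simp only; linarith) (by simp only; linarith))

end
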